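/- \textbf{Definitions.} All graphs are finite, simple and nonempty. For a poset $P=(V,\le)$, the cover-incomparability graph $G_P$ has vertex set $V$, and $uv$ is an edge iff $u$ covers $v$, $v$ covers $u$, or $u$ and $v$ are incomparable. A graph is a \emph{C-I graph} if it equals $G_P$ for some poset $P$ on its vertex set. A \emph{cograph} is a graph with no induced path on four vertices; a \emph{C-I cograph} is a cograph that is a C-I graph. A poset is \emph{completely ranked} if it has a rank function $\rho:V\to\mathbb Z$, with $\rho=0$ on the minimal elements and $\rho(b)=\rho(a)+1$ whenever $b$ covers $a$, such that every element of rank $i$ covers all elements of rank $i-1$. Its \emph{rank} is the largest value of $\rho$. The \emph{sum} $P_1+\dots+P_r$ of disjoint posets is their disjoint union: $z_1\le z_2$ in the sum iff $z_1\le z_2$ in some $P_i$. A \emph{cotree} of $G$ is a rooted tree whose leaves are the vertices of $G$, in which every internal node has at least two children and is labelled $0$ or $1$, the labels alternate between internal nodes joined by an edge, and two distinct vertices are adjacent in $G$ iff their lowest common ancestor is labelled $1$. The family $\mathcal T_C$ consists of the one-node tree and of the cotrees whose root is a $1$-node with at most as many $0$-nodes as leaves among its children, in which every $0$-node has exactly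 two children and every $1$-node other than the root has only leaves as children. \textbf{Model.} A program is a fixed text for a random access machine with finitely many registers and arrays of natural numbers, with unit-cost copying, indirect addressing, addition, truncated subtraction and comparison. The numbers it stores are bounded by a fixed power of $n+2$. The input graph, with vertices $0,\dots,n-1$ and $m$ edges, is given by $n$ and its adjacency lists, each in arbitrary order. \textbf{Theorem.} There is a program, consisting of a construction phase followed, if the construction succeeds, by a checking phase, with the following properties for every graph $G$ with $n\ge 1$ vertices and $m$ edges. (1) It halts after $O(n+m)$ steps and reports correctly whether $G$ is not a cograph, is a cograph but not a C-I graph, or is a C-I cograph. If $G$ is a C-I cograph, it also outputs a poset $P$ with $G_P=G$, as a sum $P=P_1+\dots+P_r$ of nonempty completely ranked posets of rank at most $2$ (by giving, for each vertex, the index of its summand and its rank there). If moreover $G$ is not complete, then every $P_i$ has rank exactly $2$. (2) The construction phase takes $O(n+m)$ steps. It reports that $G$ is not a cograph if this is so, and otherwise outputs the cotree $T$ of $G$. The graph $G$ is then a C-I graph if and only if $T\in\mathcal T_C$. (3) If $G$ is a cograph, the checking phase, started on the memory left by the construction phase, takes $O(n)$ steps. It decides whether $T\in\mathcal T_C$,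 and if so outputs the poset of (1). The implied constants, and the power of $n+2$, do not depend on $G$. -/

import Mathlib

namespace CICograph

/-! ### Posets, ranked posets, sums of posets, cover-incomparability graphs -/

/-- The cover-incomparability graph of a poset `P`: distinct `u`, `v` are adjacent when one of
them covers the other or when they are incomparable. -/
def coverIncompGraph {V : Type*} (P : PartialOrder V) : SimpleGraph V where
  Adj u v := u ⋖ v ∨ v ⋖ u ∨ (¬ u ≤ v ∧ ¬ v ≤ u)
  symm := ⟨fun _ _ h => by tauto⟩
  loopless := ⟨fun u h => by
    rcases h with h | h | h
    · exact h.lt.false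
    · exact h.lt.false
    · exact h.1 le_rfl⟩

/-- `G` is a C-I graph: the cover-incomparability graph of some poset on its vertex set. -/
def IsCIGraph {V : Type*} (G : SimpleGraph V) : Prop :=
  ∃ P : PartialOrder V, coverIncompGraph P = G

/-- `G` is a cograph: it has no induced path on four vertices. -/
def IsCograph {V : Type*} (G : SimpleGraph V) : Prop :=
  ¬ (SimpleGraph.pathGraph 4).IsIndContained G

/-- `ρ` is a rank function of `P`: it is `0` on the minimal elements and goes up by one along
covering relations. -/
def IsRankFunction {V : Type*} (P : PartialOrder V) (ρ : V → ℤ) : Prop :=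
  (∀ v, IsMin v → ρ v = 0) ∧ ∀ a b : V, a ⋖ b → ρ b = ρ a + 1

/-- `P` is completely ranked with rank function `ρ`: moreover every element of rank `i` covers
all elements of rank `i - 1`. -/
def IsCompletelyRanked {V : Type*} (P : PartialOrder V) (ρ : V → ℤ) : Prop :=
  IsRankFunction P ρ ∧ ∀ a b : V, ρ a = ρ b - 1 → a ⋖ b

/-- `P` is the sum (disjoint union) of the posets `Q i`, whose ground sets are the classes
`{v | κ v = i}` of a partition of `V`. -/
def IsPosetSum {V ι : Type*} (P : PartialOrder V) (κ : V → ι)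
    (Q : ∀ i, PartialOrder {v : V // κ v = i}) : Prop :=
  ∀ u v : V, u ≤ v ↔ ∃ (i : ι) (hu : κ u = i) (hv : κ v = i), (Q i).le ⟨u, hu⟩ ⟨v, hv⟩

/-! ### Cotrees -/

/-- A cotree with leaves indexed by `V` and `N` nodes, given by its parent map (the root is its own
parent).  `label x = true` means that the internal node `x` is a 1-node, `label x = false` that it
is a 0-node; the label of a leaf has no meaning. -/
structure Cotree (V : Type*) (N : ℕ) where
  root : Fin N
  parent : Fin N → Fin N
  label : Fin N → Bool
  leaf : V → Fin N
  parent_root : parent root = root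
  reaches_root : ∀ x, ∃ k : ℕ, parent^[k] x = root
  leaf_injective : Function.Injective leaf
  /-- the leaves are the nodes without children -/
  leaf_iff : ∀ x, (∃ v, leaf v = x) ↔ ∀ y, ¬ (y ≠ root ∧ parent y = x)
  /-- every internal node has at least two children -/
  two_children : ∀ x, (¬ ∃ v, leaf v = x) →
    ∃ y z, y ≠ z ∧ (y ≠ root ∧ parent y = x) ∧ (z ≠ root ∧ parent z = x)
  /-- labels alternate along the edges between internal nodes -/
  alternate : ∀ y, y ≠ root → (¬ ∃ v, leaf v = y) → label y ≠ label (parent y)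

namespace Cotree

variable {V : Type*} {N : ℕ} (T : Cotree V N)

/-- `y` is a child of `x`. -/
def IsChild (y x : Fin N) : Prop := y ≠ T.root ∧ T.parent y = x

def IsLeaf (x : Fin N) : Prop := ∃ v, T.leaf v = x

def IsOneNode (x : Fin N) : Prop := ¬ T.IsLeaf x ∧ T.label x = true

def IsZeroNode (x : Fin N) : Prop := ¬ T.IsLeaf x ∧ T.label x = false

/-- `x` is an ancestor of `y` (possibly `y` itself). -/
def IsAncestor (x y : Fin N) : Prop := ∃ k : ℕ, T.parent^[k] y = x

/-- `z` is the lowest common ancestor of `x` and `y`. -/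
def IsLCA (z x y : Fin N) : Prop :=
  T.IsAncestor z x ∧ T.IsAncestor z y ∧
    ∀ w, T.IsAncestor w x → T.IsAncestor w y → T.IsAncestor w z

/-- The graph of a cotree: its vertices are the leaves, and two of them are adjacent when their
lowest common ancestor is a 1-node. -/
def graph : SimpleGraph V where
  Adj u v := u ≠ v ∧ ∃ z, T.IsLCA z (T.leaf u) (T.leaf v) ∧ T.IsOneNode z
  symm := ⟨fun _ _ h => by
    obtain ⟨huv, z, ⟨h1, h2, h3⟩, hz⟩ := h
    exact ⟨huv.symm, z, ⟨h2, h1, fun w hu hv => h3 w hv hu⟩, hz⟩⟩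
  loopless := ⟨fun _ h => h.1 rfl⟩

/-- The family `𝒯_C`: the one-node tree (the cotree of `K₁`), and the cotrees whose root is a
1-node with at most as many 0-nodes as leaves among its children, in which every 0-node has exactly
two children and every 1-node other than the root has only leaves as children. -/
def InTC : Prop :=
  T.IsLeaf T.root ∨
    (T.IsOneNode T.root ∧
      {y | T.IsChild y T.root ∧ T.IsZeroNode y}.ncard
        ≤ {y | T.IsChild y T.root ∧ T.IsLeaf y}.ncard ∧
      (∀ x, T.IsZeroNode x → {y | T.IsChild y x}.ncard = 2) ∧
      ∀ x, T.IsOneNode x → x ≠ T.root → ∀ y, T.IsChild y x → T.IsLeaf y)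

end Cotree

/-! ### The machine model: a random access machine with unit-cost operations

A program is a fixed finite text over finitely many registers and finitely many arrays of natural
numbers.  Every operation costs one step, and nothing larger than the word bound `W` may ever be
stored. -/

/-- Memory: `reg i` is the content of register `i`, `arr a j` that of cell `j` of array `a`. -/
structure Memory where
  reg : ℕ → ℕ
  arr : ℕ → ℕ → ℕ

namespace Memory

def setReg (s : Memory) (i v : ℕ) : Memory :=
  { s with reg := Function.update s.reg i v }

def setArr (s : Memory) (a j v : ℕ) : Memory :=
  { s with arr := Function.update s.arr a (Function.update (s.arr a) j v) }

end Memory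

/-- Expressions: constants, registers, array reads (indirect addressing), addition, truncated
subtraction, and comparisons. -/
inductive Expr where
  | lit (k : ℕ)
  | reg (i : ℕ)
  | read (a : ℕ) (e : Expr)
  | add (e f : Expr)
  | sub (e f : Expr)
  | eq (e f : Expr)
  | lt (e f : Expr)

namespace Expr

def eval (s : Memory) : Expr → ℕ
  | lit k => k
  | reg i => s.reg i
  | read a e => s.arr a (e.eval s)
  | add e f => e.eval s + f.eval s
  | sub e f => e.eval s - f.eval s
  | eq e f => if e.eval s = f.eval s then 1 else 0
  | lt e f => if e.eval s < f.eval s then 1 else 0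

/-- The number of steps needed to evaluate an expression: one per operation. -/
def cost : Expr → ℕ
  | lit _ => 1
  | reg _ => 1
  | read _ e => e.cost + 1
  | add e f => e.cost + f.cost + 1
  | sub e f => e.cost + f.cost + 1
  | eq e f => e.cost + f.cost + 1
  | lt e f => e.cost + f.cost + 1

end Expr

/-- Programs; a test `b` succeeds when its value is not `0`. -/
inductive Program where
  | skip
  | set (i : ℕ) (e : Expr)
  | write (a : ℕ) (e f : Expr)
  | seq (p q : Program)
  | ite (b : Expr) (p q : Program)
  | loop (b : Expr) (p : Program)

/-- `Run W p s t s'`: with word bound `W`, program `p` started in memory `s` halts after exactly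
`t` steps in memory `s'`. -/
inductive Run (W : ℕ) : Program → Memory → ℕ → Memory → Prop where
  | skip (s : Memory) : Run W .skip s 1 s
  | set (s : Memory) (i : ℕ) (e : Expr) (h : e.eval s ≤ W) :
      Run W (.set i e) s (e.cost + 1) (s.setReg i (e.eval s))
  | write (s : Memory) (a : ℕ) (e f : Expr) (h : f.eval s ≤ W) :
      Run W (.write a e f) s (e.cost + f.cost + 1) (s.setArr a (e.eval s) (f.eval s))
  | seq (p q : Program) (s₁ s₂ s₃ : Memory) (t₁ t₂ : ℕ) (h₁ : Run W p s₁ t₁ s₂)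
      (h₂ : Run W q s₂ t₂ s₃) : Run W (.seq p q) s₁ (t₁ + t₂) s₃
  | ite_true (b : Expr) (p q : Program) (s s' : Memory) (t : ℕ) (hb : b.eval s ≠ 0)
      (h : Run W p s t s') : Run W (.ite b p q) s (b.cost + 1 + t) s'
  | ite_false (b : Expr) (p q : Program) (s s' : Memory) (t : ℕ) (hb : b.eval s = 0)
      (h : Run W q s t s') : Run W (.ite b p q) s (b.cost + 1 + t) s'
  | loop_stop (b : Expr) (p : Program) (s : Memory) (hb : b.eval s = 0) :
      Run W (.loop b p) s (b.cost + 1) s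
  | loop_step (b : Expr) (p : Program) (s₁ s₂ s₃ : Memory) (t₁ t₂ : ℕ) (hb : b.eval s₁ ≠ 0)
      (h₁ : Run W p s₁ t₁ s₂) (h₂ : Run W (.loop b p) s₂ t₂ s₃) :
      Run W (.loop b p) s₁ (b.cost + 1 + t₁ + t₂) s₃

/-- With word bound `W`, program `p` started in `s` halts within `B` steps, in a memory that
satisfies `Q`. -/
def RunsWithin (W : ℕ) (p : Program) (s : Memory) (B : ℕ) (Q : Memory → Prop) : Prop :=
  ∃ (t : ℕ) (s' : Memory), Run W p s t s' ∧ t ≤ B ∧ Q s'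

/-! ### Input and output conventions -/

/-- `adj` lists, in any order and without repetition, the neighbours of every vertex of `G`. -/
def IsAdjacencyLists {n : ℕ} (G : SimpleGraph (Fin n)) (adj : Fin n → List (Fin n)) : Prop :=
  ∀ v, (adj v).Nodup ∧ ∀ w, w ∈ adj v ↔ G.Adj v w

/-- The initial memory: register `0` holds `n`; array `1` holds the adjacency lists of the vertices
`0, …, n - 1` one after the other; cells `v` and `v + 1` of array `0` tell where the list of `v`
starts and where it ends.  Everything else is `0`. -/
def inputMemory (n : ℕ) (adj : Fin n → List (Fin n)) : Memory where
  reg i := if i = 0 then n else 0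
  arr a j :=
    if a = 0 then
      if j ≤ n then (((List.ofFn adj).take j).map List.length).sum else 0
    else if a = 1 then ((List.ofFn adj).flatten.map Fin.val).getD j 0
    else 0

/-- The memory `s` stores the cotree `T`: register `1` holds the number of nodes and register `2`
the root, node `v < n` is the leaf of the vertex `v`, array `2` is the parent map, and array `3`
holds the labels of the internal nodes. -/
def StoresCotree {n N : ℕ} (s : Memory) (T : Cotree (Fin n) N) : Prop :=
  s.reg 1 = N ∧ s.reg 2 = T.root ∧
    (∀ v : Fin n, (T.leaf v : ℕ) = v) ∧
    (∀ x : Fin N, s.arr 2 x = T.parent x) ∧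
    ∀ x : Fin N, ¬ T.IsLeaf x → s.arr 3 x = if T.label x then 1 else 0

/-- The memory `s` stores the poset `P` as a sum of (nonempty) completely ranked posets
`P_0 + ⋯ + P_(r-1)`: register `3` holds `r`, array `4` tells for every element in which summand it
lies, and array `5` its rank there.  All ranks are at most `2`, and if `exact` holds then every
summand has rank exactly `2`.  (The order of a completely ranked poset is determined by its rank
function, hence `P` by what is stored.) -/
def StoresPoset {n : ℕ} (s : Memory) (P : PartialOrder (Fin n)) (exact : Prop) : Prop :=
  ∃ (κ : Fin n → Fin (s.reg 3)) (Q : ∀ i, PartialOrder {v : Fin n // κ v = i}),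
    (∀ v : Fin n, s.arr 4 v = κ v) ∧ Function.Surjective κ ∧ IsPosetSum P κ Q ∧
    (∀ i, IsCompletelyRanked (Q i) fun v => (s.arr 5 (v : Fin n) : ℤ)) ∧
    (∀ v : Fin n, s.arr 5 v ≤ 2) ∧
    (exact → ∀ i, ∃ v : Fin n, κ v = i ∧ s.arr 5 v = 2)

/-- The whole algorithm: build the cotree; register `0` then tells whether this succeeded, and if
so the cotree is checked. -/
def recognizer (build check : Program) : Program :=
  .seq build (.ite (.reg 0) check .skip)

end CICograph

open CICograph

/-! The construction inserts the vertices one by one into a cotree. Relative to the new vertex `v`,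
a node is full if all leaves below it are neighbours of `v`, mixed if it is not full but has a full
child, and partial if leaves of both kinds lie below it. Without induced paths on four vertices, the
siblings of a partial node are forced: the leaves below them are all neighbours of `v` if the common
parent is a 1-node, and none of them is if it is a 0-node (`sibling_of_partial`). Hence the partial
nodes form the path from the root down to a lowest one `β`, which is mixed; strictly above `β`, a
1-node has all children but one full, and a 0-node has no full child (`exists_bottom`). Conversely,
if all mixed nodes lie above a mixed node `β` and the nodes above `β` have this form, then `v` can
be inserted by a local change at `β` (`IsFull.isSite` and the `attachable_` lemmas). So a violation
proves that there is an induced path.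

The cost of an insertion is linear in the length of the adjacency list, plus a constant. Fullness is
propagated upwards from the `k` earlier neighbours; as internal nodes have at least two children, at
most `2 * k` nodes become full and at most `k` nodes have a full child (`queue_le_two_mul`,
`MarkInv.potential`). Labels alternate and the 1-nodes above `β` are mixed, so every mixed node
except `β` is the parent or the grandparent of a mixed node. This singles out `β` without a search
(`exists_unflagged`, `bottom_of_unflagged`), and it bounds the climb from `β` to the root by about
twice the number of mixed nodes (`walk_spec`). Lists of children are not needed: the number and the
sum of the children of a node suffice, since a single remaining child is a difference of two sums.
Scratch cells are never erased; every insertion works in a fresh block of zeros.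

As for the family `𝒯_C`: in a cover-incomparability graph two distinct vertices are nonadjacent iff
some element lies strictly between them. A chain of four elements would give an induced path
(`no_chain`). So in a C-I cograph the middle of a chain of three elements is adjacent to everything
(`adj_of_between`), and no three vertices are pairwise nonadjacent (`no_triangle`). Universal
vertices force the root to be a 1-node and are children of it; the absence of independent triples
puts the 0-nodes directly below the root and gives them two children; and distinct 0-nodes need
distinct universal vertices (`inFamily_of_order`). Conversely, every 0-node of a tree in the family
yields a summand: the leaves below its two children have ranks 0 and 2, and a leaf child of the root
of its own has rank 1; the remaining leaf children of the root join the summand 0 (`adj_iff_ranks`,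
`exists_poset`). The checking phase computes exactly this poset, and its run proves that membership
in the family is sufficient (`two_phases`). -/

namespace CICograph

/-! ### Rooted trees on natural numbers, given by a parent map -/

/-- `Anc par r x w`: the node `x` is reached from `w` by iterating `par`, without passing `r`. -/
inductive Anc (par : ℕ → ℕ) (r : ℕ) : ℕ → ℕ → Prop
  | refl (x : ℕ) : Anc par r x x
  | up {x w : ℕ} (h : w ≠ r) (h' : Anc par r x (par w)) : Anc par r x w

namespace Anc

variable {par : ℕ → ℕ} {r x y z w : ℕ}

theorem trans (h : Anc par r x y) (h' : Anc par r y z) : Anc par r x z := by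
  induction h' with
  | refl => exact h
  | up hw _ ih => exact .up hw ih

theorem parent (hw : w ≠ r) : Anc par r (par w) w := .up hw (.refl _)

theorem root_right (h : Anc par r x r) : x = r := by
  cases h with
  | refl => rfl
  | up h => exact absurd rfl h

theorem of_ne (h : Anc par r x w) (hx : x ≠ w) : w ≠ r ∧ Anc par r x (par w) := by
  cases h with
  | refl => exact absurd rfl hx
  | up h h' => exact ⟨h, h'⟩

theorem exists_child (h : Anc par r x w) (hx : x ≠ w) :
    ∃ d, d ≠ r ∧ par d = x ∧ Anc par r d w := by
  induction h with
  | refl => exact absurd rfl hx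
  | @up w hw h' ih =>
    by_cases hxw : x = par w
    · exact ⟨w, hw, hxw.symm, .refl _⟩
    · obtain ⟨d, h1, h2, h3⟩ := ih hxw
      exact ⟨d, h1, h2, .up hw h3⟩

theorem comparable (h : Anc par r x w) (h' : Anc par r y w) : Anc par r x y ∨ Anc par r y x := by
  induction h with
  | refl => exact .inr h'
  | @up w hw h1 ih =>
    cases h' with
    | refl => exact .inl (.up hw h1)
    | up _ h2 => exact ih h2

/-- Below the root there is no cycle. -/
theorem not_parent (h : Anc par r r w) (hw : w ≠ r) : ¬ Anc par r w (par w) := by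
  induction h with
  | refl => exact absurd rfl hw
  | @up w _ h' ih =>
    intro h1
    by_cases hp : par w = r
    · rw [hp] at h1
      exact hw h1.root_right
    · by_cases he : w = par w
      · exact ih hp (by rw [← he, ← he]; exact .refl _)
      · obtain ⟨_, h2⟩ := h1.of_ne he
        exact ih hp ((parent hw).trans h2)

theorem antisymm (hr : Anc par r r w) (h : Anc par r x w) (h' : Anc par r w x) : x = w := by
  by_contra hne
  obtain ⟨hw, h1⟩ := h.of_ne hne
  exact not_parent hr hw (h'.trans h1)

end Anc

/-- A tree in memory: root, number of the next fresh node, parents, labels, numbers of children and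
sums of children. -/
structure PT where
  root : ℕ
  fresh : ℕ
  par : ℕ → ℕ
  lab : ℕ → ℕ
  nc : ℕ → ℕ
  cs : ℕ → ℕ

namespace PT

/-- `x` is an ancestor of `w` in `T`. -/
def A (T : PT) (x w : ℕ) : Prop := Anc T.par T.root x w

/-- The children of `x` among the nodes in `X`. -/
def ch (T : PT) (X : Finset ℕ) (x : ℕ) : Finset ℕ := {c ∈ X | c ≠ T.root ∧ T.par c = x}

theorem mem_ch {T : PT} {X : Finset ℕ} {c x : ℕ} :
    c ∈ T.ch X x ↔ c ∈ X ∧ c ≠ T.root ∧ T.par c = x := by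
  simp [ch]

/-- `T` is a rooted tree with node set `X`, all nodes in `V` being leaves. -/
structure IsTree (T : PT) (X V : Finset ℕ) : Prop where
  root_mem : T.root ∈ X
  reach : ∀ x ∈ X, T.A T.root x
  par_mem : ∀ x ∈ X, x ≠ T.root → T.par x ∈ X ∧ T.par x ∉ V
  sub : V ⊆ X

/-- Any two distinct leaves meet in a node whose label tells whether they are adjacent. -/
def Meets (T : PT) (X V : Finset ℕ) (adj : ℕ → ℕ → Prop) : Prop :=
  ∀ u ∈ V, ∀ w ∈ V, u ≠ w → ∃ z c d, c ≠ d ∧ c ∈ T.ch X z ∧ d ∈ T.ch X z ∧ T.A c u ∧ T.A d w ∧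
    (adj u w ↔ T.lab z = 1)

/-- The remaining conditions on a cotree, and the correctness of the child counts and sums. The
labels need not alternate between a node of `E` and its parent. -/
structure IsReduced (T : PT) (X V E : Finset ℕ) : Prop where
  two : ∀ x ∈ X, x ∉ V → 2 ≤ (T.ch X x).card
  lab_le : ∀ x ∈ X, x ∉ V → T.lab x ≤ 1
  alt : ∀ x ∈ X, x ∉ V → x ∉ E → x ≠ T.root → T.lab x ≠ T.lab (T.par x)
  nc_eq : ∀ x ∈ X, x ∉ V → T.nc x = (T.ch X x).card
  cs_eq : ∀ x ∈ X, x ∉ V → T.cs x = ∑ c ∈ T.ch X x, c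
  par_root : T.par T.root = T.root

/-! ### Ancestors, siblings and forks in a rooted tree. -/

namespace IsTree

variable {T : PT} {X V E : Finset ℕ} {x y z w c d u : ℕ}

theorem mem_of_anc (h : T.IsTree X V) (hw : w ∈ X) (hx : T.A x w) : x ∈ X := by
  unfold A at hx
  induction hx with
  | refl => exact hw
  | @up w hw' _ ih => exact ih (h.par_mem w hw hw').1

theorem antisymm (h : T.IsTree X V) (hw : w ∈ X) (h1 : T.A x w) (h2 : T.A w x) : x = w :=
  Anc.antisymm (h.reach w hw) h1 h2

theorem anc_leaf (h : T.IsTree X V) (hw : w ∈ X) (hx : x ∈ V) (hxw : T.A x w) : x = w := by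
  by_contra hne
  obtain ⟨d, hd, hd', hdw⟩ := Anc.exists_child hxw hne
  exact (h.par_mem d (h.mem_of_anc hw hdw) hd).2 (hd' ▸ hx)

theorem exists_child (h : T.IsTree X V) (hw : w ∈ X) (hx : T.A x w) (hne : x ≠ w) :
    ∃ d ∈ T.ch X x, T.A d w := by
  obtain ⟨d, hd, hd', hdw⟩ := Anc.exists_child hx hne
  exact ⟨d, mem_ch.2 ⟨h.mem_of_anc hw hdw, hd, hd'⟩, hdw⟩

theorem anc_of_ch (hc : c ∈ T.ch X x) : T.A x c := by
  obtain ⟨_, h1, h2⟩ := mem_ch.1 hc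
  exact .up h1 (h2 ▸ .refl _)

theorem ne_of_ch (h : T.IsTree X V) (hc : c ∈ T.ch X x) : c ≠ x := by
  obtain ⟨h0, h1, h2⟩ := mem_ch.1 hc
  rintro rfl
  exact Anc.not_parent (h.reach c h0) h1 (by rw [h2]; exact .refl _)

theorem not_anc_of_ch (h : T.IsTree X V) (hc : c ∈ T.ch X x) : ¬ T.A c x := by
  intro h'
  exact h.ne_of_ch hc (h.antisymm (mem_ch.1 hc).1 (anc_of_ch hc) h').symm

theorem mem_of_ch (h : T.IsTree X V) (hc : c ∈ T.ch X x) : x ∈ X ∧ x ∉ V := by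
  obtain ⟨h0, h1, h2⟩ := mem_ch.1 hc
  exact h2 ▸ h.par_mem c h0 h1

/-- Siblings are not comparable. -/
theorem sibling_eq (h : T.IsTree X V) (hc : c ∈ T.ch X x) (hd : d ∈ T.ch X x) (hcd : T.A c d) :
    c = d := by
  by_contra hne
  obtain ⟨_, h1⟩ := Anc.of_ne hcd hne
  rw [(mem_ch.1 hd).2.2] at h1
  exact h.not_anc_of_ch hc h1

theorem sibling_eq_of_anc (h : T.IsTree X V) (hc : c ∈ T.ch X x) (hd : d ∈ T.ch X x)
    (hcu : T.A c u) (hdu : T.A d u) : c = d := by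
  rcases Anc.comparable hcu hdu with h1 | h1
  · exact h.sibling_eq hc hd h1
  · exact (h.sibling_eq hd hc h1).symm

/-- The path from `u` to the root enters the path from `y` to the root. -/
theorem exists_branch (h : T.IsTree X V) (hu : u ∈ X) (hy : y ∈ X) :
    T.A u y ∨ ∃ z, ∃ c ∈ T.ch X z, T.A z y ∧ T.A c u ∧ ¬ T.A c y := by
  have key : ∀ w, Anc T.par T.root T.root w → w ∈ X →
      T.A w y ∨ ∃ z, ∃ c ∈ T.ch X z, T.A z y ∧ T.A c w ∧ ¬ T.A c y := by
    intro w hw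
    induction hw with
    | refl => exact fun _ => .inl (h.reach y hy)
    | @up w hw h' ih =>
      intro hwX
      by_cases hwy : T.A w y
      · exact .inl hwy
      · rcases ih (h.par_mem w hwX hw).1 with h1 | ⟨z, c, hc, hz, hcw, hcy⟩
        · exact .inr ⟨T.par w, w, mem_ch.2 ⟨hwX, hw, rfl⟩, h1, .refl _, hwy⟩
        · exact .inr ⟨z, c, hc, hz, .up hw hcw, hcy⟩
  exact key u (h.reach u hu) hu

/-- Two incomparable nodes lie below different children of some node. -/
theorem exists_fork (h : T.IsTree X V) (hu : u ∈ X) (hy : y ∈ X) (h1 : ¬ T.A u y)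
    (h2 : ¬ T.A y u) :
    ∃ z c d, c ≠ d ∧ c ∈ T.ch X z ∧ d ∈ T.ch X z ∧ T.A c u ∧ T.A d y := by
  rcases h.exists_branch hu hy with h3 | ⟨z, c, hc, hz, hcu, hcy⟩
  · exact absurd h3 h1
  · by_cases hzy : z = y
    · exact absurd ((anc_of_ch hc).trans hcu) (hzy ▸ h2)
    · obtain ⟨d, hd, hdy⟩ := h.exists_child hy hz hzy
      exact ⟨z, c, d, fun e => hcy (e ▸ hdy), hc, hd, hcu, hdy⟩

/-- If `z` separates `u` from `w` and `z'` lies above both, then `z'` lies above `z`. -/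
theorem anc_fork (h : T.IsTree X V) (hu : u ∈ X) (hc : c ∈ T.ch X z) (hd : d ∈ T.ch X z)
    (hcd : c ≠ d) (hcu : T.A c u) (hdw : T.A d w) (hw : w ∈ X) (h1 : T.A y u) (h2 : T.A y w) :
    T.A y z := by
  have aux : ∀ {c w}, c ∈ T.ch X z → T.A c w → w ∈ X → T.A y w → T.A y z ∨ T.A c y := by
    intro c w hc hcw hw hyw
    rcases Anc.comparable hcw hyw with h3 | h3
    · exact .inr h3
    · by_cases e : y = c
      · exact .inr (e ▸ .refl _)
      · have := (Anc.of_ne h3 e).2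
        rw [(mem_ch.1 hc).2.2] at this
        exact .inl this
  rcases aux hc hcu hu h1 with h3 | h3
  · exact h3
  rcases aux hd hdw hw h2 with h4 | h4
  · exact h4
  exact absurd (h.sibling_eq_of_anc hc hd h3 h4) hcd

/-- Each of the two forks is a common ancestor of `u` and `w`, so by `anc_fork` each lies above the
other. -/
theorem fork_unique (h : T.IsTree X V) (hu : u ∈ X) (hw : w ∈ X) {z' c' d' : ℕ}
    (hc : c ∈ T.ch X z) (hd : d ∈ T.ch X z) (hcd : c ≠ d) (hcu : T.A c u) (hdw : T.A d w)
    (hc' : c' ∈ T.ch X z') (hd' : d' ∈ T.ch X z') (hcd' : c' ≠ d') (hcu' : T.A c' u)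
    (hdw' : T.A d' w) : z = z' :=
  h.antisymm (h.mem_of_ch hc').1
    (h.anc_fork hu hc' hd' hcd' hcu' hdw' hw ((anc_of_ch hc).trans hcu) ((anc_of_ch hd).trans hdw))
    (h.anc_fork hu hc hd hcd hcu hdw hw ((anc_of_ch hc').trans hcu') ((anc_of_ch hd').trans hdw'))

/-- `Meets` only provides some fork whose label decides adjacency. As forks are unique, any fork at
hand may be used. -/
theorem adj_iff (h : T.IsTree X V) {adj : ℕ → ℕ → Prop} (hm : T.Meets X V adj) (hu : u ∈ V)
    (hw : w ∈ V) (hc : c ∈ T.ch X z) (hd : d ∈ T.ch X z) (hcd : c ≠ d) (hcu : T.A c u)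
    (hdw : T.A d w) : adj u w ↔ T.lab z = 1 := by
  have huw : u ≠ w := by
    rintro rfl
    exact hcd (h.sibling_eq_of_anc hc hd hcu hdw)
  obtain ⟨z', c', d', h1, h2, h3, h4, h5, h6⟩ := hm u hu w hw huw
  rw [h6, h.fork_unique (h.sub hu) (h.sub hw) hc hd hcd hcu hdw h2 h3 h1 h4 h5]

-- By induction on the number of nodes below `x`: the set of nodes below a child is strictly
-- smaller, since `x` itself is missing.
open Classical in
theorem induction_down (h : T.IsTree X V) {p : ℕ → Prop}
    (hp : ∀ x ∈ X, (∀ c ∈ T.ch X x, p c) → p x) : ∀ x ∈ X, p x := by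
  have key : ∀ k, ∀ x ∈ X, ({w ∈ X | T.A x w}).card ≤ k → p x := by
    intro k
    induction k with
    | zero =>
      intro x hx hk
      have : x ∈ ({w ∈ X | T.A x w}) := Finset.mem_filter.2 ⟨hx, .refl _⟩
      rw [Nat.le_zero, Finset.card_eq_zero] at hk
      simp [hk] at this
    | succ k ih =>
      intro x hx hk
      refine hp x hx fun c hc => ih c (mem_ch.1 hc).1 ?_
      have : ({w ∈ X | T.A c w}) ⊂ ({w ∈ X | T.A x w}) := by
        refine Finset.ssubset_iff_of_subset (fun w => ?_) |>.2 ⟨x, ?_, ?_⟩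
        · simp only [Finset.mem_filter]
          exact fun ⟨h1, h2⟩ => ⟨h1, (anc_of_ch hc).trans h2⟩
        · exact Finset.mem_filter.2 ⟨hx, .refl _⟩
        · simp [h.not_anc_of_ch hc]
      have := Finset.card_lt_card this
      omega
  exact fun x hx => key _ x hx le_rfl

theorem ch_nonempty (hr : T.IsReduced X V E) (hx : x ∈ X) (hxV : x ∉ V) : (T.ch X x).Nonempty := by
  have := hr.two x hx hxV
  exact Finset.card_pos.1 (by omega)

theorem exists_leaf (h : T.IsTree X V) (hr : T.IsReduced X V E) : ∀ x ∈ X, ∃ u ∈ V, T.A x u := by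
  refine h.induction_down fun x hx ih => ?_
  by_cases hxV : x ∈ V
  · exact ⟨x, hxV, .refl _⟩
  · obtain ⟨c, hc⟩ := ch_nonempty hr hx hxV
    obtain ⟨u, hu, hcu⟩ := ih c hc
    exact ⟨u, hu, (anc_of_ch hc).trans hcu⟩

theorem exists_other_child (hr : T.IsReduced X V E) (hx : x ∈ X) (hxV : x ∉ V) (c : ℕ) :
    ∃ d ∈ T.ch X x, d ≠ c := by
  have := hr.two x hx hxV
  exact Finset.exists_mem_ne (by omega) c

end IsTree

end PT

end CICograph

namespace CICograph

namespace PT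

/-! ### Operations on trees -/

/-- `T'` arises from `T` by putting the new node `y` above `β` and moving the children `M` of `β`
up to `y`. -/
structure SplitUp (T T' : PT) (X V M : Finset ℕ) (β y : ℕ) : Prop where
  mem : β ∈ X
  new : y ∉ X
  sub : M ⊆ T.ch X β
  root_eq : T'.root = if β = T.root then y else T.root
  par_new : T'.par y = if β = T.root then y else T.par β
  par_base : T'.par β = y
  par_moved : ∀ a ∈ M, T'.par a = y
  par_eq : ∀ x ∈ X, x ≠ β → x ∉ M → T'.par x = T.par x
  lab_eq : ∀ x ∈ X, T'.lab x = T.lab x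
  lab_new : M.Nonempty → T'.lab y = T.lab β
  nc_new : T'.nc y = M.card + 1
  nc_base : β ∉ V → T'.nc β + M.card = T.nc β
  nc_eq : ∀ x ∈ X, x ≠ β → T'.nc x = T.nc x
  cs_new : T'.cs y = ∑ a ∈ M, a + β
  cs_base : β ∉ V → T'.cs β + ∑ a ∈ M, a = T.cs β
  cs_par : β ≠ T.root → T'.cs (T.par β) + β = T.cs (T.par β) + y
  cs_eq : ∀ x ∈ X, x ≠ β → (β ≠ T.root → x ≠ T.par β) → T'.cs x = T.cs x

namespace SplitUp

variable {T T' : PT} {X V M : Finset ℕ} {β y : ℕ}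

theorem not_moved (h : T.SplitUp T' X V M β y) (ht : T.IsTree X V) : β ∉ M := fun hβ =>
  ht.ne_of_ch (h.sub hβ) rfl

theorem moved (h : T.SplitUp T' X V M β y) {a : ℕ} (ha : a ∈ M) :
    a ∈ X ∧ a ≠ T.root ∧ T.par a = β := mem_ch.1 (h.sub ha)

theorem ne_root (h : T.SplitUp T' X V M β y) {x : ℕ} (hx : x ∈ X) :
    x ≠ T'.root ↔ x = β ∨ x ≠ T.root := by
  rw [h.root_eq]
  have : x ≠ y := fun e => h.new (e ▸ hx)
  split_ifs with hr
  · subst hr; tauto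
  · constructor
    · exact .inr
    · rintro (rfl | h') <;> assumption

theorem new_ne_root (h : T.SplitUp T' X V M β y) (ht : T.IsTree X V) :
    y ≠ T'.root ↔ β ≠ T.root := by
  rw [h.root_eq]
  split_ifs with hr
  · simp [hr]
  · simp only [ne_eq, hr, not_false_eq_true, iff_true]
    exact fun e => h.new (e ▸ ht.root_mem)

/-- The new node `y` takes over the role of `β` as an ancestor, because the moved children are below
`y` but no longer below `β`. All other old nodes keep their descendants. -/
theorem anc_up (h : T.SplitUp T' X V M β y) (ht : T.IsTree X V) {x w : ℕ} (hw : w ∈ X)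
    (hxw : T.A x w) : T'.A (if x = β then y else x) w := by
  have hφ : (if x = β then y else x) ≠ β := by
    split_ifs with e
    · exact fun e' => h.new (e' ▸ h.mem)
    · exact e
  unfold A at hxw
  induction hxw with
  | refl =>
    split_ifs with e
    · exact .up ((h.ne_root hw).2 (.inl e)) (e ▸ h.par_base ▸ .refl _)
    · exact .refl _
  | @up w hwr _ ih =>
    have hp := (ht.par_mem w hw hwr).1
    have ih := ih hp
    have hwr' := (h.ne_root hw).2 (.inr hwr)
    by_cases hwβ : w = β
    · subst hwβ
      refine .up hwr' ?_
      rw [h.par_base]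
      refine .up ((h.new_ne_root ht).2 hwr) ?_
      rw [h.par_new, if_neg hwr]
      exact ih
    · by_cases hwM : w ∈ M
      · rw [(h.moved hwM).2.2] at ih
        have := (Anc.of_ne ih hφ).2
        rw [h.par_base] at this
        exact .up hwr' (h.par_moved w hwM ▸ this)
      · exact .up hwr' (h.par_eq w hw hwβ hwM ▸ ih)

/-- The second component is what the induction needs when the path upwards passes through `y`: the
next old node on it is the former parent of `β`. -/
theorem anc_down (h : T.SplitUp T' X V M β y) (ht : T.IsTree X V) {x w : ℕ} (hx : x ∈ X)
    (hxw : T'.A x w) : (w ∈ X → T.A x w) ∧ (w = y → T.A x β) := by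
  unfold A at hxw
  induction hxw with
  | refl => exact ⟨fun _ => .refl _, fun e => absurd (e ▸ hx) h.new⟩
  | @up w hwr _ ih =>
    constructor
    · intro hw
      by_cases hwβ : w = β
      · exact hwβ ▸ ih.2 (hwβ ▸ h.par_base)
      · have hwr' : w ≠ T.root := ((h.ne_root hw).1 hwr).resolve_left hwβ
        by_cases hwM : w ∈ M
        · exact .up hwr' ((h.moved hwM).2.2 ▸ ih.2 (h.par_moved w hwM))
        · have e := h.par_eq w hw hwβ hwM
          exact .up hwr' (e ▸ ih.1 (e ▸ (ht.par_mem w hw hwr').1))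
    · rintro rfl
      have hβ := (h.new_ne_root ht).1 hwr
      rw [h.par_new, if_neg hβ] at ih
      exact .up hβ (ih.1 (ht.par_mem β h.mem hβ).1)

theorem anc_iff (h : T.SplitUp T' X V M β y) (ht : T.IsTree X V) {x w : ℕ} (hw : w ∈ X)
    (hx : x ∈ X) (hxβ : x ≠ β) : T'.A x w ↔ T.A x w :=
  ⟨fun h' => (h.anc_down ht hx h').1 hw, fun h' => by
    have := h.anc_up ht hw h'
    rwa [if_neg hxβ] at this⟩

theorem isTree (h : T.SplitUp T' X V M β y) (ht : T.IsTree X V) : T'.IsTree (insert y X) V := by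
  have hr : T'.root = if T.root = β then y else T.root := by
    rw [h.root_eq]; simp [eq_comm]
  have hX : ∀ x ∈ X, T'.A T'.root x := fun x hx => by
    rw [hr]; exact h.anc_up ht hx (ht.reach x hx)
  have hyV : y ∉ V := fun e => h.new (ht.sub e)
  constructor
  · rw [hr]
    split_ifs
    · simp
    · exact Finset.mem_insert_of_mem ht.root_mem
  · intro x hx
    rcases Finset.mem_insert.1 hx with rfl | hx
    · have := hX β h.mem
      by_cases hβ : T'.root = β
      · exact absurd hβ.symm ((h.ne_root h.mem).2 (.inl rfl))
      · have := (Anc.of_ne this hβ).2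
        rwa [h.par_base] at this
    · exact hX x hx
  · intro x hx hxr
    rcases Finset.mem_insert.1 hx with rfl | hx
    · have hβ := (h.new_ne_root ht).1 hxr
      rw [h.par_new, if_neg hβ]
      have := ht.par_mem β h.mem hβ
      exact ⟨Finset.mem_insert_of_mem this.1, this.2⟩
    · by_cases hxβ : x = β
      · rw [hxβ, h.par_base]
        exact ⟨Finset.mem_insert_self _ _, hyV⟩
      · by_cases hxM : x ∈ M
        · rw [h.par_moved x hxM]
          exact ⟨Finset.mem_insert_self _ _, hyV⟩
        · rw [h.par_eq x hx hxβ hxM]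
          have := ht.par_mem x hx (((h.ne_root hx).1 hxr).resolve_left hxβ)
          exact ⟨Finset.mem_insert_of_mem this.1, this.2⟩
  · exact ht.sub.trans (Finset.subset_insert _ _)

theorem ch_new (h : T.SplitUp T' X V M β y) (ht : T.IsTree X V) :
    T'.ch (insert y X) y = insert β M := by
  ext c
  rw [mem_ch, Finset.mem_insert, Finset.mem_insert]
  constructor
  · rintro ⟨rfl | hc, h1, h2⟩
    · have hβ := (h.new_ne_root ht).1 h1
      rw [h.par_new, if_neg hβ] at h2
      exact absurd (h2 ▸ (ht.par_mem β h.mem hβ).1) h.new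
    · by_contra hne
      push Not at hne
      rw [h.par_eq c hc hne.1 hne.2] at h2
      exact h.new (h2 ▸ (ht.par_mem c hc (((h.ne_root hc).1 h1).resolve_left hne.1)).1)
  · rintro (rfl | hc)
    · exact ⟨.inr h.mem, (h.ne_root h.mem).2 (.inl rfl), h.par_base⟩
    · have := h.moved hc
      exact ⟨.inr this.1, (h.ne_root this.1).2 (.inr this.2.1), h.par_moved c hc⟩

theorem mem_ch_old (h : T.SplitUp T' X V M β y) {x c : ℕ} (hx : x ∈ X) (hc : c ∈ X) :
    c ∈ T'.ch (insert y X) x ↔ c ∈ T.ch X x ∧ c ≠ β ∧ c ∉ M := by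
  have hxy : y ≠ x := fun e => h.new (e ▸ hx)
  rw [mem_ch, mem_ch, h.ne_root hc, Finset.mem_insert]
  by_cases hcβ : c = β
  · simp [hcβ, h.par_base, hxy]
  · by_cases hcM : c ∈ M
    · simp [hcM, h.par_moved c hcM, hxy]
    · simp [hcβ, hcM, hc, h.par_eq c hc hcβ hcM]

theorem new_mem_ch (h : T.SplitUp T' X V M β y) (ht : T.IsTree X V) {x : ℕ} :
    y ∈ T'.ch (insert y X) x ↔ (β ≠ T.root ∧ T.par β = x) := by
  rw [mem_ch, h.new_ne_root ht]
  refine ⟨fun h' => ⟨h'.2.1, ?_⟩, fun h' => ⟨Finset.mem_insert_self _ _, h'.1, ?_⟩⟩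
  · rw [← h'.2.2, h.par_new, if_neg h'.2.1]
  · rw [← h'.2, h.par_new, if_neg h'.1]

theorem ch_base (h : T.SplitUp T' X V M β y) (ht : T.IsTree X V) :
    T'.ch (insert y X) β = T.ch X β \ M := by
  ext c
  rw [Finset.mem_sdiff]
  by_cases hc : c ∈ X
  · rw [h.mem_ch_old h.mem hc]
    exact ⟨fun h' => ⟨h'.1, h'.2.2⟩, fun h' => ⟨h'.1, ht.ne_of_ch h'.1, h'.2⟩⟩
  · refine ⟨fun h' => ?_, fun h' => absurd (mem_ch.1 h'.1).1 hc⟩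
    obtain rfl := (Finset.mem_insert.1 (mem_ch.1 h').1).resolve_right hc
    obtain ⟨h1, h2⟩ := (h.new_mem_ch ht).1 h'
    exact absurd (mem_ch.2 ⟨h.mem, h1, h2⟩) fun h' => ht.ne_of_ch h' rfl

theorem ch_par (h : T.SplitUp T' X V M β y) (ht : T.IsTree X V) (hβ : β ≠ T.root) :
    T'.ch (insert y X) (T.par β) = insert y ((T.ch X (T.par β)).erase β) := by
  have hp := ht.par_mem β h.mem hβ
  ext c
  rw [Finset.mem_insert, Finset.mem_erase]
  by_cases hc : c ∈ X
  · rw [h.mem_ch_old hp.1 hc]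
    constructor
    · exact fun h' => .inr ⟨h'.2.1, h'.1⟩
    · rintro (rfl | h')
      · exact absurd hc h.new
      · refine ⟨h'.2, h'.1, fun hcM => ?_⟩
        have e := (h.moved hcM).2.2
        rw [(mem_ch.1 h'.2).2.2] at e
        exact absurd (mem_ch.2 ⟨h.mem, hβ, e⟩) fun h' => ht.ne_of_ch h' rfl
  · constructor
    · exact fun h' => .inl ((Finset.mem_insert.1 (mem_ch.1 h').1).resolve_right hc)
    · rintro (rfl | h')
      · exact (h.new_mem_ch ht).2 ⟨hβ, rfl⟩
      · exact absurd (mem_ch.1 h'.2).1 hc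

theorem ch_eq (h : T.SplitUp T' X V M β y) (ht : T.IsTree X V) {x : ℕ} (hx : x ∈ X) (hxβ : x ≠ β)
    (hxp : β ≠ T.root → x ≠ T.par β) : T'.ch (insert y X) x = T.ch X x := by
  ext c
  by_cases hc : c ∈ X
  · rw [h.mem_ch_old hx hc]
    refine ⟨fun h' => h'.1, fun h' => ⟨h', ?_, ?_⟩⟩
    · rintro rfl
      exact hxp (mem_ch.1 h').2.1 (mem_ch.1 h').2.2.symm
    · intro hcM
      exact hxβ ((mem_ch.1 h').2.2.symm.trans (h.moved hcM).2.2)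
  · refine ⟨fun h' => ?_, fun h' => absurd (mem_ch.1 h').1 hc⟩
    obtain rfl := (Finset.mem_insert.1 (mem_ch.1 h').1).resolve_right hc
    obtain ⟨h1, h2⟩ := (h.new_mem_ch ht).1 h'
    exact absurd h2.symm (hxp h1)

/-- What is below `β` afterwards. -/
theorem anc_base (h : T.SplitUp T' X V M β y) (ht : T.IsTree X V) {w : ℕ} (hw : w ∈ X) :
    T'.A β w ↔ w = β ∨ ∃ d ∈ T.ch X β, d ∉ M ∧ T.A d w := by
  have ht' := h.isTree ht
  constructor
  · intro h'
    by_cases hne : β = w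
    · exact .inl hne.symm
    · obtain ⟨d, hd, hdw⟩ := ht'.exists_child (Finset.mem_insert_of_mem hw) h' hne
      rw [h.ch_base ht, Finset.mem_sdiff] at hd
      exact .inr ⟨d, hd.1, hd.2, (h.anc_iff ht hw (mem_ch.1 hd.1).1 (ht.ne_of_ch hd.1)).1 hdw⟩
  · rintro (rfl | ⟨d, hd, hdM, hdw⟩)
    · exact .refl _
    · have hd' : d ∈ T'.ch (insert y X) β := by
        rw [h.ch_base ht]; exact Finset.mem_sdiff.2 ⟨hd, hdM⟩
      exact (IsTree.anc_of_ch hd').trans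
        ((h.anc_iff ht hw (mem_ch.1 hd).1 (ht.ne_of_ch hd)).2 hdw)

theorem anc_new (h : T.SplitUp T' X V M β y) (ht : T.IsTree X V) {w : ℕ} (hw : w ∈ X) :
    T'.A y w ↔ T.A β w := by
  constructor
  · intro h'
    by_cases hne : y = w
    · exact absurd (hne ▸ hw) h.new
    · obtain ⟨d, hd, hdw⟩ := (h.isTree ht).exists_child (Finset.mem_insert_of_mem hw) h' hne
      rw [h.ch_new ht, Finset.mem_insert] at hd
      rcases hd with rfl | hd
      · rcases (h.anc_base ht hw).1 hdw with rfl | ⟨c, hc, _, hcw⟩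
        · exact .refl _
        · exact (IsTree.anc_of_ch hc).trans hcw
      · have hd' := h.sub hd
        exact (IsTree.anc_of_ch hd').trans
          ((h.anc_iff ht hw (mem_ch.1 hd').1 (ht.ne_of_ch hd')).1 hdw)
  · intro h'
    have := h.anc_up ht hw h'
    rwa [if_pos rfl] at this

/-- Only pairs that met in `β` can change their fork. Such a pair now meets in `y` as soon as one of
its leaves is below a moved child, with `β` as the child of `y` above a leaf that was not moved. So
`y` must carry the label of `β`, but only if `M` is nonempty; otherwise `β` is the only child of
`y`, no pair meets there, and the label of `y` is free. `Attachable.subdivide` relies on this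
freedom. -/
theorem meets (h : T.SplitUp T' X V M β y) (ht : T.IsTree X V) {adj : ℕ → ℕ → Prop}
    (hm : T.Meets X V adj) : T'.Meets (insert y X) V adj := by
  intro u hu w hw huw
  obtain ⟨z, c, d, hcd, hc, hd, hcu, hdw, hadj⟩ := hm u hu w hw huw
  have hu' := ht.sub hu
  have hw' := ht.sub hw
  have hzX := (ht.mem_of_ch hc).1
  by_cases hz : z = β
  · subst hz
    have hcz := ht.ne_of_ch hc
    have hdz := ht.ne_of_ch hd
    have hcu' := (h.anc_iff ht hu' (mem_ch.1 hc).1 hcz).2 hcu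
    have hdw' := (h.anc_iff ht hw' (mem_ch.1 hd).1 hdz).2 hdw
    by_cases hcM : c ∈ M
    · have hc' : c ∈ T'.ch (insert y X) y := by
        rw [h.ch_new ht]; exact Finset.mem_insert_of_mem hcM
      rw [← h.lab_new ⟨c, hcM⟩] at hadj
      by_cases hdM : d ∈ M
      · have hd' : d ∈ T'.ch (insert y X) y := by
          rw [h.ch_new ht]; exact Finset.mem_insert_of_mem hdM
        exact ⟨y, c, d, hcd, hc', hd', hcu', hdw', hadj⟩
      · have hd' : z ∈ T'.ch (insert y X) y := by
          rw [h.ch_new ht]; exact Finset.mem_insert_self _ _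
        exact ⟨y, c, z, hcz, hc', hd', hcu',
          (h.anc_base ht hw').2 (.inr ⟨d, hd, hdM, hdw⟩), hadj⟩
    · by_cases hdM : d ∈ M
      · have hd' : d ∈ T'.ch (insert y X) y := by
          rw [h.ch_new ht]; exact Finset.mem_insert_of_mem hdM
        have hc' : z ∈ T'.ch (insert y X) y := by
          rw [h.ch_new ht]; exact Finset.mem_insert_self _ _
        rw [← h.lab_new ⟨d, hdM⟩] at hadj
        exact ⟨y, z, d, hdz.symm, hc', hd', (h.anc_base ht hu').2 (.inr ⟨c, hc, hcM, hcu⟩),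
          hdw', hadj⟩
      · rw [← h.lab_eq z hzX] at hadj
        refine ⟨z, c, d, hcd, ?_, ?_, hcu', hdw', hadj⟩
        · rw [h.ch_base ht]; exact Finset.mem_sdiff.2 ⟨hc, hcM⟩
        · rw [h.ch_base ht]; exact Finset.mem_sdiff.2 ⟨hd, hdM⟩
  · rw [← h.lab_eq z hzX] at hadj
    have aux : ∀ {c u}, c ∈ T.ch X z → T.A c u → u ∈ X →
        (if c = β then y else c) ∈ T'.ch (insert y X) z ∧ T'.A (if c = β then y else c) u := by
      intro c u hc hcu hu
      refine ⟨?_, h.anc_up ht hu hcu⟩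
      split_ifs with e
      · obtain ⟨_, h1, h2⟩ := mem_ch.1 hc
        exact (h.new_mem_ch ht).2 ⟨e ▸ h1, e ▸ h2⟩
      · refine (h.mem_ch_old hzX (mem_ch.1 hc).1).2 ⟨hc, e, fun hcM => hz ?_⟩
        exact (mem_ch.1 hc).2.2.symm.trans (h.moved hcM).2.2
    obtain ⟨h1, h2⟩ := aux hc hcu hu'
    obtain ⟨h3, h4⟩ := aux hd hdw hw'
    refine ⟨z, _, _, ?_, h1, h3, h2, h4, hadj⟩
    have hcy : c ≠ y := fun e => h.new (e ▸ (mem_ch.1 hc).1)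
    have hdy : d ≠ y := fun e => h.new (e ▸ (mem_ch.1 hd).1)
    split_ifs with e1 e2 e2
    · exact absurd (e1.trans e2.symm) hcd
    · exact hdy.symm
    · exact hcy
    · exact hcd

/-- Only `y`, `β` and the old parent of `β` have new sets of children; the parent exchanges `β` for
`y`, which changes its sum but not its number of children. -/
theorem counts (h : T.SplitUp T' X V M β y) (ht : T.IsTree X V)
    (hnc : ∀ x ∈ X, x ∉ V → T.nc x = (T.ch X x).card)
    (hcs : ∀ x ∈ X, x ∉ V → T.cs x = ∑ c ∈ T.ch X x, c) :
    ∀ x ∈ insert y X, x ∉ V → T'.nc x = (T'.ch (insert y X) x).card ∧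
      T'.cs x = ∑ c ∈ T'.ch (insert y X) x, c := by
  intro x hx hxV
  rcases Finset.mem_insert.1 hx with rfl | hx
  · rw [h.ch_new ht, Finset.card_insert_of_notMem (h.not_moved ht),
      Finset.sum_insert (h.not_moved ht), h.nc_new, h.cs_new, add_comm β]
    exact ⟨rfl, rfl⟩
  · by_cases hxβ : x = β
    · subst hxβ
      have h1 := h.nc_base hxV
      have h2 := h.cs_base hxV
      rw [hnc x hx hxV] at h1
      rw [hcs x hx hxV] at h2
      rw [h.ch_base ht, Finset.card_sdiff_of_subset h.sub]
      have := Finset.sum_sdiff h.sub (f := fun c => c)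
      constructor <;> omega
    · by_cases hxp : β ≠ T.root ∧ x = T.par β
      · obtain ⟨hβ, rfl⟩ := hxp
        have hmem : β ∈ T.ch X (T.par β) := mem_ch.2 ⟨h.mem, hβ, rfl⟩
        have hy : y ∉ (T.ch X (T.par β)).erase β := fun e =>
          h.new (mem_ch.1 (Finset.mem_of_mem_erase e)).1
        rw [h.ch_par ht hβ, Finset.card_insert_of_notMem hy, Finset.sum_insert hy,
          Finset.card_erase_add_one hmem, h.nc_eq _ hx hxβ, hnc _ hx hxV]
        have := Finset.add_sum_erase _ (fun c => c) hmem
        have h1 := h.cs_par hβ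
        rw [hcs _ hx hxV] at h1
        exact ⟨rfl, by omega⟩
      · have hxp' : β ≠ T.root → x ≠ T.par β := fun h1 h2 => hxp ⟨h1, h2⟩
        rw [h.ch_eq ht hx hxβ hxp', h.nc_eq x hx hxβ, h.cs_eq x hx hxβ hxp']
        exact ⟨hnc x hx hxV, hcs x hx hxV⟩

end SplitUp

/-- `T'` arises from `T` by putting a new node `y` below `β`, to which the children `M` of `β` are
moved. -/
structure SplitDown (T T' : PT) (X V M : Finset ℕ) (β y : ℕ) : Prop where
  mem : β ∈ X
  notMem : β ∉ V
  new : y ∉ X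
  sub : M ⊆ T.ch X β
  root_eq : T'.root = T.root
  par_new : T'.par y = β
  par_moved : ∀ a ∈ M, T'.par a = y
  par_eq : ∀ x ∈ X, x ∉ M → T'.par x = T.par x
  lab_eq : ∀ x ∈ X, T'.lab x = T.lab x
  lab_new : T'.lab y = T.lab β
  nc_new : T'.nc y = M.card
  nc_base : T'.nc β + M.card = T.nc β + 1
  nc_eq : ∀ x ∈ X, x ≠ β → T'.nc x = T.nc x
  cs_new : T'.cs y = ∑ a ∈ M, a
  cs_base : T'.cs β + ∑ a ∈ M, a = T.cs β + y
  cs_eq : ∀ x ∈ X, x ≠ β → T'.cs x = T.cs x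

namespace SplitDown

variable {T T' : PT} {X V M : Finset ℕ} {β y : ℕ}

theorem moved (h : T.SplitDown T' X V M β y) {a : ℕ} (ha : a ∈ M) :
    a ∈ X ∧ a ≠ T.root ∧ T.par a = β := mem_ch.1 (h.sub ha)

theorem new_ne_root (h : T.SplitDown T' X V M β y) (ht : T.IsTree X V) : y ≠ T'.root := by
  rw [h.root_eq]
  exact fun e => h.new (e ▸ ht.root_mem)

theorem anc_up (h : T.SplitDown T' X V M β y) (ht : T.IsTree X V) {x w : ℕ} (hw : w ∈ X)
    (hxw : T.A x w) : T'.A x w := by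
  unfold A at hxw
  induction hxw with
  | refl => exact .refl _
  | @up w hwr _ ih =>
    have ih := ih (ht.par_mem w hw hwr).1
    have hwr' : w ≠ T'.root := h.root_eq ▸ hwr
    by_cases hwM : w ∈ M
    · rw [(h.moved hwM).2.2] at ih
      refine .up hwr' ?_
      rw [h.par_moved w hwM]
      exact .up (h.new_ne_root ht) (h.par_new ▸ ih)
    · exact .up hwr' (h.par_eq w hw hwM ▸ ih)

theorem anc_down (h : T.SplitDown T' X V M β y) (ht : T.IsTree X V) {x w : ℕ} (hx : x ∈ X)
    (hxw : T'.A x w) : (w ∈ X → T.A x w) ∧ (w = y → T.A x β) := by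
  unfold A at hxw
  induction hxw with
  | refl => exact ⟨fun _ => .refl _, fun e => absurd (e ▸ hx) h.new⟩
  | @up w hwr _ ih =>
    constructor
    · intro hw
      have hwr' : w ≠ T.root := h.root_eq ▸ hwr
      by_cases hwM : w ∈ M
      · exact .up hwr' ((h.moved hwM).2.2 ▸ ih.2 (h.par_moved w hwM))
      · have e := h.par_eq w hw hwM
        exact .up hwr' (e ▸ ih.1 (e ▸ (ht.par_mem w hw hwr').1))
    · rintro rfl
      exact h.par_new ▸ ih.1 (h.par_new.symm ▸ h.mem)

theorem anc_iff (h : T.SplitDown T' X V M β y) (ht : T.IsTree X V) {x w : ℕ} (hw : w ∈ X)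
    (hx : x ∈ X) : T'.A x w ↔ T.A x w :=
  ⟨fun h' => (h.anc_down ht hx h').1 hw, h.anc_up ht hw⟩

theorem isTree (h : T.SplitDown T' X V M β y) (ht : T.IsTree X V) :
    T'.IsTree (insert y X) V := by
  have hyV : y ∉ V := fun e => h.new (ht.sub e)
  constructor
  · rw [h.root_eq]
    exact Finset.mem_insert_of_mem ht.root_mem
  · intro x hx
    rw [h.root_eq]
    rcases Finset.mem_insert.1 hx with rfl | hx
    · exact .up (h.new_ne_root ht) (h.par_new ▸ h.anc_up ht h.mem (ht.reach β h.mem))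
    · exact h.anc_up ht hx (ht.reach x hx)
  · intro x hx hxr
    rcases Finset.mem_insert.1 hx with rfl | hx
    · rw [h.par_new]
      exact ⟨Finset.mem_insert_of_mem h.mem, h.notMem⟩
    · by_cases hxM : x ∈ M
      · rw [h.par_moved x hxM]
        exact ⟨Finset.mem_insert_self _ _, hyV⟩
      · rw [h.par_eq x hx hxM]
        have := ht.par_mem x hx (h.root_eq ▸ hxr)
        exact ⟨Finset.mem_insert_of_mem this.1, this.2⟩
  · exact ht.sub.trans (Finset.subset_insert _ _)

theorem mem_ch_old (h : T.SplitDown T' X V M β y) {x c : ℕ} (hx : x ∈ X) (hc : c ∈ X) :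
    c ∈ T'.ch (insert y X) x ↔ c ∈ T.ch X x ∧ c ∉ M := by
  have hxy : y ≠ x := fun e => h.new (e ▸ hx)
  rw [mem_ch, mem_ch, h.root_eq, Finset.mem_insert]
  by_cases hcM : c ∈ M
  · simp [hcM, h.par_moved c hcM, hxy]
  · simp [hcM, hc, h.par_eq c hc hcM]

theorem new_mem_ch (h : T.SplitDown T' X V M β y) (ht : T.IsTree X V) {x : ℕ} :
    y ∈ T'.ch (insert y X) x ↔ β = x := by
  rw [mem_ch, h.par_new]
  exact ⟨fun h' => h'.2.2, fun h' => ⟨Finset.mem_insert_self _ _, h.new_ne_root ht, h'⟩⟩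

theorem ch_new (h : T.SplitDown T' X V M β y) (ht : T.IsTree X V) :
    T'.ch (insert y X) y = M := by
  ext c
  constructor
  · intro h'
    obtain ⟨h0, h1, h2⟩ := mem_ch.1 h'
    rcases Finset.mem_insert.1 h0 with rfl | hc
    · rw [h.par_new] at h2
      exact absurd (h2 ▸ h.mem) h.new
    · by_contra hne
      rw [h.par_eq c hc hne] at h2
      exact h.new (h2 ▸ (ht.par_mem c hc (h.root_eq ▸ h1)).1)
  · intro hc
    have := h.moved hc
    exact mem_ch.2 ⟨Finset.mem_insert_of_mem this.1, h.root_eq ▸ this.2.1, h.par_moved c hc⟩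

theorem ch_base (h : T.SplitDown T' X V M β y) (ht : T.IsTree X V) :
    T'.ch (insert y X) β = insert y (T.ch X β \ M) := by
  ext c
  rw [Finset.mem_insert, Finset.mem_sdiff]
  by_cases hc : c ∈ X
  · rw [h.mem_ch_old h.mem hc]
    exact ⟨.inr, fun h' => h'.resolve_left fun e => h.new (e ▸ hc)⟩
  · constructor
    · exact fun h' => .inl ((Finset.mem_insert.1 (mem_ch.1 h').1).resolve_right hc)
    · rintro (rfl | h')
      · exact (h.new_mem_ch ht).2 rfl
      · exact absurd (mem_ch.1 h'.1).1 hc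

theorem ch_eq (h : T.SplitDown T' X V M β y) (ht : T.IsTree X V) {x : ℕ} (hx : x ∈ X)
    (hxβ : x ≠ β) : T'.ch (insert y X) x = T.ch X x := by
  ext c
  by_cases hc : c ∈ X
  · rw [h.mem_ch_old hx hc]
    exact ⟨fun h' => h'.1, fun h' => ⟨h', fun hcM =>
      hxβ ((mem_ch.1 h').2.2.symm.trans (h.moved hcM).2.2)⟩⟩
  · refine ⟨fun h' => ?_, fun h' => absurd (mem_ch.1 h').1 hc⟩
    obtain rfl := (Finset.mem_insert.1 (mem_ch.1 h').1).resolve_right hc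
    exact absurd ((h.new_mem_ch ht).1 h').symm hxβ

theorem anc_new (h : T.SplitDown T' X V M β y) (ht : T.IsTree X V) {w : ℕ} (hw : w ∈ X) :
    T'.A y w ↔ ∃ a ∈ M, T.A a w := by
  constructor
  · intro h'
    obtain ⟨d, hd, hdw⟩ := (h.isTree ht).exists_child (Finset.mem_insert_of_mem hw) h'
      fun e => h.new (e ▸ hw)
    rw [h.ch_new ht] at hd
    exact ⟨d, hd, (h.anc_iff ht hw (h.moved hd).1).1 hdw⟩
  · rintro ⟨a, ha, haw⟩
    have : a ∈ T'.ch (insert y X) y := by rwa [h.ch_new ht]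
    exact (IsTree.anc_of_ch this).trans (h.anc_up ht hw haw)

/-- Two leaves below moved children that met in `β` now meet in `y`, so `y` needs the label of `β`.
If only one of the two is below a moved child, they still meet in `β`, with `y` replacing that
child. -/
theorem meets (h : T.SplitDown T' X V M β y) (ht : T.IsTree X V) {adj : ℕ → ℕ → Prop}
    (hm : T.Meets X V adj) : T'.Meets (insert y X) V adj := by
  intro u hu w hw huw
  obtain ⟨z, c, d, hcd, hc, hd, hcu, hdw, hadj⟩ := hm u hu w hw huw
  have hu' := ht.sub hu
  have hw' := ht.sub hw
  have hzX := (ht.mem_of_ch hc).1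
  have hcu' := h.anc_up ht hu' hcu
  have hdw' := h.anc_up ht hw' hdw
  by_cases hz : z = β
  · subst hz
    have hyz : y ∈ T'.ch (insert y X) z := (h.new_mem_ch ht).2 rfl
    have hcy : c ≠ y := fun e => h.new (e ▸ (mem_ch.1 hc).1)
    have hdy : d ≠ y := fun e => h.new (e ▸ (mem_ch.1 hd).1)
    have hadj' := hadj
    rw [← h.lab_new] at hadj
    rw [← h.lab_eq z hzX] at hadj'
    by_cases hcM : c ∈ M
    · by_cases hdM : d ∈ M
      · rw [← h.ch_new ht] at hcM hdM
        exact ⟨y, c, d, hcd, hcM, hdM, hcu', hdw', hadj⟩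
      · exact ⟨z, y, d, hdy.symm, hyz, (h.mem_ch_old hzX (mem_ch.1 hd).1).2 ⟨hd, hdM⟩,
          (h.anc_new ht hu').2 ⟨c, hcM, hcu⟩, hdw', hadj'⟩
    · have hc' := (h.mem_ch_old hzX (mem_ch.1 hc).1).2 ⟨hc, hcM⟩
      by_cases hdM : d ∈ M
      · exact ⟨z, c, y, hcy, hc', hyz, hcu', (h.anc_new ht hw').2 ⟨d, hdM, hdw⟩, hadj'⟩
      · exact ⟨z, c, d, hcd, hc', (h.mem_ch_old hzX (mem_ch.1 hd).1).2 ⟨hd, hdM⟩, hcu', hdw',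
          hadj'⟩
  · rw [← h.lab_eq z hzX] at hadj
    rw [← h.ch_eq ht hzX hz] at hc hd
    exact ⟨z, c, d, hcd, hc, hd, hcu', hdw', hadj⟩

theorem counts (h : T.SplitDown T' X V M β y) (ht : T.IsTree X V)
    (hnc : ∀ x ∈ X, x ∉ V → T.nc x = (T.ch X x).card)
    (hcs : ∀ x ∈ X, x ∉ V → T.cs x = ∑ c ∈ T.ch X x, c) :
    ∀ x ∈ insert y X, x ∉ V → T'.nc x = (T'.ch (insert y X) x).card ∧
      T'.cs x = ∑ c ∈ T'.ch (insert y X) x, c := by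
  intro x hx hxV
  rcases Finset.mem_insert.1 hx with rfl | hx
  · rw [h.ch_new ht, h.nc_new, h.cs_new]
    exact ⟨rfl, rfl⟩
  · by_cases hxβ : x = β
    · subst hxβ
      have h1 := h.nc_base
      have h2 := h.cs_base
      rw [hnc x hx hxV] at h1
      rw [hcs x hx hxV] at h2
      have hy : y ∉ T.ch X x \ M := fun e => h.new (mem_ch.1 (Finset.mem_sdiff.1 e).1).1
      rw [h.ch_base ht, Finset.card_insert_of_notMem hy, Finset.sum_insert hy,
        Finset.card_sdiff_of_subset h.sub]
      have := Finset.sum_sdiff h.sub (f := fun c => c)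
      have := Finset.card_le_card h.sub
      constructor <;> omega
    · rw [h.ch_eq ht hx hxβ, h.nc_eq x hx hxβ, h.cs_eq x hx hxβ]
      exact ⟨hnc x hx hxV, hcs x hx hxV⟩

end SplitDown

/-- `T'` arises from `T` by adding the leaf `v` as a child of `y`. -/
structure AddLeaf (T T' : PT) (X V : Finset ℕ) (v y : ℕ) : Prop where
  mem : y ∈ X
  notMem : y ∉ V
  new : v ∉ X
  root_eq : T'.root = T.root
  par_new : T'.par v = y
  par_eq : ∀ x ∈ X, T'.par x = T.par x
  lab_eq : ∀ x ∈ X, T'.lab x = T.lab x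
  nc_base : T'.nc y = T.nc y + 1
  nc_eq : ∀ x ∈ X, x ≠ y → T'.nc x = T.nc x
  cs_base : T'.cs y = T.cs y + v
  cs_eq : ∀ x ∈ X, x ≠ y → T'.cs x = T.cs x

namespace AddLeaf

variable {T T' : PT} {X V : Finset ℕ} {v y : ℕ}

theorem new_ne_root (h : T.AddLeaf T' X V v y) (ht : T.IsTree X V) : v ≠ T'.root := by
  rw [h.root_eq]
  exact fun e => h.new (e ▸ ht.root_mem)

theorem anc_iff (h : T.AddLeaf T' X V v y) (ht : T.IsTree X V) {x w : ℕ} (hw : w ∈ X) :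
    T'.A x w ↔ T.A x w := by
  constructor
  · intro hxw
    unfold A at hxw
    induction hxw with
    | refl => exact .refl _
    | @up w hwr _ ih =>
      have hwr' : w ≠ T.root := h.root_eq ▸ hwr
      have e := h.par_eq w hw
      exact .up hwr' (e ▸ ih (e ▸ (ht.par_mem w hw hwr').1))
  · intro hxw
    unfold A at hxw
    induction hxw with
    | refl => exact .refl _
    | @up w hwr _ ih =>
      exact .up (h.root_eq ▸ hwr) (h.par_eq w hw ▸ ih (ht.par_mem w hw hwr).1)

theorem isTree (h : T.AddLeaf T' X V v y) (ht : T.IsTree X V) :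
    T'.IsTree (insert v X) (insert v V) := by
  constructor
  · rw [h.root_eq]
    exact Finset.mem_insert_of_mem ht.root_mem
  · intro x hx
    rw [h.root_eq]
    rcases Finset.mem_insert.1 hx with rfl | hx
    · exact .up (h.new_ne_root ht) (h.par_new ▸ (h.anc_iff ht h.mem).2 (ht.reach y h.mem))
    · exact (h.anc_iff ht hx).2 (ht.reach x hx)
  · intro x hx hxr
    have aux : ∀ {z}, z ∈ X → z ∉ V → z ∈ insert v X ∧ z ∉ insert v V := fun h1 h2 =>
      ⟨Finset.mem_insert_of_mem h1, by
        rw [Finset.mem_insert]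
        rintro (rfl | h')
        · exact h.new h1
        · exact h2 h'⟩
    rcases Finset.mem_insert.1 hx with rfl | hx
    · rw [h.par_new]
      exact aux h.mem h.notMem
    · rw [h.par_eq x hx]
      have := ht.par_mem x hx (h.root_eq ▸ hxr)
      exact aux this.1 this.2
  · exact Finset.insert_subset_insert _ ht.sub

theorem mem_ch_old (h : T.AddLeaf T' X V v y) {x c : ℕ} (hc : c ∈ X) :
    c ∈ T'.ch (insert v X) x ↔ c ∈ T.ch X x := by
  rw [mem_ch, mem_ch, h.root_eq, Finset.mem_insert, h.par_eq c hc]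
  simp [hc]

theorem new_mem_ch (h : T.AddLeaf T' X V v y) (ht : T.IsTree X V) {x : ℕ} :
    v ∈ T'.ch (insert v X) x ↔ y = x := by
  rw [mem_ch, h.par_new]
  exact ⟨fun h' => h'.2.2, fun h' => ⟨Finset.mem_insert_self _ _, h.new_ne_root ht, h'⟩⟩

theorem ch_base (h : T.AddLeaf T' X V v y) (ht : T.IsTree X V) :
    T'.ch (insert v X) y = insert v (T.ch X y) := by
  ext c
  rw [Finset.mem_insert]
  by_cases hc : c ∈ X
  · rw [h.mem_ch_old hc]
    exact ⟨.inr, fun h' => h'.resolve_left fun e => h.new (e ▸ hc)⟩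
  · constructor
    · exact fun h' => .inl ((Finset.mem_insert.1 (mem_ch.1 h').1).resolve_right hc)
    · rintro (rfl | h')
      · exact (h.new_mem_ch ht).2 rfl
      · exact absurd (mem_ch.1 h').1 hc

theorem ch_eq (h : T.AddLeaf T' X V v y) (ht : T.IsTree X V) {x : ℕ} (hxy : x ≠ y) :
    T'.ch (insert v X) x = T.ch X x := by
  ext c
  by_cases hc : c ∈ X
  · rw [h.mem_ch_old hc]
  · refine ⟨fun h' => ?_, fun h' => absurd (mem_ch.1 h').1 hc⟩
    obtain rfl := (Finset.mem_insert.1 (mem_ch.1 h').1).resolve_right hc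
    exact absurd ((h.new_mem_ch ht).1 h').symm hxy

/-- The label of the node where the new leaf `v` branches off from a leaf has to be right. -/
theorem meets (h : T.AddLeaf T' X V v y) (ht : T.IsTree X V) {adj : ℕ → ℕ → Prop}
    (hsymm : ∀ u w, adj u w → adj w u) (hm : T.Meets X V adj)
    (hv : ∀ z, ∀ c ∈ T.ch X z, T.A z y → ¬ T.A c y → ∀ u ∈ V, T.A c u → (adj v u ↔ T.lab z = 1)) :
    T'.Meets (insert v X) (insert v V) adj := by
  have ht' := h.isTree ht
  have key : ∀ u ∈ V, ∃ z c d, c ≠ d ∧ c ∈ T'.ch (insert v X) z ∧ d ∈ T'.ch (insert v X) z ∧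
      T'.A c u ∧ T'.A d v ∧ (adj v u ↔ T'.lab z = 1) := by
    intro u hu
    have huX := ht.sub hu
    rcases ht.exists_branch huX h.mem with h1 | ⟨z, c, hc, hz, hcu, hcy⟩
    · exact absurd (ht.anc_leaf h.mem hu h1 ▸ hu) h.notMem
    · have hzX := (ht.mem_of_ch hc).1
      have hcX := (mem_ch.1 hc).1
      have hadj := hv z c hc hz hcy u hu hcu
      rw [← h.lab_eq z hzX] at hadj
      have hc' := (h.mem_ch_old hcX).2 hc
      have hcu' := (h.anc_iff ht huX).2 hcu
      by_cases hzy : z = y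
      · exact ⟨z, c, v, fun e => h.new (e ▸ hcX), hc', (h.new_mem_ch ht).2 hzy.symm, hcu', .refl _,
          hadj⟩
      · obtain ⟨d, hd, hdy⟩ := ht.exists_child h.mem hz hzy
        have hyv : T'.A y v := IsTree.anc_of_ch ((h.new_mem_ch ht).2 rfl)
        exact ⟨z, c, d, fun e => hcy (e ▸ hdy), hc', (h.mem_ch_old (mem_ch.1 hd).1).2 hd, hcu',
          ((h.anc_iff ht h.mem).2 hdy).trans hyv, hadj⟩
  intro u hu w hw huw
  rcases Finset.mem_insert.1 hu with rfl | hu'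
  · rcases Finset.mem_insert.1 hw with rfl | hw'
    · exact absurd rfl huw
    · obtain ⟨z, c, d, h1, h2, h3, h4, h5, h6⟩ := key w hw'
      exact ⟨z, d, c, h1.symm, h3, h2, h5, h4, h6⟩
  · rcases Finset.mem_insert.1 hw with rfl | hw'
    · obtain ⟨z, c, d, h1, h2, h3, h4, h5, h6⟩ := key u hu'
      exact ⟨z, c, d, h1, h2, h3, h4, h5, ⟨fun h' => h6.1 (hsymm _ _ h'), fun h' =>
        hsymm _ _ (h6.2 h')⟩⟩
    · obtain ⟨z, c, d, h1, h2, h3, h4, h5, h6⟩ := hm u hu' w hw' huw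
      refine ⟨z, c, d, h1, (h.mem_ch_old (mem_ch.1 h2).1).2 h2,
        (h.mem_ch_old (mem_ch.1 h3).1).2 h3, (h.anc_iff ht (ht.sub hu')).2 h4,
        (h.anc_iff ht (ht.sub hw')).2 h5, ?_⟩
      rw [h.lab_eq z (ht.mem_of_ch h2).1, h6]

theorem counts (h : T.AddLeaf T' X V v y) (ht : T.IsTree X V)
    (hnc : ∀ x ∈ X, x ∉ V → T.nc x = (T.ch X x).card)
    (hcs : ∀ x ∈ X, x ∉ V → T.cs x = ∑ c ∈ T.ch X x, c) :
    ∀ x ∈ insert v X, x ∉ insert v V → T'.nc x = (T'.ch (insert v X) x).card ∧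
      T'.cs x = ∑ c ∈ T'.ch (insert v X) x, c := by
  intro x hx hxV
  rw [Finset.mem_insert, not_or] at hxV
  have hx := (Finset.mem_insert.1 hx).resolve_left hxV.1
  by_cases hxy : x = y
  · subst hxy
    have hv : v ∉ T.ch X x := fun e => h.new (mem_ch.1 e).1
    rw [h.ch_base ht, Finset.card_insert_of_notMem hv, Finset.sum_insert hv, h.nc_base, h.cs_base,
      hnc x hx hxV.2, hcs x hx hxV.2, add_comm v]
    exact ⟨rfl, rfl⟩
  · rw [h.ch_eq ht hxy, h.nc_eq x hx hxy, h.cs_eq x hx hxy]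
    exact ⟨hnc x hx hxV.2, hcs x hx hxV.2⟩

end AddLeaf

end PT

end CICograph

namespace CICograph

namespace PT

/-! ### Adding a vertex to the tree -/

variable {T T' : PT} {X V M F : Finset ℕ} {adj : ℕ → ℕ → Prop} {v U y b β : ℕ}

/-- Once the counts are known to be right, "at least two children" can be verified on the stored
numbers, which the tree operations track explicitly. -/
theorem IsReduced.of_counts {E : Finset ℕ}
    (h : ∀ x ∈ X, x ∉ V → T.nc x = (T.ch X x).card ∧ T.cs x = ∑ c ∈ T.ch X x, c)
    (two : ∀ x ∈ X, x ∉ V → 2 ≤ T.nc x) (lab_le : ∀ x ∈ X, x ∉ V → T.lab x ≤ 1)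
    (alt : ∀ x ∈ X, x ∉ V → x ∉ E → x ≠ T.root → T.lab x ≠ T.lab (T.par x))
    (par_root : T.par T.root = T.root) : T.IsReduced X V E where
  two x hx hxV := (h x hx hxV).1 ▸ two x hx hxV
  lab_le := lab_le
  alt := alt
  nc_eq x hx hxV := (h x hx hxV).1
  cs_eq x hx hxV := (h x hx hxV).2
  par_root := par_root

theorem IsReduced.two_le_nc {E : Finset ℕ} (h : T.IsReduced X V E) {x : ℕ} (hx : x ∈ X)
    (hxV : x ∉ V) : 2 ≤ T.nc x := h.nc_eq x hx hxV ▸ h.two x hx hxV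

/-- The new leaf `v` may be joined to the subtree of `U` by a node labelled `b`. -/
structure Attachable (T : PT) (X V : Finset ℕ) (adj : ℕ → ℕ → Prop) (v U b : ℕ) : Prop where
  tree : T.IsTree X V
  meets : T.Meets X V adj
  reduced : T.IsReduced X V {U}
  mem : U ∈ X
  le_one : b ≤ 1
  lab_par : U ≠ T.root → T.lab (T.par U) ≠ b
  above : ∀ z, z ≠ U → ∀ c ∈ T.ch X z, T.A z U → ¬ T.A c U → ∀ u ∈ V, T.A c u →
    (adj v u ↔ T.lab z = 1)
  below : ∀ u ∈ V, T.A U u → (adj v u ↔ b = 1)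

/-- The conditions on a cotree of the graph `adj` on `V`. -/
structure IsCotree (T : PT) (X V : Finset ℕ) (adj : ℕ → ℕ → Prop) : Prop where
  tree : T.IsTree X V
  meets : T.Meets X V adj
  reduced : T.IsReduced X V ∅

/-- Here `U` already has the label that must separate `v` from the leaves below it. `Attachable`
exempts `U` from alternation; in this case alternation at `U` is recovered from `lab_par`. -/
theorem Attachable.addLeaf (h : T.Attachable X V adj v U b) (hsymm : ∀ u w, adj u w → adj w u)
    (hU : U ∉ V) (hb : T.lab U = b) (ha : T.AddLeaf T' X V v U) :
    T'.IsCotree (insert v X) (insert v V) adj := by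
  have hold : ∀ {x}, x ∈ insert v X → x ∉ insert v V → x ∈ X ∧ x ∉ V := fun h1 h2 => by
    rw [Finset.mem_insert, not_or] at h2
    exact ⟨(Finset.mem_insert.1 h1).resolve_left h2.1, h2.2⟩
  refine ⟨ha.isTree h.tree, ha.meets h.tree hsymm h.meets ?_, .of_counts
    (ha.counts h.tree h.reduced.nc_eq h.reduced.cs_eq) ?_ ?_ ?_ ?_⟩
  · intro z c hc hz hcU u hu hcu
    by_cases e : z = U
    · subst e
      rw [hb]
      exact h.below u hu ((IsTree.anc_of_ch hc).trans hcu)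
    · exact h.above z e c hc hz hcU u hu hcu
  · intro x hx hxV
    obtain ⟨hx, hxV⟩ := hold hx hxV
    have := h.reduced.two_le_nc hx hxV
    by_cases e : x = U
    · have := ha.nc_base
      subst e
      omega
    · rw [ha.nc_eq x hx e]; exact this
  · intro x hx hxV
    obtain ⟨hx, hxV⟩ := hold hx hxV
    exact ha.lab_eq x hx ▸ h.reduced.lab_le x hx hxV
  · intro x hx hxV _ hxr
    obtain ⟨hx, hxV⟩ := hold hx hxV
    rw [ha.root_eq] at hxr
    rw [ha.par_eq x hx, ha.lab_eq x hx, ha.lab_eq _ (h.tree.par_mem x hx hxr).1]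
    by_cases e : x = U
    · rw [e, hb]; exact (h.lab_par (e ▸ hxr)).symm
    · exact h.reduced.alt x hx hxV (by simpa using e) hxr
  · rw [ha.root_eq, ha.par_eq _ h.tree.root_mem]
    exact h.reduced.par_root

/-- `T'` arises from `T` by putting a new node `y` with label `b` above `U`, and the new leaf `v`
below it. -/
structure Subdivide (T T' : PT) (X : Finset ℕ) (v U b y : ℕ) : Prop where
  new : y ∉ X
  new_leaf : v ∉ X
  ne : v ≠ y
  root_eq : T'.root = if U = T.root then y else T.root
  par_new : T'.par y = if U = T.root then y else T.par U
  par_base : T'.par U = y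
  par_leaf : T'.par v = y
  par_eq : ∀ x ∈ X, x ≠ U → T'.par x = T.par x
  lab_eq : ∀ x ∈ X, T'.lab x = T.lab x
  lab_new : T'.lab y = b
  nc_new : T'.nc y = 2
  nc_eq : ∀ x ∈ X, T'.nc x = T.nc x
  cs_new : T'.cs y = U + v
  cs_par : U ≠ T.root → T'.cs (T.par U) + U = T.cs (T.par U) + y
  cs_eq : ∀ x ∈ X, (U ≠ T.root → x ≠ T.par U) → T'.cs x = T.cs x

/-- The insertion is a `SplitUp` that moves no children, followed by an `AddLeaf`. The new node has
label `b`, which differs from the label of the parent of `U` by `lab_par` and from that of `U` by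
`hU`. So alternation is restored even if `U` and its parent had equal labels before. -/
theorem Attachable.subdivide (h : T.Attachable X V adj v U b)
    (hsymm : ∀ u w, adj u w → adj w u) (hU : U ∉ V → T.lab U ≠ b)
    (ha : T.Subdivide T' X v U b y) :
    T'.IsCotree (insert v (insert y X)) (insert v V) adj := by
  have ht := h.tree
  have hyX : ∀ {x}, x ∈ X → x ≠ y := fun hx e => ha.new (e ▸ hx)
  -- The intermediate tree, in which `y` has the only child `U`. It is not reduced, but the lemmas
  -- on forks and counts do not require this.
  let T₁ : PT := { T' with nc := Function.update T'.nc y 1, cs := Function.update T'.cs y U }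
  have h₁ : T.SplitUp T₁ X V ∅ U y :=
    { mem := h.mem, new := ha.new, sub := by simp, root_eq := ha.root_eq, par_new := ha.par_new
      par_base := ha.par_base, par_moved := by simp, par_eq := fun x hx hxU _ => ha.par_eq x hx hxU
      lab_eq := ha.lab_eq, lab_new := by simp, nc_new := by simp [T₁]
      nc_base := fun _ => by simp [T₁, hyX h.mem, ha.nc_eq U h.mem]
      nc_eq := fun x hx _ => by simp [T₁, hyX hx, ha.nc_eq x hx]
      cs_new := by simp [T₁]
      cs_base := fun hUV => by
        simp only [T₁, Finset.sum_empty, add_zero, Function.update_of_ne (hyX h.mem)]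
        refine ha.cs_eq U h.mem fun hr e => ht.ne_of_ch (mem_ch.2 ⟨h.mem, hr, e.symm⟩) rfl
      cs_par := fun hr => by
        simp only [T₁, Function.update_of_ne (hyX (ht.par_mem U h.mem hr).1)]
        exact ha.cs_par hr
      cs_eq := fun x hx _ hxp => by
        simp only [T₁, Function.update_of_ne (hyX hx)]
        exact ha.cs_eq x hx hxp }
  have ht₁ := h₁.isTree ht
  have hyV : y ∉ V := fun e => ha.new (ht.sub e)
  have hyv : v ∉ insert y X := by simp [ha.ne, ha.new_leaf]
  have h₂ : T₁.AddLeaf T' (insert y X) V v y :=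
    { mem := Finset.mem_insert_self _ _, notMem := hyV, new := hyv, root_eq := rfl
      par_new := ha.par_leaf, par_eq := fun _ _ => rfl, lab_eq := fun _ _ => rfl
      nc_base := by simp [T₁, ha.nc_new], nc_eq := fun x _ hxy => by simp [T₁, hxy]
      cs_base := by simp [T₁, ha.cs_new], cs_eq := fun x _ hxy => by simp [T₁, hxy] }
  have hcnt := h₁.counts ht h.reduced.nc_eq h.reduced.cs_eq
  have hold : ∀ {x}, x ∈ insert v (insert y X) → x ∉ insert v V → x = y ∨ x ∈ X ∧ x ∉ V :=
    fun h1 h2 => by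
      rw [Finset.mem_insert, not_or] at h2
      rcases Finset.mem_insert.1 ((Finset.mem_insert.1 h1).resolve_left h2.1) with e | e
      · exact .inl e
      · exact .inr ⟨e, h2.2⟩
  refine ⟨h₂.isTree ht₁, h₂.meets ht₁ hsymm (h₁.meets ht h.meets) ?_, .of_counts
    (h₂.counts ht₁ (fun x hx hxV => (hcnt x hx hxV).1) fun x hx hxV => (hcnt x hx hxV).2)
    ?_ ?_ ?_ ?_⟩
  · intro z c hc hz hcy u hu hcu
    have huX := ht.sub hu
    by_cases hzy : z = y
    · rw [hzy, h₁.ch_new ht] at hc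
      obtain rfl : c = U := by simpa using hc
      rw [hzy, show T₁.lab y = b from ha.lab_new]
      refine h.below u hu ?_
      rcases (h₁.anc_base ht huX).1 hcu with rfl | ⟨d, hd, _, hdu⟩
      · exact .refl _
      · exact (IsTree.anc_of_ch hd).trans hdu
    · have hzX := (Finset.mem_insert.1 (ht₁.mem_of_ch hc).1).resolve_left hzy
      have hcX : c ∈ X := (Finset.mem_insert.1 (mem_ch.1 hc).1).resolve_left fun e =>
        hcy (e ▸ .refl _)
      have hUy : U ∈ T₁.ch (insert y X) y := by rw [h₁.ch_new ht]; simp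
      have hzU : z ≠ U := fun e => ht₁.not_anc_of_ch hUy (e ▸ hz)
      obtain ⟨hc', hcU, _⟩ := (h₁.mem_ch_old hzX hcX).1 hc
      rw [show T₁.lab z = T.lab z from ha.lab_eq z hzX]
      refine h.above z hzU c hc' ((h₁.anc_down ht hzX hz).2 rfl) (fun hcU' => hcy ?_) u hu
        ((h₁.anc_iff ht huX hcX hcU).1 hcu)
      have := (h₁.anc_iff ht h.mem hcX hcU).2 hcU'
      have := (Anc.of_ne this hcU).2
      rwa [h₁.par_base] at this
  · intro x hx hxV
    rcases hold hx hxV with rfl | ⟨hx, hxV⟩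
    · exact ha.nc_new.ge
    · exact ha.nc_eq x hx ▸ h.reduced.two_le_nc hx hxV
  · intro x hx hxV
    rcases hold hx hxV with rfl | ⟨hx, hxV⟩
    · exact ha.lab_new ▸ h.le_one
    · exact ha.lab_eq x hx ▸ h.reduced.lab_le x hx hxV
  · intro x hx hxV _ hxr
    rcases hold hx hxV with rfl | ⟨hx, hxV⟩
    · have hr := (h₁.new_ne_root ht).1 hxr
      rw [ha.par_new, if_neg hr, ha.lab_new, ha.lab_eq _ (ht.par_mem U h.mem hr).1]
      exact (h.lab_par hr).symm
    · by_cases e : x = U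
      · rw [e, ha.par_base, ha.lab_new, ha.lab_eq U h.mem]
        exact hU (e ▸ hxV)
      · have hxr' : x ≠ T.root := ((h₁.ne_root hx).1 hxr).resolve_left e
        rw [ha.par_eq x hx e, ha.lab_eq x hx, ha.lab_eq _ (ht.par_mem x hx hxr').1]
        exact h.reduced.alt x hx hxV (by simpa using e) hxr'
  · rw [ha.root_eq]
    split_ifs with hr
    · rw [ha.par_new, if_pos hr]
    · rw [ha.par_eq _ ht.root_mem (Ne.symm hr), h.reduced.par_root]

theorem IsReduced.weaken {E : Finset ℕ} (h : T.IsReduced X V ∅) : T.IsReduced X V E :=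
  { h with alt := fun x hx hxV _ => h.alt x hx hxV (by simp) }

/-- The case without mixed nodes: `v` is adjacent to all earlier vertices or to none. Nothing lies
above the root, so `above` is vacuous. -/
theorem IsCotree.attachable_root (h : T.IsCotree X V adj) (hb : b ≤ 1)
    (hv : ∀ u ∈ V, (adj v u ↔ b = 1)) : T.Attachable X V adj v T.root b where
  tree := h.tree
  meets := h.meets
  reduced := h.reduced.weaken
  mem := h.tree.root_mem
  le_one := hb
  lab_par hr := absurd rfl hr
  above _ hz _ _ hz' := absurd (Anc.root_right hz') hz
  below u hu _ := hv u hu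

/-- The node `β` of the cotree is the place where the new vertex `v` has to be inserted; `F` are
the nodes below which all leaves are adjacent to `v`. -/
structure IsSite (T : PT) (X V F : Finset ℕ) (adj : ℕ → ℕ → Prop) (v β : ℕ) : Prop where
  mem : β ∈ X
  notMem : β ∉ V
  above : ∀ z, z ≠ β → ∀ c ∈ T.ch X z, T.A z β → ¬ T.A c β → ∀ u ∈ V, T.A c u →
    (adj v u ↔ T.lab z = 1)
  full : ∀ c ∈ T.ch X β, ∀ u ∈ V, T.A c u → (adj v u ↔ c ∈ F)

/-- This covers the two cases in which `β` need not be split: a 1-node all of whose children but `U`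
are full (`b = 0`), and a 0-node whose only full child is `U` (`b = 1`). -/
theorem IsSite.attachable_child (hs : T.IsSite X V F adj v β) (h : T.IsCotree X V adj)
    (hU : U ∈ T.ch X β) (hb : b ≤ 1) (hbβ : T.lab β ≠ b) (hUF : U ∈ F ↔ b = 1)
    (hoth : ∀ c ∈ T.ch X β, c ≠ U → (c ∈ F ↔ T.lab β = 1)) : T.Attachable X V adj v U b where
  tree := h.tree
  meets := h.meets
  reduced := h.reduced.weaken
  mem := (mem_ch.1 hU).1
  le_one := hb
  lab_par _ := (mem_ch.1 hU).2.2 ▸ hbβ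
  above z hz c hc hzU hcU u hu hcu := by
    have hzβ := (Anc.of_ne hzU hz).2
    rw [(mem_ch.1 hU).2.2] at hzβ
    by_cases e : z = β
    · subst e
      rw [hs.full c hc u hu hcu, hoth c hc fun e => hcU (e ▸ .refl _)]
    · exact hs.above z e c hc hzβ (fun h' => hcU (h'.trans (IsTree.anc_of_ch hU))) u hu hcu
  below u hu hUu := by rw [hs.full U hU u hu hUu, hUF]

/-- The full children of the 1-node `β` are moved above it, so that no leaf remaining below `β` is
adjacent to `v`; then `v` and `β` have to be joined by a 0-node. Meanwhile `β` and its parent `y`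
are both 1-nodes, which is why `β` is exempt from alternation. By `hcard`, at least two children
stay with `β`. -/
theorem IsSite.attachable_splitUp (hs : T.IsSite X V F adj v β) (h : T.IsCotree X V adj)
    (hβ : T.lab β = 1) (hM : M = T.ch X β ∩ F) (hne : M.Nonempty)
    (hcard : M.card + 2 ≤ (T.ch X β).card) (hsp : T.SplitUp T' X V M β y) :
    T'.Attachable (insert y X) V adj v β 0 := by
  have ht := h.tree
  have hyV : y ∉ V := fun e => hsp.new (ht.sub e)
  refine
    { tree := hsp.isTree ht
      meets := hsp.meets ht h.meets
      reduced := .of_counts (hsp.counts ht h.reduced.nc_eq h.reduced.cs_eq) ?_ ?_ ?_ ?_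
      mem := Finset.mem_insert_of_mem hs.mem
      le_one := by simp
      lab_par := fun _ => by rw [hsp.par_base, hsp.lab_new hne, hβ]; simp
      above := ?_
      below := ?_ }
  · intro x hx hxV
    rcases Finset.mem_insert.1 hx with rfl | hx
    · rw [hsp.nc_new]
      have := hne.card_pos
      omega
    · by_cases e : x = β
      · have := hsp.nc_base hs.notMem
        rw [h.reduced.nc_eq β hs.mem hs.notMem] at this
        subst e
        omega
      · rw [hsp.nc_eq x hx e]
        exact h.reduced.two_le_nc hx hxV
  · intro x hx hxV
    rcases Finset.mem_insert.1 hx with rfl | hx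
    · rw [hsp.lab_new hne, hβ]
    · exact hsp.lab_eq x hx ▸ h.reduced.lab_le x hx hxV
  · intro x hx hxV hxβ hxr
    rw [Finset.mem_singleton] at hxβ
    rcases Finset.mem_insert.1 hx with rfl | hx
    · have hr := (hsp.new_ne_root ht).1 hxr
      rw [hsp.par_new, if_neg hr, hsp.lab_new hne, hsp.lab_eq _ (ht.par_mem β hs.mem hr).1]
      exact h.reduced.alt β hs.mem hs.notMem (by simp) hr
    · have hxr' := ((hsp.ne_root hx).1 hxr).resolve_left hxβ
      have := h.reduced.alt x hx hxV (by simp) hxr'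
      by_cases hxM : x ∈ M
      · rw [hsp.par_moved x hxM, hsp.lab_new hne, hsp.lab_eq x hx, ← (hsp.moved hxM).2.2]
        exact this
      · rw [hsp.par_eq x hx hxβ hxM, hsp.lab_eq x hx, hsp.lab_eq _ (ht.par_mem x hx hxr').1]
        exact this
  · rw [hsp.root_eq]
    split_ifs with hr
    · rw [hsp.par_new, if_pos hr]
    · rw [hsp.par_eq _ ht.root_mem (Ne.symm hr) fun e => (hsp.moved e).2.1 rfl,
        h.reduced.par_root]
  · intro z hz c hc hzβ hcβ u hu hcu
    have huX := ht.sub hu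
    by_cases hzy : z = y
    · rw [hzy, hsp.ch_new ht, Finset.mem_insert] at hc
      rcases hc with rfl | hc
      · exact absurd (.refl _) hcβ
      · have hc' := hsp.sub hc
        rw [hzy, hsp.lab_new hne, hβ, hs.full c hc' u hu
          ((hsp.anc_iff ht huX (mem_ch.1 hc').1 (ht.ne_of_ch hc')).1 hcu)]
        rw [hM, Finset.mem_inter] at hc
        simp [hc.2]
    · have hzX := (Finset.mem_insert.1 ((hsp.isTree ht).mem_of_ch hc).1).resolve_left hzy
      have hcX : c ∈ X := by
        refine (Finset.mem_insert.1 (mem_ch.1 hc).1).resolve_left ?_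
        rintro rfl
        exact hcβ ((hsp.anc_new ht hs.mem).2 (.refl _))
      obtain ⟨hc', hcβ', _⟩ := (hsp.mem_ch_old hzX hcX).1 hc
      rw [hsp.lab_eq z hzX]
      exact hs.above z hz c hc' ((hsp.anc_iff ht hs.mem hzX hz).1 hzβ)
        (fun h' => hcβ ((hsp.anc_iff ht hs.mem hcX hcβ').2 h')) u hu
        ((hsp.anc_iff ht huX hcX hcβ').1 hcu)
  · intro u hu hβu
    rcases (hsp.anc_base ht (ht.sub hu)).1 hβu with rfl | ⟨d, hd, hdM, hdu⟩
    · exact absurd hu hs.notMem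
    · rw [hs.full d hd u hu hdu]
      rw [hM, Finset.mem_inter] at hdM
      simp only [zero_ne_one, iff_false]
      exact fun e => hdM ⟨hd, e⟩

/-- The full children of the 0-node `β` are gathered below `y`, so that `v` is adjacent to all
leaves below `y` and has to be joined to it by a 1-node. Until then `y` repeats the label of `β`.
The hypothesis `hcard` gives `y` two children, and `hlt` leaves `β` one besides `y`. -/
theorem IsSite.attachable_splitDown (hs : T.IsSite X V F adj v β) (h : T.IsCotree X V adj)
    (hβ : T.lab β = 0) (hM : M = T.ch X β ∩ F) (hcard : 2 ≤ M.card)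
    (hlt : M.card < (T.ch X β).card) (hsp : T.SplitDown T' X V M β y) :
    T'.Attachable (insert y X) V adj v y 1 := by
  have ht := h.tree
  have hyV : y ∉ V := fun e => hsp.new (ht.sub e)
  refine
    { tree := hsp.isTree ht
      meets := hsp.meets ht h.meets
      reduced := .of_counts (hsp.counts ht h.reduced.nc_eq h.reduced.cs_eq) ?_ ?_ ?_ ?_
      mem := Finset.mem_insert_self _ _
      le_one := le_rfl
      lab_par := fun _ => by rw [hsp.par_new, hsp.lab_eq β hs.mem, hβ]; simp
      above := ?_
      below := ?_ }
  · intro x hx hxV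
    rcases Finset.mem_insert.1 hx with rfl | hx
    · rw [hsp.nc_new]
      exact hcard
    · by_cases e : x = β
      · have := hsp.nc_base
        rw [h.reduced.nc_eq β hs.mem hs.notMem] at this
        subst e
        omega
      · rw [hsp.nc_eq x hx e]
        exact h.reduced.two_le_nc hx hxV
  · intro x hx hxV
    rcases Finset.mem_insert.1 hx with rfl | hx
    · rw [hsp.lab_new, hβ]; simp
    · exact hsp.lab_eq x hx ▸ h.reduced.lab_le x hx hxV
  · intro x hx hxV hxy hxr
    rw [Finset.mem_singleton] at hxy
    have hx := (Finset.mem_insert.1 hx).resolve_left hxy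
    have hxr' : x ≠ T.root := hsp.root_eq ▸ hxr
    have := h.reduced.alt x hx hxV (by simp) hxr'
    by_cases hxM : x ∈ M
    · rw [hsp.par_moved x hxM, hsp.lab_new, hsp.lab_eq x hx, ← (hsp.moved hxM).2.2]
      exact this
    · rw [hsp.par_eq x hx hxM, hsp.lab_eq x hx, hsp.lab_eq _ (ht.par_mem x hx hxr').1]
      exact this
  · rw [hsp.root_eq, hsp.par_eq _ ht.root_mem fun e => (hsp.moved e).2.1 rfl, h.reduced.par_root]
  · intro z hz c hc hzy hcy u hu hcu
    have huX := ht.sub hu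
    have hzX := (Finset.mem_insert.1 ((hsp.isTree ht).mem_of_ch hc).1).resolve_left hz
    have hcX : c ∈ X := (Finset.mem_insert.1 (mem_ch.1 hc).1).resolve_left fun e =>
      hcy (e ▸ .refl _)
    obtain ⟨hc', hcM⟩ := (hsp.mem_ch_old hzX hcX).1 hc
    have hcu' := (hsp.anc_iff ht huX hcX).1 hcu
    rw [hsp.lab_eq z hzX]
    by_cases e : z = β
    · subst e
      rw [hs.full c hc' u hu hcu', hβ]
      simp only [zero_ne_one, iff_false]
      exact fun e => hcM (hM ▸ Finset.mem_inter.2 ⟨hc', e⟩)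
    · refine hs.above z e c hc' ((hsp.anc_down ht hzX hzy).2 rfl) (fun h' => hcy ?_) u hu hcu'
      exact ((hsp.anc_iff ht hs.mem hcX).2 h').trans
        (IsTree.anc_of_ch ((hsp.new_mem_ch ht).2 rfl))
  · intro u hu hyu
    obtain ⟨a, ha, hau⟩ := (hsp.anc_new ht (ht.sub hu)).1 hyu
    rw [hs.full a (hsp.sub ha) u hu hau]
    rw [hM, Finset.mem_inter] at ha
    simp [ha.2]

/-! ### Nodes that are full, empty, or neither -/

/-- `F` is the set of the nodes below which all leaves are adjacent to `v`. -/
structure IsFull (T : PT) (X V F : Finset ℕ) (adj : ℕ → ℕ → Prop) (v : ℕ) : Prop where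
  leaf : ∀ u ∈ V, (u ∈ F ↔ adj v u)
  node : ∀ x ∈ X, x ∉ V → (x ∈ F ↔ T.ch X x ⊆ F)

/-- Some child is full, but not all are. -/
def IsMixed (T : PT) (X V F : Finset ℕ) (x : ℕ) : Prop :=
  x ∈ X ∧ x ∉ V ∧ x ∉ F ∧ ∃ c ∈ T.ch X x, c ∈ F

namespace IsFull

theorem of_anc (hF : T.IsFull X V F adj v) (ht : T.IsTree X V) {x w : ℕ} (hw : w ∈ X)
    (hxw : T.A x w) (hx : x ∈ F) : w ∈ F := by
  unfold A at hxw
  induction hxw with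
  | refl => exact hx
  | @up w hwr _ ih =>
    obtain ⟨h1, h2⟩ := ht.par_mem w hw hwr
    exact (hF.node _ h1 h2).1 (ih h1) (mem_ch.2 ⟨hw, hwr, rfl⟩)

/-- On the way up from the full node `w` to the node `x`, which is not full, the first node that is
not full is mixed. -/
theorem exists_mixed (_hF : T.IsFull X V F adj v) (ht : T.IsTree X V) {x w : ℕ} (hw : w ∈ X)
    (hxw : T.A x w) (hx : x ∉ F) (hwF : w ∈ F) : ∃ q, T.IsMixed X V F q ∧ T.A x q := by
  unfold A at hxw
  induction hxw with
  | refl => exact absurd hwF hx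
  | @up w hwr h' ih =>
    obtain ⟨h1, h2⟩ := ht.par_mem w hw hwr
    by_cases hp : T.par w ∈ F
    · exact ih h1 hp
    · exact ⟨T.par w, ⟨h1, h2, hp, w, mem_ch.2 ⟨hw, hwr, rfl⟩, hwF⟩, h'⟩

/-- The program propagates fullness from children to parents; this links it to the leaves, in terms
of which insertion is described. -/
theorem mem_iff (hF : T.IsFull X V F adj v) (ht : T.IsTree X V) :
    ∀ x ∈ X, (x ∈ F ↔ ∀ u ∈ V, T.A x u → adj v u) := by
  refine ht.induction_down fun x hx ih => ⟨fun h u hu hxu =>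
    (hF.leaf u hu).1 (hF.of_anc ht (ht.sub hu) hxu h), fun h => ?_⟩
  by_cases hxV : x ∈ V
  · exact (hF.leaf x hxV).2 (h x hxV (.refl _))
  · exact (hF.node x hx hxV).2 fun c hc =>
      (ih c hc).2 fun u hu hcu => h u hu ((IsTree.anc_of_ch hc).trans hcu)

/-- When the nodes above `β` have the right children, then `β` is the place for `v`. -/
theorem isSite (hF : T.IsFull X V F adj v) (h : T.IsCotree X V adj) (hβ : T.IsMixed X V F β)
    (hall : ∀ q, T.IsMixed X V F q → T.A q β)
    (hpath : ∀ z, T.A z β → z ≠ β →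
      (T.lab z = 1 → (T.ch X z ∩ F).card + 1 = (T.ch X z).card) ∧
      (T.lab z = 0 → T.ch X z ∩ F = ∅)) : T.IsSite X V F adj v β := by
  have ht := h.tree
  -- If a node that is not full had a neighbour of `v` below it, then it would have a mixed node
  -- below it. By `hall` that node is above `β`, and so the given one would be above `β` as well.
  have key : ∀ c ∈ X, c ∉ F → ¬ T.A c β → ∀ u ∈ V, T.A c u → ¬ adj v u := by
    intro c _ hcF hcβ u hu hcu hvu
    obtain ⟨q, hq, hcq⟩ := hF.exists_mixed ht (ht.sub hu) hcu hcF ((hF.leaf u hu).2 hvu)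
    exact hcβ (hcq.trans (hall q hq))
  refine ⟨hβ.1, hβ.2.1, fun z hz c hc hzβ hcβ u hu hcu => ?_, fun c hc u hu hcu => ?_⟩
  · obtain ⟨d, hd, hdβ⟩ := ht.exists_child hβ.1 hzβ hz
    have hdF : d ∉ F := fun e => hβ.2.2.1 (hF.of_anc ht hβ.1 hdβ e)
    have hcd : c ≠ d := fun e => hcβ (e ▸ hdβ)
    have hcX := (mem_ch.1 hc).1
    have hzX := ht.mem_of_ch hc
    rcases Nat.le_one_iff_eq_zero_or_eq_one.1 (h.reduced.lab_le z hzX.1 hzX.2) with h0 | h1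
    · have hcF : c ∉ F := fun e => by
        have := (hpath z hzβ hz).2 h0
        exact Finset.notMem_empty c (this ▸ Finset.mem_inter.2 ⟨hc, e⟩)
      simp only [h0, zero_ne_one, iff_false]
      exact key c hcX hcF hcβ u hu hcu
    · have hcF : c ∈ F := by
        by_contra hcF
        -- The child `d` towards `β` is not full either. If `c` were not full, at least two children
        -- would be missing from `F`, whereas `hpath` allows only one.
        have hsub : T.ch X z ∩ F ⊆ ((T.ch X z).erase c).erase d := fun x hx => by
          rw [Finset.mem_inter] at hx
          refine Finset.mem_erase.2 ⟨?_, Finset.mem_erase.2 ⟨?_, hx.1⟩⟩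
          · rintro rfl; exact hdF hx.2
          · rintro rfl; exact hcF hx.2
        have := Finset.card_le_card hsub
        have h3 := (hpath z hzβ hz).1 h1
        have h4 := Finset.card_erase_add_one (Finset.mem_erase.2 ⟨hcd.symm, hd⟩)
        have h5 := Finset.card_erase_add_one hc
        omega
      simp only [h1, iff_true]
      exact (hF.mem_iff ht c hcX).1 hcF u hu hcu
  · by_cases hcF : c ∈ F
    · simp only [hcF, iff_true]
      exact (hF.mem_iff ht c (mem_ch.1 hc).1).1 hcF u hu hcu
    · simp only [hcF, iff_false]
      exact key c (mem_ch.1 hc).1 hcF (ht.not_anc_of_ch hc) u hu hcu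

end IsFull

/-! ### Graphs without induced paths on four vertices -/

end PT

/-- There is no induced path on four vertices. -/
def NoP4 (adj : ℕ → ℕ → Prop) : Prop :=
  ∀ a b c d, adj a b → adj b c → adj c d → ¬ adj a c → ¬ adj a d → ¬ adj b d → False

namespace PT

variable {T : PT} {X V F : Finset ℕ} {adj : ℕ → ℕ → Prop} {v β : ℕ}

/-- Some, but not all leaves below `x` are adjacent to `v`. -/
def IsPartial (T : PT) (V : Finset ℕ) (adj : ℕ → ℕ → Prop) (v x : ℕ) : Prop :=
  (∃ u ∈ V, T.A x u ∧ adj v u) ∧ ∃ u ∈ V, T.A x u ∧ ¬ adj v u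

/-! ### Where the neighbours of a new vertex lie in the cotree of a cograph. -/

namespace IsCotree

variable {x z c d q : ℕ}

theorem partial_mono (_h : T.IsCotree X V adj) (hx : T.IsPartial V adj v x) (hzx : T.A z x) :
    T.IsPartial V adj v z := by
  obtain ⟨⟨s, hs, hs', hs''⟩, t, ht, ht', ht''⟩ := hx
  exact ⟨⟨s, hs, hzx.trans hs', hs''⟩, t, ht, hzx.trans ht', ht''⟩

theorem partial_notMem (h : T.IsCotree X V adj) (hx : T.IsPartial V adj v x) : x ∉ V := by
  obtain ⟨⟨s, hs, hs', hs''⟩, t, ht, ht', ht''⟩ := hx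
  intro hxV
  rw [← h.tree.anc_leaf (h.tree.sub hs) hxV hs'] at hs''
  rw [← h.tree.anc_leaf (h.tree.sub ht) hxV ht'] at ht''
  exact ht'' hs''

/-- If a neighbour and a nonneighbour of `v` are below the same child, then any leaf below another
child forms, with one of these two, a pair separated at `x`. -/
theorem partial_fork (h : T.IsCotree X V adj) (hxX : x ∈ X) (hx : T.IsPartial V adj v x) :
    ∃ c ∈ T.ch X x, ∃ d ∈ T.ch X x, ∃ s ∈ V, ∃ t ∈ V, c ≠ d ∧ T.A c s ∧ T.A d t ∧ adj v s ∧
      ¬ adj v t := by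
  have hxV := h.partial_notMem hx
  obtain ⟨⟨s, hs, hs', hs''⟩, t, ht, ht', ht''⟩ := hx
  obtain ⟨c, hc, hcs⟩ := h.tree.exists_child (h.tree.sub hs) hs' fun e => hxV (e ▸ hs)
  obtain ⟨d, hd, hdt⟩ := h.tree.exists_child (h.tree.sub ht) ht' fun e => hxV (e ▸ ht)
  by_cases hcd : c = d
  · subst hcd
    obtain ⟨e, he, hec⟩ := IsTree.exists_other_child h.reduced hxX hxV c
    obtain ⟨u, hu, heu⟩ := h.tree.exists_leaf h.reduced e (mem_ch.1 he).1
    by_cases hvu : adj v u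
    · exact ⟨e, he, c, hc, u, hu, t, ht, hec, heu, hdt, hvu, ht''⟩
    · exact ⟨c, hc, e, he, s, hs, u, hu, hec.symm, hcs, heu, hs'', hvu⟩
  · exact ⟨c, hc, d, hd, s, hs, t, ht, hcd, hcs, hdt, hs'', ht''⟩

/-- A sibling of a partial node is full below a 1-node, and empty below a 0-node. -/
theorem sibling_of_partial (h : T.IsCotree X V adj) (hsymm : ∀ u w, adj u w → adj w u)
    (hP : NoP4 adj) (hc : c ∈ T.ch X z) (hd : d ∈ T.ch X z) (hcd : c ≠ d)
    (hcp : T.IsPartial V adj v c) : ∀ u ∈ V, T.A d u → (adj v u ↔ T.lab z = 1) := by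
  intro u hu hdu
  obtain ⟨hcX, hcr, hcz⟩ := mem_ch.1 hc
  have hzX := h.tree.mem_of_ch hc
  have hcV := h.partial_notMem hcp
  have hlc := h.reduced.lab_le c hcX hcV
  have hlz := h.reduced.lab_le z hzX.1 hzX.2
  have hne := h.reduced.alt c hcX hcV (by simp) hcr
  rw [hcz] at hne
  obtain ⟨e, he, f, hf, s, hs, t, ht, hef, hes, hft, hvs, hvt⟩ := h.partial_fork hcX hcp
  have hst := h.tree.adj_iff h.meets hs ht he hf hef hes hft
  have hcs : T.A c s := (IsTree.anc_of_ch he).trans hes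
  have hct : T.A c t := (IsTree.anc_of_ch hf).trans hft
  have hsu := h.tree.adj_iff h.meets hs hu hc hd hcd hcs hdu
  have htu := h.tree.adj_iff h.meets ht hu hc hd hcd hct hdu
  -- By alternation `c` has the opposite label. If `z` is a 1-node and `u` is not adjacent to `v`,
  -- then `v, s, u, t` is an induced path; if `z` is a 0-node and `u` is adjacent to `v`, then `u,
  -- v, s, t` is one.
  by_cases hz : T.lab z = 1
  · simp only [hz, iff_true] at hsu htu ⊢
    by_contra hvu
    have : ¬ adj s t := fun e => hne ((hst.1 e).trans hz.symm)
    exact hP v s u t hvs hsu (hsymm _ _ htu) hvu hvt this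
  · simp only [hz, iff_false] at hsu htu ⊢
    intro hvu
    have : adj s t := hst.2 (by omega)
    exact hP u v s t (hsymm _ _ hvu) hvs this (fun e => hsu (hsymm _ _ e))
      (fun e => htu (hsymm _ _ e)) hvt

theorem partial_iff (h : T.IsCotree X V adj) (hF : T.IsFull X V F adj v) (hx : x ∈ X) :
    T.IsPartial V adj v x ↔ x ∉ F ∧ ∃ u ∈ V, T.A x u ∧ adj v u := by
  rw [hF.mem_iff h.tree x hx, IsPartial]
  push Not
  tauto

theorem partial_of_mixed (h : T.IsCotree X V adj) (hF : T.IsFull X V F adj v)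
    (hq : T.IsMixed X V F q) : T.IsPartial V adj v q := by
  obtain ⟨hqX, hqV, hqF, c, hc, hcF⟩ := hq
  refine (h.partial_iff hF hqX).2 ⟨hqF, ?_⟩
  have hcX := (mem_ch.1 hc).1
  obtain ⟨u, hu, hcu⟩ := h.tree.exists_leaf h.reduced c hcX
  exact ⟨u, hu, (IsTree.anc_of_ch hc).trans hcu, (hF.mem_iff h.tree c hcX).1 hcF u hu hcu⟩

/-- In a graph without induced paths on four vertices, the mixed nodes lie above one of them, and
the nodes above it have the right children. -/
theorem exists_bottom (h : T.IsCotree X V adj) (hsymm : ∀ u w, adj u w → adj w u)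
    (hP : NoP4 adj) (hF : T.IsFull X V F adj v) (hq : T.IsMixed X V F q) :
    ∃ β, T.IsMixed X V F β ∧ (∀ q, T.IsMixed X V F q → T.A q β) ∧
      (∀ z, T.A z β → z ≠ β →
        (T.lab z = 1 → (T.ch X z ∩ F).card + 1 = (T.ch X z).card) ∧
        (T.lab z = 0 → T.ch X z ∩ F = ∅)) ∧
      ∀ q, T.IsMixed X V F q → q ≠ β → ∃ p, T.IsMixed X V F p ∧ p ≠ T.root ∧
        (T.par p = q ∨ T.par (T.par p) = q) := by
  have ht := h.tree
  -- A lowest partial node. If there were none, induction from the leaves upwards would show that no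
  -- node is partial, but mixed nodes are.
  obtain ⟨β, hβX, hβ, hmin⟩ : ∃ β ∈ X, T.IsPartial V adj v β ∧
      ∀ c ∈ T.ch X β, ¬ T.IsPartial V adj v c := by
    by_contra hno
    push Not at hno
    refine ht.induction_down (p := fun x => ¬ T.IsPartial V adj v x) (fun x hx ih hxp => ?_) q hq.1
      (h.partial_of_mixed hF hq)
    obtain ⟨c, hc, hcp⟩ := hno x hx hxp
    exact ih c hc hcp
  have hβV := h.partial_notMem hβ
  have hβm : T.IsMixed X V F β := by
    obtain ⟨c, hc, d, hd, s, hs, t, ht', hcd, hcs, hdt, hvs, hvt⟩ := h.partial_fork hβX hβ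
    refine ⟨hβX, hβV, ((h.partial_iff hF hβX).1 hβ).1, c, hc, ?_⟩
    by_contra hcF
    exact hmin c hc ((h.partial_iff hF (mem_ch.1 hc).1).2 ⟨hcF, s, hs, hcs, hvs⟩)
  -- A partial node strictly below `β` contradicts minimality. A partial node incomparable to `β`
  -- would yield two partial siblings, while the siblings of a partial node are homogeneous.
  have hpart : ∀ q ∈ X, T.IsPartial V adj v q → T.A q β := by
    intro q hqX hqp
    by_contra hqβ
    by_cases hβq : T.A β q
    · obtain ⟨c, hc, hcq⟩ := ht.exists_child hqX hβq fun e => hqβ (e ▸ .refl _)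
      exact hmin c hc (h.partial_mono hqp hcq)
    · obtain ⟨z, c, d, hcd, hc, hd, hcq, hdβ⟩ := ht.exists_fork hqX hβX hqβ hβq
      have hsib := h.sibling_of_partial hsymm hP hc hd hcd (h.partial_mono hqp hcq)
      obtain ⟨⟨s, hs, hs', hs''⟩, t, ht, ht', ht''⟩ := h.partial_mono hβ hdβ
      exact ht'' ((hsib t ht ht').2 ((hsib s hs hs').1 hs''))
  have hsplit : ∀ z d, z ≠ β → T.A z β → d ∈ T.ch X z → T.A d β → ∀ c ∈ T.ch X z, c ≠ d →
      (c ∈ F ↔ T.lab z = 1) := by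
    intro z d hz hzβ hd hdβ c hc hcd
    have hcX := (mem_ch.1 hc).1
    have hsib := h.sibling_of_partial hsymm hP hd hc hcd.symm (h.partial_mono hβ hdβ)
    rw [hF.mem_iff ht c hcX]
    obtain ⟨u, hu, hcu⟩ := ht.exists_leaf h.reduced c hcX
    exact ⟨fun h' => (hsib u hu hcu).1 (h' u hu hcu), fun h' u hu hcu => (hsib u hu hcu).2 h'⟩
  have hnF : ∀ z, T.A z β → z ∉ F := fun z hz hzF => hβm.2.2.1 (hF.of_anc ht hβX hz hzF)
  refine ⟨β, hβm, fun q hq => hpart q hq.1 (h.partial_of_mixed hF hq), fun z hzβ hz => ?_, ?_⟩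
  · obtain ⟨d, hd, hdβ⟩ := ht.exists_child hβX hzβ hz
    have hs := hsplit z d hz hzβ hd hdβ
    constructor
    · intro hl
      have : T.ch X z ∩ F = (T.ch X z).erase d := by
        ext c
        rw [Finset.mem_inter, Finset.mem_erase]
        constructor
        · exact fun h' => ⟨fun e => hnF d hdβ (e ▸ h'.2), h'.1⟩
        · exact fun h' => ⟨h'.2, (hs c h'.2 h'.1).2 hl⟩
      rw [this, Finset.card_erase_add_one hd]
    · intro hl
      refine Finset.eq_empty_of_forall_notMem fun c hc => ?_
      rw [Finset.mem_inter] at hc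
      by_cases e : c = d
      · exact hnF d hdβ (e ▸ hc.2)
      · have := (hs c hc.1 e).1 hc.2
        omega
  · intro q hq hqβ
    have hqA := hpart q hq.1 (h.partial_of_mixed hF hq)
    -- A 1-node above `β` has a second child besides the one towards `β`, and this child is full.
    have hql : ∀ z, T.A z β → z ≠ β → z ∈ X → z ∉ V → T.lab z = 1 → T.IsMixed X V F z := by
      intro z hz hne hzX hzV hl
      obtain ⟨d, hd, hdβ⟩ := ht.exists_child hβX hz hne
      obtain ⟨c, hc, hcd⟩ := IsTree.exists_other_child h.reduced hzX hzV d
      exact ⟨hzX, hzV, hnF z hz, c, hc, (hsplit z d hne hz hd hdβ c hc hcd).2 hl⟩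
    have hq1 : T.lab q = 1 := by
      obtain ⟨hqX, hqV, hqF, c, hc, hcF⟩ := hq
      obtain ⟨d, hd, hdβ⟩ := ht.exists_child hβX hqA hqβ
      exact (hsplit q d hqβ hqA hd hdβ c hc fun e => hnF d hdβ (e ▸ hcF)).1 hcF
    -- On the path from the 1-node `q` down to `β`, the next node `d` is a 0-node and the node `e`
    -- after it is a 1-node, hence mixed, unless `β` comes first. In any case `q` is the parent or
    -- the grandparent of a mixed node.
    obtain ⟨d, hd, hdβ⟩ := ht.exists_child hβX hqA hqβ
    obtain ⟨hdX, hdr, hdq⟩ := mem_ch.1 hd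
    by_cases hd0 : d = β
    · exact ⟨β, hβm, hd0 ▸ hdr, .inl (hd0 ▸ hdq)⟩
    have hdp := h.partial_mono hβ hdβ
    have hdV := h.partial_notMem hdp
    obtain ⟨e, he, heβ⟩ := ht.exists_child hβX hdβ hd0
    obtain ⟨heX, her, hed⟩ := mem_ch.1 he
    by_cases he0 : e = β
    · exact ⟨β, hβm, he0 ▸ her, .inr (by rw [← he0, hed, hdq])⟩
    have heV := h.partial_notMem (h.partial_mono hβ heβ)
    have h1 := h.reduced.alt d hdX hdV (by simp) hdr
    have h2 := h.reduced.alt e heX heV (by simp) her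
    have h3 := h.reduced.lab_le d hdX hdV
    have h4 := h.reduced.lab_le e heX heV
    rw [hdq] at h1
    rw [hed] at h2
    exact ⟨e, hql e heβ he0 heX heV (by omega), her, .inr (by rw [hed, hdq])⟩

/-- A mixed node which is neither the parent nor the grandparent of a mixed node is the lowest. -/
theorem bottom_of_unflagged (h : T.IsCotree X V adj) (hsymm : ∀ u w, adj u w → adj w u)
    (hP : NoP4 adj) (hF : T.IsFull X V F adj v) (hβ : T.IsMixed X V F β)
    (hun : ∀ p, T.IsMixed X V F p → p ≠ T.root → T.par p ≠ β ∧ T.par (T.par p) ≠ β) :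
    (∀ q, T.IsMixed X V F q → T.A q β) ∧
      (∀ z, T.A z β → z ≠ β →
        (T.lab z = 1 → (T.ch X z ∩ F).card + 1 = (T.ch X z).card) ∧
        (T.lab z = 0 → T.ch X z ∩ F = ∅)) := by
  obtain ⟨β', h1, h2, h3, h4⟩ := h.exists_bottom hsymm hP hF hβ
  have : β = β' := by
    by_contra hne
    obtain ⟨p, hp, hpr, hp'⟩ := h4 β hβ hne
    have := hun p hp hpr
    tauto
  subst this
  exact ⟨h2, h3⟩

/-- All mixed nodes lie above the lowest one, so the latter cannot be the parent or the grandparent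
of any of them. -/
theorem exists_unflagged (h : T.IsCotree X V adj) (hsymm : ∀ u w, adj u w → adj w u)
    (hP : NoP4 adj) (hF : T.IsFull X V F adj v) (hq : T.IsMixed X V F q) :
    ∃ β, T.IsMixed X V F β ∧
      ∀ p, T.IsMixed X V F p → p ≠ T.root → T.par p ≠ β ∧ T.par (T.par p) ≠ β := by
  obtain ⟨β, h1, h2, h3, h4⟩ := h.exists_bottom hsymm hP hF hq
  have ht := h.tree
  refine ⟨β, h1, fun p hp hpr => ⟨fun e => ?_, fun e => ?_⟩⟩
  · exact Anc.not_parent (ht.reach p hp.1) hpr (e ▸ h2 p hp)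
  · have hpA := h2 p hp
    -- The root is its own parent, so the "grandparent" of a child of the root is the root again.
    by_cases hr : T.par p = T.root
    · rw [hr, h.reduced.par_root] at e
      exact Anc.not_parent (ht.reach p hp.1) hpr (by rw [hr.trans e]; exact hpA)
    · have := (ht.par_mem p hp.1 hpr).1
      rw [← e] at hpA
      exact Anc.not_parent (ht.reach _ this) hr ((Anc.parent hpr).trans hpA)

end IsCotree

end PT

end CICograph

namespace CICograph

/-! ### Reasoning about programs -/

namespace Memory

variable (s : Memory) (i j a v : ℕ)

@[simp] theorem setReg_reg : (s.setReg i v).reg j = if j = i then v else s.reg j := by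
  simp [setReg, Function.update_apply]

@[simp] theorem setReg_arr : (s.setReg i v).arr = s.arr := rfl

@[simp] theorem setArr_reg : (s.setArr a j v).reg = s.reg := rfl

@[simp] theorem setArr_arr (b : ℕ) :
    (s.setArr a j v).arr b = if b = a then Function.update (s.arr a) j v else s.arr b := by
  by_cases h : b = a
  · subst h; simp [setArr]
  · simp [setArr, h]

/-- `s'` agrees with `s` outside the registers `R` and the arrays `A`. -/
def Frame (R A : List ℕ) (s s' : Memory) : Prop :=
  (∀ i, i ∉ R → s'.reg i = s.reg i) ∧ ∀ a, a ∉ A → s'.arr a = s.arr a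

namespace Frame

variable {R A R' A' : List ℕ} {s s' s'' : Memory} {i a j v : ℕ}

theorem refl : Frame R A s s := ⟨fun _ _ => rfl, fun _ _ => rfl⟩

theorem setReg (h : Frame R A s s') (hi : i ∈ R) : Frame R A s (s'.setReg i v) :=
  ⟨fun k hk => by
    have : k ≠ i := fun e => hk (e ▸ hi)
    rw [setReg_reg, if_neg this]
    exact h.1 k hk, h.2⟩

theorem setArr (h : Frame R A s s') (ha : a ∈ A) : Frame R A s (s'.setArr a j v) :=
  ⟨h.1, fun k hk => by
    have : k ≠ a := fun e => hk (e ▸ ha)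
    rw [setArr_arr, if_neg this]
    exact h.2 k hk⟩

theorem mono (h : Frame R A s s') (hR : R ⊆ R') (hA : A ⊆ A') : Frame R' A' s s' :=
  ⟨fun i hi => h.1 i fun h' => hi (hR h'), fun a ha => h.2 a fun h' => ha (hA h')⟩

theorem trans (h : Frame R A s s') (h' : Frame R A s' s'') : Frame R A s s'' :=
  ⟨fun i hi => (h'.1 i hi).trans (h.1 i hi), fun a ha => (h'.2 a ha).trans (h.2 a ha)⟩

end Frame

end Memory

open Memory

namespace Expr

variable {e f : Expr} {s : Memory}

theorem lt_ne_zero : (lt e f).eval s ≠ 0 ↔ e.eval s < f.eval s := by simp [eval]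

theorem lt_eq_zero : (lt e f).eval s = 0 ↔ f.eval s ≤ e.eval s := by simp [eval]

theorem eq_ne_zero : (eq e f).eval s ≠ 0 ↔ e.eval s = f.eval s := by simp [eval]

theorem eq_eq_zero : (eq e f).eval s = 0 ↔ e.eval s ≠ f.eval s := by simp [eval]

end Expr

namespace Program

/-- The sequential composition of a list of programs. -/
def block (l : List Program) : Program := l.foldr .seq .skip

/-- The weakest precondition of a loop-free program. -/
def wp (W : ℕ) : Program → (Memory → Prop) → Memory → Prop
  | skip, Q, s => Q s
  | set i e, Q, s => e.eval s ≤ W ∧ Q (s.setReg i (e.eval s))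
  | write a e f, Q, s => f.eval s ≤ W ∧ Q (s.setArr a (e.eval s) (f.eval s))
  | seq p q, Q, s => p.wp W (q.wp W Q) s
  | ite b p q, Q, s => (b.eval s ≠ 0 → p.wp W Q s) ∧ (b.eval s = 0 → q.wp W Q s)
  | loop _ _, _, _ => False

/-- An upper bound for the number of steps of a loop-free program. -/
def cost : Program → ℕ
  | skip => 1
  | set _ e => e.cost + 1
  | write _ e f => e.cost + f.cost + 1
  | seq p q => p.cost + q.cost
  | ite b p q => b.cost + 1 + max p.cost q.cost
  | loop _ _ => 0

end Program

variable {W : ℕ}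

theorem RunsWithin.mono {p : Program} {s : Memory} {B B' : ℕ} {Q Q' : Memory → Prop}
    (h : RunsWithin W p s B Q) (hB : B ≤ B') (hQ : ∀ s', Q s' → Q' s') :
    RunsWithin W p s B' Q' := by
  obtain ⟨t, s', h1, h2, h3⟩ := h
  exact ⟨t, s', h1, h2.trans hB, hQ s' h3⟩

theorem runsWithin_seq {p q : Program} {s : Memory} {B₁ B₂ : ℕ} {Q : Memory → Prop}
    (h : RunsWithin W p s B₁ fun s' => RunsWithin W q s' B₂ Q) :
    RunsWithin W (.seq p q) s (B₁ + B₂) Q := by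
  obtain ⟨t, s', h1, h2, t', s'', h3, h4, h5⟩ := h
  exact ⟨t + t', s'', .seq p q s s' s'' t t' h1 h3, by omega, h5⟩

theorem runsWithin_ite {b : Expr} {p q : Program} {s : Memory} {B : ℕ} {Q : Memory → Prop}
    (h1 : b.eval s ≠ 0 → RunsWithin W p s B Q) (h2 : b.eval s = 0 → RunsWithin W q s B Q) :
    RunsWithin W (.ite b p q) s (b.cost + 1 + B) Q := by
  by_cases hb : b.eval s = 0
  · obtain ⟨t, s', h3, h4, h5⟩ := h2 hb
    exact ⟨_, s', .ite_false b p q s s' t hb h3, by omega, h5⟩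
  · obtain ⟨t, s', h3, h4, h5⟩ := h1 hb
    exact ⟨_, s', .ite_true b p q s s' t hb h3, by omega, h5⟩

/-- The value `0` of `Program.cost` on loops does no harm, as `wp` is `False` there. -/
theorem runsWithin_wp {p : Program} {s : Memory} {Q : Memory → Prop} (h : p.wp W Q s) :
    RunsWithin W p s p.cost Q := by
  induction p generalizing s Q with
  | skip => exact ⟨_, s, .skip s, le_rfl, h⟩
  | set i e => exact ⟨_, _, .set s i e h.1, le_rfl, h.2⟩
  | write a e f => exact ⟨_, _, .write s a e f h.1, le_rfl, h.2⟩
  | seq p q hp hq => exact runsWithin_seq ((hp h).mono le_rfl fun s' h' => hq h')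
  | ite b p q hp hq =>
    exact runsWithin_ite (fun hb => (hp (h.1 hb)).mono (le_max_left _ _) fun _ h' => h')
      fun hb => (hq (h.2 hb)).mono (le_max_right _ _) fun _ h' => h'
  | loop b p => exact h.elim

/-- A loop with an invariant that mentions an upper bound for the remaining number of steps. -/
theorem runsWithin_loop {b : Expr} {p : Program} {Q : Memory → Prop} (I : ℕ → Memory → Prop)
    (hstep : ∀ k s, I k s → b.eval s ≠ 0 →
      ∃ B, RunsWithin W p s B fun s' => ∃ k', I k' s' ∧ B + b.cost + 1 + k' ≤ k)
    (hexit : ∀ k s, I k s → b.eval s = 0 → Q s) {k : ℕ} {s : Memory} (h : I k s) :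
    RunsWithin W (.loop b p) s (k + b.cost + 1) Q := by
  induction k using Nat.strong_induction_on generalizing s with
  | _ k ih =>
    by_cases hb : b.eval s = 0
    · exact ⟨_, s, Run.loop_stop b p s hb, by omega, hexit k s h hb⟩
    · obtain ⟨B, t, s', h1, h2, k', h3, h4⟩ := hstep k s h hb
      obtain ⟨t', s'', h5, h6, h7⟩ := ih k' (by omega) h3
      exact ⟨_, s'', .loop_step b p s s' s'' t t' hb h1 h5, by omega, h7⟩

/-- A loop with a loop-free body. -/
theorem runsWithin_loop_wp {b : Expr} {p : Program} {Q : Memory → Prop} (I : ℕ → Memory → Prop)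
    (hstep : ∀ k s, I k s → b.eval s ≠ 0 →
      p.wp W (fun s' => ∃ k', k' < k ∧ I k' s') s)
    (hexit : ∀ k s, I k s → b.eval s = 0 → Q s) {k : ℕ} {s : Memory} (h : I k s) :
    RunsWithin W (.loop b p) s ((k + 1) * (p.cost + b.cost + 1)) Q := by
  refine (runsWithin_loop (k := k * (p.cost + b.cost + 1))
    (I := fun m s => ∃ k, m = k * (p.cost + b.cost + 1) ∧ I k s) ?_ ?_ ⟨k, rfl,
      h⟩).mono ?_ fun _ h => h
  · rintro _ s ⟨k, rfl, hI⟩ hb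
    refine ⟨_, (runsWithin_wp (hstep k s hI hb)).mono le_rfl ?_⟩
    rintro s' ⟨k', hk, hI'⟩
    refine ⟨_, ⟨k', rfl, hI'⟩, ?_⟩
    calc _ = (k' + 1) * (p.cost + b.cost + 1) := by ring
      _ ≤ _ := Nat.mul_le_mul_right _ hk
  · rintro _ s ⟨k, rfl, hI⟩ hb
    exact hexit k s hI hb
  · rw [Nat.add_mul, Nat.one_mul]
    omega

/-- A loop-free program followed by a loop with a loop-free body. -/
theorem runsWithin_init_loop {b : Expr} {p q : Program} {Q : Memory → Prop}
    (I : ℕ → Memory → Prop) (k : ℕ) {s : Memory} (hinit : p.wp W (I k) s)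
    (hstep : ∀ k s, I k s → b.eval s ≠ 0 → q.wp W (fun s' => ∃ k', k' < k ∧ I k' s') s)
    (hexit : ∀ k s, I k s → b.eval s = 0 → Q s) :
    RunsWithin W (.seq p (.loop b q)) s (p.cost + (k + 1) * (q.cost + b.cost + 1)) Q :=
  runsWithin_seq ((runsWithin_wp hinit).mono le_rfl fun _ h => runsWithin_loop_wp I hstep hexit h)

/-! ### The content of the first cells of an array, as a set -/

/-- The set of the first `q` values of `f`. -/
def img (f : ℕ → ℕ) (q : ℕ) : Finset ℕ := (Finset.range q).image f

theorem img_zero (f : ℕ → ℕ) : img f 0 = ∅ := rfl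

theorem img_succ (f : ℕ → ℕ) (q : ℕ) : img f (q + 1) = insert (f q) (img f q) := by
  rw [img, Finset.range_add_one, Finset.image_insert]
  rfl

theorem img_update (f : ℕ → ℕ) {q k x : ℕ} (h : q ≤ k) : img (Function.update f k x) q = img f q :=
    by
  refine Finset.image_congr fun i hi => Function.update_of_ne ?_ _ _
  simp only [Finset.coe_range, Set.mem_Iio] at hi
  omega

theorem img_push (f : ℕ → ℕ) (q x : ℕ) :
    img (Function.update f q x) (q + 1) = insert x (img f q) := by
  rw [img_succ, img_update f le_rfl, Function.update_self]

theorem mem_img {f : ℕ → ℕ} {q x : ℕ} : x ∈ img f q ↔ ∃ i < q, f i = x := by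
  simp [img]

theorem img_mono (f : ℕ → ℕ) {k q : ℕ} (h : k ≤ q) : img f k ⊆ img f q := fun x hx => by
  obtain ⟨i, hi, e⟩ := mem_img.1 hx
  exact mem_img.2 ⟨i, by omega, e⟩

/-- The hypothesis on the cardinality says that the first `q` entries are distinct. In the queue it
guarantees that no node is counted twice at its parent. -/
theorem notMem_img {f : ℕ → ℕ} {k q : ℕ} (h : (img f q).card = q) (hk : k < q) :
    f k ∉ img f k := by
  intro h'
  obtain ⟨i, hi, e⟩ := mem_img.1 h'
  have : Set.InjOn f (Finset.range q) := by
    rw [← Finset.card_image_iff]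
    simpa [img] using h
  have := this (by simp; omega) (by simp [hk]) e
  omega

end CICograph

namespace CICograph

open Memory Program

/-! ### The construction phase: collecting the earlier neighbours of a vertex -/

/-- Load the neighbours of the vertex in register 11 which are smaller into array 8. -/
def collect : Program :=
  .seq (block [
    .set 17 (.lit 0),
    .set 15 (.read 0 (.reg 11)),
    .set 16 (.read 0 (.add (.reg 11) (.lit 1)))])
  (.loop (.lt (.reg 15) (.reg 16)) (block [
    .set 18 (.read 1 (.reg 15)),
    .ite (.lt (.reg 18) (.reg 11)) (block [
      .write 8 (.reg 17) (.reg 18),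
      .set 17 (.add (.reg 17) (.lit 1))]) .skip,
    .set 15 (.add (.reg 15) (.lit 1))]))

theorem collect_spec {W n v : ℕ} {s : Memory} (l : List ℕ) (hnd : l.Nodup)
    (hl : ∀ x ∈ l, x < n) (hv : s.reg 11 = v) (hend : s.arr 0 (v + 1) = s.arr 0 v + l.length)
    (harr : ∀ i (h : i < l.length), s.arr 1 (s.arr 0 v + i) = l[i]) (hn : n ≤ W)
    (hW : s.arr 0 (v + 1) ≤ W) :
    RunsWithin W collect s (60 * (l.length + 1)) fun s' =>
      Frame [15, 16, 17, 18] [8] s s' ∧ img (s'.arr 8) (s'.reg 17) = {u ∈ l.toFinset | u < v} ∧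
        ({u ∈ l.toFinset | u < v} : Finset ℕ).card = s'.reg 17 := by
  have hlen : l.length ≤ n := by
    have := List.toFinset_card_of_nodup hnd
    rw [← this, ← Finset.card_range n]
    exact Finset.card_le_card fun x hx => by simpa using hl x (by simpa using hx)
  refine (runsWithin_init_loop (fun k s' => Frame [15, 16, 17, 18] [8] s s' ∧
      s'.reg 16 = s.arr 0 (v + 1) ∧ ∃ i, i + k = l.length ∧ s'.reg 15 = s.arr 0 v + i ∧
        img (s'.arr 8) (s'.reg 17) = {u ∈ (l.take i).toFinset | u < v} ∧
        ({u ∈ (l.take i).toFinset | u < v} : Finset ℕ).card = s'.reg 17) l.length ?_ ?_ ?_).mono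
      ?_ fun _ h => h
  · simp [block, wp, Expr.eval, hv, hend]
    refine ⟨by omega, by omega, ?_, by simp [img_zero]⟩
    apply_rules [Frame.setReg, Frame.refl] <;> simp
  · rintro k s' ⟨hf, h16, i, hik, h15, himg, hcard⟩ hb
    have hb : s'.reg 15 < s'.reg 16 := Expr.lt_ne_zero.1 hb
    have hi : i < l.length := by omega
    have hw : s'.arr 1 (s'.reg 15) = l[i] := by
      rw [h15, hf.2 1 (by simp), harr i hi]
    have hwn := hl l[i] (List.getElem_mem hi)
    have h11 : s'.reg 11 = v := (hf.1 11 (by simp)).trans hv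
    have htake : (l.take (i + 1)).toFinset = insert l[i] (l.take i).toFinset := by
      rw [List.take_succ_eq_append_getElem hi, List.toFinset_append, Finset.union_comm]
      simp
    have hnot : l[i] ∉ (l.take i).toFinset := by
      rw [List.mem_toFinset]
      intro hmem
      have := List.take_succ_eq_append_getElem hi ▸ hnd.sublist (List.take_sublist (i + 1) l)
      exact (List.nodup_append.1 this).2.2 _ hmem _ (by simp) rfl
    have hq : s'.reg 17 ≤ i := by
      rw [← hcard]
      refine (Finset.card_filter_le _ _).trans ((List.toFinset_card_le _).trans ?_)
      simp
    simp [block, wp, Expr.eval, hw, h11]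
    refine ⟨by omega, fun hlt => ⟨by omega, by omega, by omega, k - 1, by omega, ?_, h16, i + 1,
      by omega, by omega, ?_, ?_⟩, fun hge => ⟨by omega, k - 1, by omega, ?_, h16, i + 1,
      by omega, by omega, ?_, ?_⟩⟩
    · apply_rules [Frame.setReg, Frame.setArr] <;> simp
    · rw [htake, Finset.filter_insert, if_pos hlt, img_push, himg]
    · rw [htake, Finset.filter_insert, if_pos hlt, Finset.card_insert_of_notMem, hcard]
      exact fun h => hnot (Finset.mem_of_mem_filter _ h)
    · apply_rules [Frame.setReg] <;> simp
    · rw [htake, Finset.filter_insert, if_neg hge.not_gt, himg]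
    · rw [htake, Finset.filter_insert, if_neg hge.not_gt, hcard]
  · rintro k s' ⟨hf, h16, i, hik, h15, himg, hcard⟩ hb
    have hb : s'.reg 16 ≤ s'.reg 15 := Expr.lt_eq_zero.1 hb
    obtain rfl : i = l.length := by omega
    rw [List.take_length] at himg hcard
    exact ⟨hf, himg, hcard⟩
  · simp [block, Program.cost, Expr.cost]
    omega

end CICograph

namespace CICograph

open Memory Program

/-! ### The construction phase: marking the full nodes -/

/-- The tree stored in a memory. -/
def treeOf (s : Memory) : PT := ⟨s.reg 2, s.reg 1, s.arr 2, s.arr 3, s.arr 6, s.arr 7⟩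

/-- Starting with the leaves in the queue (array 8), append every node all of whose children are in
the queue. Array 9 lists the nodes with a child in the queue; for these, arrays 10 and 11 contain
the number of the children in the queue and their sum, with an offset in register 12. -/
def mark : Program :=
  .seq (block [.set 22 (.reg 17), .set 19 (.lit 0), .set 20 (.lit 0)])
    (.loop (.lt (.reg 19) (.reg 17)) (block [
      .set 18 (.read 8 (.reg 19)),
      .set 19 (.add (.reg 19) (.lit 1)),
      .ite (.eq (.reg 18) (.reg 2)) .skip (block [
        .set 21 (.read 2 (.reg 18)),
        .write 10 (.add (.reg 12) (.reg 21)) (.add (.read 10 (.add (.reg 12) (.reg 21))) (.lit 1)),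
        .write 11 (.add (.reg 12) (.reg 21))
          (.add (.read 11 (.add (.reg 12) (.reg 21))) (.reg 18)),
        .ite (.eq (.read 10 (.add (.reg 12) (.reg 21))) (.lit 1)) (block [
          .write 9 (.reg 20) (.reg 21),
          .set 20 (.add (.reg 20) (.lit 1))]) .skip,
        .ite (.eq (.read 10 (.add (.reg 12) (.reg 21))) (.read 6 (.reg 21))) (block [
          .write 8 (.reg 17) (.reg 21),
          .set 17 (.add (.reg 17) (.lit 1))]) .skip])]))

/-- The invariant of the marking loop; `s₀` is the memory at the beginning. -/
structure MarkInv (s₀ : Memory) (X V S : Finset ℕ) (m : ℕ) (s : Memory) : Prop where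
  frame : Frame [17, 18, 19, 20, 21, 22] [8, 9, 10, 11] s₀ s
  start : s.reg 22 = S.card
  le : s.reg 19 ≤ s.reg 17
  card_queue : (img (s.arr 8) (s.reg 17)).card = s.reg 17
  queue_sub : img (s.arr 8) (s.reg 17) ⊆ X
  leaf : ∀ u ∈ V, (u ∈ img (s.arr 8) (s.reg 17) ↔ u ∈ S)
  node : ∀ x ∈ X, x ∉ V →
    (x ∈ img (s.arr 8) (s.reg 17) ↔ (treeOf s₀).ch X x ⊆ img (s.arr 8) (s.reg 19))
  count : ∀ x ∈ X, s.arr 10 (s₀.reg 12 + x) =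
    ((treeOf s₀).ch X x ∩ img (s.arr 8) (s.reg 19)).card
  sum : ∀ x ∈ X, s.arr 11 (s₀.reg 12 + x) =
    ∑ c ∈ (treeOf s₀).ch X x ∩ img (s.arr 8) (s.reg 19), c
  touched : img (s.arr 9) (s.reg 20) =
    {x ∈ X | ((treeOf s₀).ch X x ∩ img (s.arr 8) (s.reg 19)).Nonempty}
  card_touched : (img (s.arr 9) (s.reg 20)).card = s.reg 20
  potential : s.reg 17 + s.reg 20 ≤ S.card + s.reg 19
  zero : ∀ j, s₀.reg 12 + m ≤ j → s.arr 10 j = 0 ∧ s.arr 11 j = 0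

namespace MarkInv

variable {s₀ s s₁ : Memory} {X V S : Finset ℕ} {m w : ℕ}

/-- A queued node is a leaf of `S` or an internal node. In the second case all its children, of
which there are some, have been processed, so it is touched. -/
theorem queue_le (h : MarkInv s₀ X V S m s) (hr : (treeOf s₀).IsReduced X V ∅) :
    s.reg 17 ≤ S.card + s.reg 20 := by
  rw [← h.card_queue, ← h.card_touched]
  refine (Finset.card_le_card fun q hq => ?_).trans (Finset.card_union_le _ _)
  rw [Finset.mem_union]
  by_cases hqV : q ∈ V
  · exact .inl ((h.leaf q hqV).1 hq)
  · have hqX := h.queue_sub hq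
    refine .inr ?_
    rw [h.touched, Finset.mem_filter]
    refine ⟨hqX, ?_⟩
    rw [Finset.inter_eq_left.2 ((h.node q hqX hqV).1 hq)]
    exact PT.IsTree.ch_nonempty hr hqX hqV

/-- This makes the marking linear in `S.card`, whatever the size of the tree. Write `Q`, `t` and `i`
for the numbers of queued, touched and processed nodes. Adding `Q ≤ S.card + t` and the potential `Q
+ t ≤ S.card + i` gives `2 * Q ≤ 2 * S.card + i`, and `i ≤ Q`. -/
theorem queue_le_two_mul (h : MarkInv s₀ X V S m s) (hr : (treeOf s₀).IsReduced X V ∅) :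
    s.reg 17 ≤ 2 * S.card := by
  have := h.queue_le hr
  have := h.potential
  have := h.le
  omega

/-- Processing the root changes nothing. -/
theorem step_root (h : MarkInv s₀ X V S m s) (hlt : s.reg 19 < s.reg 17)
    (hw : s.arr 8 (s.reg 19) = (treeOf s₀).root) (hf : Frame [18, 19] [] s s₁)
    (h19 : s₁.reg 19 = s.reg 19 + 1) : MarkInv s₀ X V S m s₁ := by
  have hch : ∀ x, (treeOf s₀).ch X x ∩ img (s.arr 8) (s.reg 19 + 1) =
      (treeOf s₀).ch X x ∩ img (s.arr 8) (s.reg 19) := by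
    intro x
    rw [img_succ, hw, Finset.inter_insert_of_notMem]
    exact fun h' => (PT.mem_ch.1 h').2.1 rfl
  have hsub : ∀ x, (treeOf s₀).ch X x ⊆ img (s.arr 8) (s.reg 19 + 1) ↔
      (treeOf s₀).ch X x ⊆ img (s.arr 8) (s.reg 19) := by
    intro x
    rw [← Finset.inter_eq_left, hch, Finset.inter_eq_left]
  have e8 := hf.2 8 (by simp)
  have e9 := hf.2 9 (by simp)
  have e10 := hf.2 10 (by simp)
  have e11 := hf.2 11 (by simp)
  have r17 := hf.1 17 (by simp)
  have r20 := hf.1 20 (by simp)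
  have r22 := hf.1 22 (by simp)
  constructor
  · exact h.frame.trans (hf.mono (by simp) (by simp))
  · rw [r22, h.start]
  · rw [h19, r17]; exact hlt
  · rw [e8, r17, h.card_queue]
  · rw [e8, r17]; exact h.queue_sub
  · rw [e8, r17]; exact h.leaf
  · simp only [e8, r17, h19, hsub]; exact h.node
  · simp only [e8, e10, h19, hch]; exact h.count
  · simp only [e8, e11, h19, hch]; exact h.sum
  · simp only [e8, e9, r20, h19, hch]; exact h.touched
  · rw [e9, r20, h.card_touched]
  · have := h.potential
    omega
  · rw [e10, e11]; exact h.zero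

/-- Processing another node `w` with parent `p`. -/
theorem step (h : MarkInv s₀ X V S m s) (ht : (treeOf s₀).IsTree X V)
    (hr : (treeOf s₀).IsReduced X V ∅) {p : ℕ} (hX : ∀ x ∈ X, x < m)
    (hlt : s.reg 19 < s.reg 17)
    (hw : s.arr 8 (s.reg 19) = w) (hwp : w ∈ (treeOf s₀).ch X p) (hwn : w ∉ img (s.arr 8)
      (s.reg 19))
    (hf : Frame [17, 18, 19, 20, 21] [8, 9, 10, 11] s s₁) (h19 : s₁.reg 19 = s.reg 19 + 1)
    (h10 : s₁.arr 10 = Function.update (s.arr 10) (s₀.reg 12 + p) (s.arr 10 (s₀.reg 12 + p) + 1))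
    (h11 : s₁.arr 11 = Function.update (s.arr 11) (s₀.reg 12 + p) (s.arr 11 (s₀.reg 12 + p) + w))
    (h9 : s.arr 10 (s₀.reg 12 + p) = 0 ∧ s₁.reg 20 = s.reg 20 + 1 ∧
        s₁.arr 9 = Function.update (s.arr 9) (s.reg 20) p ∨
      s.arr 10 (s₀.reg 12 + p) ≠ 0 ∧ s₁.reg 20 = s.reg 20 ∧ s₁.arr 9 = s.arr 9)
    (h8 : s.arr 10 (s₀.reg 12 + p) + 1 = (treeOf s₀).nc p ∧ s₁.reg 17 = s.reg 17 + 1 ∧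
        s₁.arr 8 = Function.update (s.arr 8) (s.reg 17) p ∨
      s.arr 10 (s₀.reg 12 + p) + 1 ≠ (treeOf s₀).nc p ∧ s₁.reg 17 = s.reg 17 ∧
        s₁.arr 8 = s.arr 8) : MarkInv s₀ X V S m s₁ := by
  obtain ⟨hpX, hpV⟩ := ht.mem_of_ch hwp
  have hK' : img (s₁.arr 8) (s₁.reg 19) = insert w (img (s.arr 8) (s.reg 19)) := by
    rw [h19]
    rcases h8 with ⟨_, _, e⟩ | ⟨_, _, e⟩ <;> rw [e]
    · rw [img_update _ (by omega), img_succ, hw]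
    · rw [img_succ, hw]
  have hchp : (treeOf s₀).ch X p ∩ insert w (img (s.arr 8) (s.reg 19)) =
    insert w ((treeOf s₀).ch X p ∩ (img (s.arr 8) (s.reg 19))) := by
    rw [Finset.inter_insert_of_mem hwp]
  have hwn' : w ∉ (treeOf s₀).ch X p ∩ (img (s.arr 8) (s.reg 19)) :=
    fun e => hwn (Finset.mem_inter.1 e).2
  have hch : ∀ x, x ≠ p → (treeOf s₀).ch X x ∩ insert w (img (s.arr 8) (s.reg 19)) =
    (treeOf s₀).ch X x ∩ (img (s.arr 8) (s.reg 19)) := by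
    intro x hx
    rw [Finset.inter_insert_of_notMem]
    exact fun h' => hx ((PT.mem_ch.1 h').2.2.symm.trans (PT.mem_ch.1 hwp).2.2)
  have hcp := h.count p hpX
  have hfull : s.arr 10 (s₀.reg 12 + p) + 1 =
    (treeOf s₀).nc p ↔ (treeOf s₀).ch X p ⊆ insert w (img (s.arr 8) (s.reg 19)) := by
    rw [hcp, hr.nc_eq p hpX hpV, ← Finset.card_insert_of_notMem hwn', ← hchp,
      ← Finset.inter_eq_left]
    exact ⟨fun e => Finset.eq_of_subset_of_card_le Finset.inter_subset_left e.ge, fun e => by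
      rw [e]⟩
  have hpQ : p ∉ img (s.arr 8) (s.reg 17) := fun e => hwn ((h.node p hpX hpV).1 e hwp)
  have hpT : p ∈ img (s.arr 9) (s.reg 20) ↔ s.arr 10 (s₀.reg 12 + p) ≠ 0 := by
    rw [h.touched, Finset.mem_filter, hcp, ← Finset.card_pos, Nat.pos_iff_ne_zero]
    exact ⟨fun e => e.2, fun e => ⟨hpX, e⟩⟩
  have hQ : img (s₁.arr 8) (s₁.reg 17) =
      if (treeOf s₀).ch X p ⊆ insert w (img (s.arr 8) (s.reg 19)) then insert p (img (s.arr 8)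
        (s.reg 17))
      else img (s.arr 8) (s.reg 17) := by
    rcases h8 with ⟨e1, e2, e3⟩ | ⟨e1, e2, e3⟩
    · rw [if_pos (hfull.1 e1), e2, e3, img_push]
    · rw [if_neg fun e => e1 (hfull.2 e), e2, e3]
  constructor
  · exact h.frame.trans (hf.mono (by simp) (by simp))
  · rw [hf.1 22 (by simp), h.start]
  · rcases h8 with ⟨_, e, _⟩ | ⟨_, e, _⟩ <;> omega
  · rw [hQ]
    rcases h8 with ⟨e1, e2, e3⟩ | ⟨e1, e2, e3⟩
    · rw [if_pos (hfull.1 e1), e2, Finset.card_insert_of_notMem hpQ, h.card_queue]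
    · rw [if_neg fun e => e1 (hfull.2 e), e2, h.card_queue]
  · rw [hQ]
    split_ifs
    · exact Finset.insert_subset hpX h.queue_sub
    · exact h.queue_sub
  · intro u hu
    rw [hQ, ← h.leaf u hu]
    have : u ≠ p := fun e => hpV (e ▸ hu)
    split_ifs
    · simp [this]
    · rfl
  · intro x hx hxV
    rw [hQ, hK']
    by_cases hxp : x = p
    · subst hxp
      split_ifs with hsub
      · simp [hsub]
      · simp [hsub, hpQ]
    · have h1 : x ∈ (if (treeOf s₀).ch X p ⊆ insert w (img (s.arr 8) (s.reg 19))
      then insert p (img (s.arr 8) (s.reg 17))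
          else img (s.arr 8) (s.reg 17)) ↔ x ∈ img (s.arr 8) (s.reg 17) := by
        split_ifs <;> simp [hxp]
      rw [h1, h.node x hx hxV, ← Finset.inter_eq_left, ← hch x hxp, Finset.inter_eq_left]
  · intro x hx
    rw [hK', h10]
    by_cases hxp : x = p
    · rw [hxp, Function.update_self, hchp, Finset.card_insert_of_notMem hwn', hcp]
    · rw [Function.update_of_ne (by omega), hch x hxp, h.count x hx]
  · intro x hx
    rw [hK', h11]
    by_cases hxp : x = p
    · rw [hxp, Function.update_self, hchp, Finset.sum_insert hwn', h.sum p hpX, add_comm]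
    · rw [Function.update_of_ne (by omega), hch x hxp, h.sum x hx]
  · have : {x ∈ X | ((treeOf s₀).ch X x ∩ insert w (img (s.arr 8) (s.reg 19))).Nonempty} =
        insert p (img (s.arr 9) (s.reg 20)) := by
      ext x
      rw [Finset.mem_filter, Finset.mem_insert, h.touched, Finset.mem_filter]
      by_cases hxp : x = p
      · subst hxp
        simp [hpX, hchp]
      · simp [hch x hxp, hxp]
    rw [hK', this]
    rcases h9 with ⟨e1, e2, e3⟩ | ⟨e1, e2, e3⟩
    · rw [e2, e3, img_push]
    · rw [e2, e3, Finset.insert_eq_of_mem (hpT.2 e1)]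
  · rcases h9 with ⟨e1, e2, e3⟩ | ⟨e1, e2, e3⟩
    · rw [e2, e3, img_push, Finset.card_insert_of_notMem fun e => hpT.1 e e1, h.card_touched]
    · rw [e2, e3, h.card_touched]
  -- One processed child raises the left side by at most one: `p` is touched at its first processed
  -- child and queued at its last, and these differ because `p` has at least two children.
  · have := h.potential
    have := hr.two_le_nc hpX hpV
    rcases h9 with ⟨e1, e2, e3⟩ | ⟨e1, e2, e3⟩ <;> rcases h8 with ⟨e4, e5, e6⟩ | ⟨e4, e5, e6⟩ <;>
      omega
  · intro j hj
    have := hX p hpX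
    rw [h10, h11, Function.update_of_ne (by omega), Function.update_of_ne (by omega)]
    exact h.zero j hj

end MarkInv

theorem card_le_of_lt {X : Finset ℕ} {m : ℕ} (h : ∀ x ∈ X, x < m) : X.card ≤ m := by
  rw [← Finset.card_range m]
  exact Finset.card_le_card fun x hx => by simpa using h x hx

theorem sum_le_of_lt {X : Finset ℕ} {m : ℕ} (h : ∀ x ∈ X, x < m) : ∑ x ∈ X, x ≤ m * m := by
  refine (Finset.sum_le_card_nsmul X _ m fun x hx => (h x hx).le).trans ?_
  rw [smul_eq_mul]
  exact Nat.mul_le_mul_right _ (card_le_of_lt h)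

theorem mark_spec {W m : ℕ} {s : Memory} {X V S : Finset ℕ} (ht : (treeOf s).IsTree X V)
    (hr : (treeOf s).IsReduced X V ∅) (hX : ∀ x ∈ X, x < m) (hW : m * m + m ≤ W) (hSV : S ⊆ V)
    (hS : img (s.arr 8) (s.reg 17) = S) (hcard : S.card = s.reg 17)
    (h0 : ∀ j, s.reg 12 ≤ j → s.arr 10 j = 0 ∧ s.arr 11 j = 0) :
    RunsWithin W mark s (200 * (S.card + 1)) fun s' =>
      MarkInv s X V S m s' ∧ s'.reg 19 = s'.reg 17 := by
  have hbound : ∀ Y : Finset ℕ, Y ⊆ X → Y.card ≤ m ∧ ∑ c ∈ Y, c ≤ m * m := fun Y hY =>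
    ⟨card_le_of_lt fun x hx => hX x (hY hx), sum_le_of_lt fun x hx => hX x (hY hx)⟩
  have hchX : ∀ x, (treeOf s).ch X x ⊆ X := fun x => Finset.filter_subset _ _
  refine (runsWithin_init_loop (fun k s' => MarkInv s X V S m s' ∧ k + s'.reg 19 = 2 * S.card)
    (2 * S.card) ?_ ?_ ?_).mono ?_ fun _ h => h
  · have hSX := hSV.trans ht.sub
    have := (hbound S hSX).1
    simp [block, wp, Expr.eval]
    refine ⟨by omega, ?_⟩
    have hS' : img (s.arr 8) S.card = S := by rw [hcard, hS]
    constructor <;> simp [img_zero, ← hcard, hS']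
    · apply_rules [Frame.setReg, Frame.refl] <;> simp
    · exact hSX
    · intro x hx hxV
      obtain ⟨c, hc⟩ := PT.IsTree.ch_nonempty hr hx hxV
      refine ⟨fun e => absurd (hSV e) hxV, fun e => ?_⟩
      simp [e] at hc
    · exact fun x hx => (h0 _ (by omega)).1
    · exact fun x hx => (h0 _ (by omega)).2
    · exact fun j hj => h0 j (by omega)
  · rintro k s' ⟨hI, hk⟩ hb
    have hlt : s'.reg 19 < s'.reg 17 := Expr.lt_ne_zero.1 hb
    have hq := hI.queue_le_two_mul hr
    have hwQ : s'.arr 8 (s'.reg 19) ∈ img (s'.arr 8) (s'.reg 17) := mem_img.2 ⟨_, hlt, rfl⟩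
    have hwn : s'.arr 8 (s'.reg 19) ∉ img (s'.arr 8) (s'.reg 19) := notMem_img hI.card_queue hlt
    obtain ⟨w, hw⟩ : ∃ w, s'.arr 8 (s'.reg 19) = w := ⟨_, rfl⟩
    rw [hw] at hwQ hwn
    have hwX := hI.queue_sub hwQ
    have hwm := hX w hwX
    have hqm := (hbound _ hI.queue_sub).1
    rw [hI.card_queue] at hqm
    have htm : s'.reg 20 ≤ m := by
      rw [← hI.card_touched, hI.touched]
      exact (hbound _ (Finset.filter_subset _ _)).1
    have r2 : s'.reg 2 = (treeOf s).root := hI.frame.1 2 (by simp)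
    have r12 : s'.reg 12 = s.reg 12 := hI.frame.1 12 (by simp)
    have a2 : s'.arr 2 = (treeOf s).par := hI.frame.2 2 (by simp)
    have a6 : s'.arr 6 = (treeOf s).nc := hI.frame.2 6 (by simp)
    simp [block, wp, Expr.eval, hw, r2, r12, a2, a6]
    refine ⟨by omega, by omega, fun hwr => ⟨k - 1, by omega, ?_, by omega⟩, fun hwr => ?_⟩
    · refine hI.step_root hlt (hw.trans hwr) ?_ (by simp)
      apply_rules [Frame.setReg, Frame.refl] <;> simp
    · obtain ⟨hpX, hpV⟩ := ht.par_mem w hwX hwr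
      have hwp : w ∈ (treeOf s).ch X ((treeOf s).par w) := PT.mem_ch.2 ⟨hwX, hwr, rfl⟩
      set p := (treeOf s).par w
      have hpm := hX p hpX
      have hnot : w ∉ (treeOf s).ch X p ∩ img (s'.arr 8) (s'.reg 19) := fun e =>
        hwn (Finset.mem_inter.1 e).2
      have hins : insert w ((treeOf s).ch X p ∩ img (s'.arr 8) (s'.reg 19)) ⊆ X :=
        Finset.insert_subset hwX (Finset.inter_subset_left.trans (hchX p))
      have hm : 1 ≤ m * m := Nat.mul_pos (by omega) (by omega)
      have hb := hbound _ hins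
      rw [Finset.card_insert_of_notMem hnot, Finset.sum_insert hnot, ← hI.count p hpX,
        ← hI.sum p hpX] at hb
      refine ⟨by omega, by omega, by omega,
        fun h1 => ⟨by omega, by omega, fun h2 => ⟨by omega, by omega, k - 1, by omega, ?_, by
          omega⟩,
          fun h2 => ⟨k - 1, by omega, ?_, by omega⟩⟩,
        fun h1 => ⟨fun h2 => ⟨by omega, by omega, k - 1, by omega, ?_, by omega⟩,
          fun h2 => ⟨k - 1, by omega, ?_, by omega⟩⟩⟩
      all_goals
        refine hI.step ht hr hX hlt hw hwp hwn ?_ (by simp) (by simp) (by simp) (by simp [h1])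
          (by simp [h2])
        apply_rules [Frame.setReg, Frame.setArr, Frame.refl] <;> simp
  · rintro k s' ⟨hI, hk⟩ hb
    exact ⟨hI, le_antisymm hI.le (Expr.lt_eq_zero.1 hb)⟩
  · simp [block, Program.cost, Expr.cost]
    omega

end CICograph

namespace CICograph

open Memory Program

/-! ### The construction phase: finding the lowest mixed node -/

/-- Count the mixed nodes, and flag the parents and the grandparents of mixed nodes. -/
def flag : Program :=
  .seq (block [.set 23 (.lit 0), .set 19 (.lit 0)])
    (.loop (.lt (.reg 19) (.reg 20)) (block [
      .set 21 (.read 9 (.reg 19)),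
      .set 19 (.add (.reg 19) (.lit 1)),
      .ite (.lt (.read 10 (.add (.reg 12) (.reg 21))) (.read 6 (.reg 21))) (block [
        .set 23 (.add (.reg 23) (.lit 1)),
        .set 24 (.reg 21),
        .ite (.eq (.reg 21) (.reg 2)) .skip (block [
          .write 12 (.add (.reg 12) (.read 2 (.reg 21))) (.lit 1),
          .write 12 (.add (.reg 12) (.read 2 (.read 2 (.reg 21)))) (.lit 1)])]) .skip]))

/-- Choose a mixed node, without a flag if possible. -/
def pick : Program :=
  .seq (block [.set 19 (.lit 0)])
    (.loop (.lt (.reg 19) (.reg 20)) (block [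
      .set 21 (.read 9 (.reg 19)),
      .set 19 (.add (.reg 19) (.lit 1)),
      .ite (.lt (.read 10 (.add (.reg 12) (.reg 21))) (.read 6 (.reg 21)))
        (.ite (.eq (.read 12 (.add (.reg 12) (.reg 21))) (.lit 0)) (.set 24 (.reg 21)) .skip)
        .skip]))

/-- Check the nodes between the chosen node and the root. -/
def walk : Program :=
  .seq (.seq (block [.set 26 (.reg 24), .set 25 (.lit 1)])
    (.loop (.sub (.sub (.lit 1) (.eq (.reg 26) (.reg 2))) (.reg 13)) (block [
      .set 21 (.read 2 (.reg 26)),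
      .ite (.eq (.read 3 (.reg 21)) (.lit 1))
        (.ite (.eq (.add (.read 10 (.add (.reg 12) (.reg 21))) (.lit 1)) (.read 6 (.reg 21)))
          (.set 25 (.add (.reg 25) (.lit 1))) (.set 13 (.lit 1)))
        (.ite (.eq (.read 10 (.add (.reg 12) (.reg 21))) (.lit 0)) .skip (.set 13 (.lit 1))),
      .set 26 (.reg 21)])))
    (.ite (.eq (.reg 25) (.reg 23)) .skip (.set 13 (.lit 1)))

theorem _root_.CICograph.Expr.sub_sub_eq_ne_zero {e f g : Expr} {s : Memory} :
    (Expr.sub (.sub (.lit 1) (.eq e f)) g).eval s ≠ 0 ↔ e.eval s ≠ f.eval s ∧ g.eval s = 0 := by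
  by_cases h : e.eval s = f.eval s
  · simp [Expr.eval, h]
  · simp [Expr.eval, h]
    omega

/-- The memory after the marking: `F` is the set of the full nodes. -/
structure Marked (s : Memory) (X V F : Finset ℕ) (m : ℕ) : Prop where
  tree : (treeOf s).IsTree X V
  reduced : (treeOf s).IsReduced X V ∅
  lt : ∀ x ∈ X, x < m
  queue : img (s.arr 8) (s.reg 17) = F
  sub : F ⊆ X
  node : ∀ x ∈ X, x ∉ V → (x ∈ F ↔ (treeOf s).ch X x ⊆ F)
  count : ∀ x ∈ X, s.arr 10 (s.reg 12 + x) = ((treeOf s).ch X x ∩ F).card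
  sum : ∀ x ∈ X, s.arr 11 (s.reg 12 + x) = ∑ c ∈ (treeOf s).ch X x ∩ F, c
  touched : img (s.arr 9) (s.reg 20) = {x ∈ X | ((treeOf s).ch X x ∩ F).Nonempty}
  card_touched : (img (s.arr 9) (s.reg 20)).card = s.reg 20

/-- The mixed nodes among the first `k` nodes of the list of touched nodes. -/
def mixedUpTo (s : Memory) (k : ℕ) : Finset ℕ :=
  {x ∈ img (s.arr 9) k | s.arr 10 (s.reg 12 + x) < s.arr 6 x}

/-- The nodes above the mixed node `β` are as they have to be if `β` is the right place for the new
vertex. -/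
def PathOK (T : PT) (X V F : Finset ℕ) (β : ℕ) : Prop :=
  (∀ q, T.IsMixed X V F q → T.A q β) ∧ ∀ z, T.A z β → z ≠ β →
    (T.lab z = 1 → (T.ch X z ∩ F).card + 1 = (T.ch X z).card) ∧ (T.lab z = 0 → T.ch X z ∩ F = ∅)

theorem mixedUpTo_succ (s : Memory) (k : ℕ) : mixedUpTo s (k + 1) =
    if s.arr 10 (s.reg 12 + s.arr 9 k) < s.arr 6 (s.arr 9 k) then insert (s.arr 9 k) (mixedUpTo s k)
    else mixedUpTo s k := by
  rw [mixedUpTo, img_succ, Finset.filter_insert]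
  rfl

namespace Marked

variable {s s' : Memory} {X V F : Finset ℕ} {m W : ℕ}

theorem par_mem (h : Marked s X V F m) {x : ℕ} (hx : x ∈ X) : s.arr 2 x ∈ X := by
  by_cases hr : x = s.reg 2
  · have : s.arr 2 (s.reg 2) = s.reg 2 := h.reduced.par_root
    rw [hr, this]
    exact h.tree.root_mem
  · exact (h.tree.par_mem x hx hr).1

theorem touched_sub (h : Marked s X V F m) {k : ℕ} (hk : k ≤ s.reg 20) :
    img (s.arr 9) k ⊆ X := by
  refine (img_mono _ hk).trans ?_
  rw [h.touched]
  exact Finset.filter_subset _ _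

theorem touched_le (h : Marked s X V F m) : s.reg 20 ≤ m := by
  rw [← h.card_touched]
  exact card_le_of_lt fun x hx => h.lt x (h.touched_sub le_rfl hx)

/-- A touched node has a full child, and by `node` it fails to be full exactly if it has fewer full
children than children. So one comparison of stored numbers recognizes a mixed node. -/
theorem mem_mixed (h : Marked s X V F m) {x : ℕ} :
    x ∈ mixedUpTo s (s.reg 20) ↔ (treeOf s).IsMixed X V F x := by
  rw [mixedUpTo, Finset.mem_filter, h.touched, Finset.mem_filter]
  constructor
  · rintro ⟨⟨hx, c, hc⟩, hlt⟩
    rw [Finset.mem_inter] at hc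
    have hxV := (h.tree.mem_of_ch hc.1).2
    refine ⟨hx, hxV, fun hxF => ?_, c, hc.1, hc.2⟩
    have h1 := h.reduced.nc_eq x hx hxV
    rw [h.count x hx, Finset.inter_eq_left.2 ((h.node x hx hxV).1 hxF), ← h1] at hlt
    exact lt_irrefl _ hlt
  · rintro ⟨hx, hxV, hxF, c, hc, hcF⟩
    refine ⟨⟨hx, c, Finset.mem_inter.2 ⟨hc, hcF⟩⟩, ?_⟩
    have h1 : s.arr 6 x = _ := h.reduced.nc_eq x hx hxV
    rw [h.count x hx, h1]
    refine Finset.card_lt_card ⟨Finset.inter_subset_left, fun h2 => hxF ?_⟩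
    exact (h.node x hx hxV).2 fun c hc => (Finset.mem_inter.1 (h2 hc)).2

theorem mixed_sub (h : Marked s X V F m) {x k : ℕ} (hk : k ≤ s.reg 20) (hx : x ∈ mixedUpTo s k) :
    x ∈ X := h.touched_sub hk (Finset.mem_of_mem_filter _ hx)

end Marked

/-- Besides the flags, the last clause is needed later: nothing is written beyond the current
scratch block, so the next insertion starts on zeros. -/
theorem flag_spec {W m : ℕ} {s : Memory} {X V F : Finset ℕ} (h : Marked s X V F m)
    (hW : m * m + m ≤ W) (h0 : ∀ j, s.reg 12 ≤ j → s.arr 12 j = 0) :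
    RunsWithin W flag s (200 * (s.reg 20 + 1)) fun s' =>
      Frame [19, 21, 23, 24] [12] s s' ∧ s'.reg 23 = (mixedUpTo s (s.reg 20)).card ∧
        ((mixedUpTo s (s.reg 20)).Nonempty → s'.reg 24 ∈ mixedUpTo s (s.reg 20)) ∧
        (∀ x, (s'.arr 12 (s.reg 12 + x) ≠ 0 ↔ ∃ p ∈ mixedUpTo s (s.reg 20),
          p ≠ s.reg 2 ∧ (s.arr 2 p = x ∨ s.arr 2 (s.arr 2 p) = x))) ∧
        ∀ j, s.reg 12 + m ≤ j → s'.arr 12 j = 0 := by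
  refine (runsWithin_init_loop (fun k s' => Frame [19, 21, 23, 24] [12] s s' ∧
      k + s'.reg 19 = s.reg 20 ∧ s'.reg 23 = (mixedUpTo s (s'.reg 19)).card ∧
        ((mixedUpTo s (s'.reg 19)).Nonempty → s'.reg 24 ∈ mixedUpTo s (s'.reg 19)) ∧
        (∀ x, (s'.arr 12 (s.reg 12 + x) ≠ 0 ↔ ∃ p ∈ mixedUpTo s (s'.reg 19),
          p ≠ s.reg 2 ∧ (s.arr 2 p = x ∨ s.arr 2 (s.arr 2 p) = x)))) (s.reg 20) ?_ ?_ ?_).mono ?_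
      fun _ h => h
  · simp [block, wp, Expr.eval, mixedUpTo, img_zero]
    refine ⟨?_, fun x => h0 _ (by omega)⟩
    apply_rules [Frame.setReg, Frame.refl] <;> simp
  · rintro k s' ⟨hf, hk, hc, hmem, hfl⟩ hb
    have hlt : s'.reg 19 < s'.reg 20 := Expr.lt_ne_zero.1 hb
    have r20 := hf.1 20 (by simp)
    have r12 := hf.1 12 (by simp)
    have r2 := hf.1 2 (by simp)
    have a9 := hf.2 9 (by simp)
    have a10 := hf.2 10 (by simp)
    have a6 := hf.2 6 (by simp)
    have a2 := hf.2 2 (by simp)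
    have htm := h.touched_le
    rw [r20] at hlt
    obtain ⟨p, hp⟩ : ∃ p, s.arr 9 (s'.reg 19) = p := ⟨_, rfl⟩
    have hpX : p ∈ X := h.touched_sub le_rfl (mem_img.2 ⟨_, hlt, hp⟩)
    have hpm := h.lt p hpX
    have hpn : p ∉ mixedUpTo s (s'.reg 19) := fun e =>
      notMem_img h.card_touched hlt (hp ▸ Finset.mem_of_mem_filter _ e)
    have hcm : (mixedUpTo s (s'.reg 19)).card ≤ s'.reg 19 := by
      refine (Finset.card_filter_le _ _).trans ((Finset.card_image_le).trans ?_)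
      simp
    have hm : 1 ≤ m * m := Nat.mul_pos (by omega) (by omega)
    have hsucc := mixedUpTo_succ s (s'.reg 19)
    rw [hp] at hsucc
    simp [block, wp, Expr.eval, r2, r12, a2, a6, a9, a10, hp]
    refine ⟨by omega, by omega, fun hlt' => ?_, fun hge => ?_⟩
    · rw [if_pos hlt'] at hsucc
      refine ⟨by omega, by omega, fun hpr => ?_, fun hpr => ?_⟩
      · refine ⟨k - 1, by omega, ?_, by omega, ?_, ?_, ?_⟩
        · apply_rules [Frame.setReg, Frame.refl] <;> simp
        · rw [hsucc, Finset.card_insert_of_notMem hpn, hc]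
        · rw [hsucc]; simp
        · intro x
          rw [hsucc, ← ne_eq, hfl x]
          simp [hpr]
      · refine ⟨by omega, k - 1, by omega, ?_, by omega, ?_, ?_, ?_⟩
        · apply_rules [Frame.setReg, Frame.setArr, Frame.refl] <;> simp
        · rw [hsucc, Finset.card_insert_of_notMem hpn, hc]
        · rw [hsucc]; simp
        · intro x
          have := hfl x
          rw [hsucc, Finset.exists_mem_insert, ← this]
          simp only [Function.update_apply, Nat.add_left_cancel_iff]
          split_ifs with h1 h2
          · simp [hpr, h1]
          · simp [hpr, h2]
          · simp [Ne.symm h1, Ne.symm h2]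
    · rw [if_neg hge.not_gt] at hsucc
      rw [hsucc]
      refine ⟨k - 1, by omega, ?_, by omega, hc, hmem, hfl⟩
      apply_rules [Frame.setReg, Frame.refl] <;> simp
  · rintro k s' ⟨hf, hk, hc, hmem, hfl⟩ hb
    have hge : s'.reg 20 ≤ s'.reg 19 := Expr.lt_eq_zero.1 hb
    have r20 := hf.1 20 (by simp)
    have e : s'.reg 19 = s.reg 20 := by omega
    rw [e] at hc hmem hfl
    -- Flagged nodes belong to the tree and are therefore smaller than `m`.
    refine ⟨hf, hc, hmem, hfl, fun j hj => ?_⟩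
    obtain ⟨x, rfl⟩ := Nat.exists_eq_add_of_le (show s.reg 12 ≤ j by omega)
    by_contra hne
    obtain ⟨p, hp, -, hx⟩ := (hfl x).1 hne
    have hpX := h.mixed_sub le_rfl hp
    have hxX : x ∈ X := by
      rcases hx with rfl | rfl
      · exact h.par_mem hpX
      · exact h.par_mem (h.par_mem hpX)
    have := h.lt x hxX
    omega
  · simp [block, Program.cost, Expr.cost]
    omega

/-- Register 24 holds some mixed node from the start, so a mixed node is returned even if all of
them are flagged. That can only happen if there is an induced path; the climb will then fail. -/
theorem pick_spec {W m : ℕ} {s : Memory} {X V F : Finset ℕ} (h : Marked s X V F m)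
    (hW : m * m + m ≤ W) (h24 : s.reg 24 ∈ mixedUpTo s (s.reg 20)) :
    RunsWithin W pick s (200 * (s.reg 20 + 1)) fun s' =>
      Frame [19, 21, 24] [] s s' ∧ s'.reg 24 ∈ mixedUpTo s (s.reg 20) ∧
        ((∃ p ∈ mixedUpTo s (s.reg 20), s.arr 12 (s.reg 12 + p) = 0) →
          s.arr 12 (s.reg 12 + s'.reg 24) = 0) := by
  refine (runsWithin_init_loop (fun k s' => Frame [19, 21, 24] [] s s' ∧
      k + s'.reg 19 = s.reg 20 ∧ s'.reg 24 ∈ mixedUpTo s (s.reg 20) ∧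
        ((∃ p ∈ mixedUpTo s (s'.reg 19), s.arr 12 (s.reg 12 + p) = 0) →
          s.arr 12 (s.reg 12 + s'.reg 24) = 0)) (s.reg 20) ?_ ?_ ?_).mono ?_ fun _ h => h
  · simp [block, wp, Expr.eval]
    refine ⟨?_, h24, by simp [mixedUpTo, img_zero]⟩
    apply_rules [Frame.setReg, Frame.refl] <;> simp
  · rintro k s' ⟨hf, hk, hmem, hfl⟩ hb
    have hlt : s'.reg 19 < s'.reg 20 := Expr.lt_ne_zero.1 hb
    have r20 := hf.1 20 (by simp)
    have r12 := hf.1 12 (by simp)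
    have a9 := hf.2 9 (by simp)
    have a10 := hf.2 10 (by simp)
    have a12 := hf.2 12 (by simp)
    have a6 := hf.2 6 (by simp)
    have htm := h.touched_le
    rw [r20] at hlt
    obtain ⟨p, hp⟩ : ∃ p, s.arr 9 (s'.reg 19) = p := ⟨_, rfl⟩
    have hpt : p ∈ img (s.arr 9) (s.reg 20) := mem_img.2 ⟨_, hlt, hp⟩
    have hpm := h.lt p (h.touched_sub le_rfl hpt)
    have hsucc := mixedUpTo_succ s (s'.reg 19)
    rw [hp] at hsucc
    simp [block, wp, Expr.eval, r12, a6, a9, a10, a12, hp]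
    refine ⟨by omega, by omega, fun hlt' => ⟨fun h1 => ⟨by omega, k - 1, by omega, ?_, by omega,
      Finset.mem_filter.2 ⟨hpt, hlt'⟩, fun _ _ _ => h1⟩, fun h1 => ⟨k - 1, by omega, ?_, by omega,
      hmem, ?_⟩⟩, fun hge => ⟨k - 1, by omega, ?_, by omega, hmem, ?_⟩⟩
    · apply_rules [Frame.setReg, Frame.refl] <;> simp
    · apply_rules [Frame.setReg, Frame.refl] <;> simp
    · intro x hx hx0
      rw [hsucc, if_pos hlt', Finset.mem_insert] at hx
      refine hfl ⟨x, hx.resolve_left fun e => h1 (e ▸ hx0), hx0⟩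
    · apply_rules [Frame.setReg, Frame.refl] <;> simp
    · intro x hx hx0
      rw [hsucc, if_neg hge.not_gt] at hx
      exact hfl ⟨x, hx, hx0⟩
  · rintro k s' ⟨hf, hk, hmem, hfl⟩ hb
    have hge : s'.reg 20 ≤ s'.reg 19 := Expr.lt_eq_zero.1 hb
    have r20 := hf.1 20 (by simp)
    have e : s'.reg 19 = s.reg 20 := by omega
    rw [e] at hfl
    exact ⟨hf, hmem, hfl⟩
  · simp [block, Program.cost, Expr.cost]
    omega

-- The local conditions are verified while climbing. The global one, that no mixed node is off the
-- path, is verified by counting: the mixed nodes met on the path are compared with all mixed nodes.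
open Classical in
theorem walk_spec {W m : ℕ} {s : Memory} {X V F : Finset ℕ} (h : Marked s X V F m)
    (hW : m * m + m ≤ W) (h13 : s.reg 13 = 0) (h23 : s.reg 23 = (mixedUpTo s (s.reg 20)).card)
    (h24 : s.reg 24 ∈ mixedUpTo s (s.reg 20)) :
    RunsWithin W walk s (200 * (s.reg 20 + 1)) fun s' =>
      Frame [13, 21, 25, 26] [] s s' ∧
        (s'.reg 13 = 0 ∧ PathOK (treeOf s) X V F (s.reg 24) ∨
          s'.reg 13 = 1 ∧ ¬ PathOK (treeOf s) X V F (s.reg 24)) := by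
  obtain ⟨β, hβ⟩ : ∃ β, s.reg 24 = β := ⟨_, rfl⟩
  rw [hβ] at h24 ⊢
  have hβm := h.mem_mixed.1 h24
  have ht := h.tree
  obtain ⟨D, hD⟩ : ∃ D, mixedUpTo s (s.reg 20) = D := ⟨_, rfl⟩
  have hmemD : ∀ {q}, q ∈ D ↔ (treeOf s).IsMixed X V F q := fun {q} => hD ▸ h.mem_mixed
  rw [hD] at h23 h24
  have hDt : D.card ≤ s.reg 20 := by
    rw [← hD]
    exact (Finset.card_filter_le (img (s.arr 9) (s.reg 20)) fun x =>
      s.arr 10 (s.reg 12 + x) < s.arr 6 x).trans h.card_touched.le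
  have htm := h.touched_le
  -- The measure `k` bounds the remaining climb. A step to a 1-node that passes the test removes
  -- this mixed node from the set of those strictly above, worth 2, and raises the label by 1. A
  -- step to a 0-node lowers the label and does not enlarge the set. After a failed test, register
  -- 13 ends the loop.
  refine (runsWithin_seq (B₂ := 20) ((runsWithin_init_loop (fun k s' => Frame [13, 21, 25,
    26] [] s s' ∧
      (s'.reg 13 = 1 ∧ ¬ PathOK (treeOf s) X V F β ∨
        s'.reg 13 = 0 ∧ ∃ w, s'.reg 26 = w ∧ w ∈ X ∧ w ∉ V ∧ (treeOf s).A w β ∧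
          (∀ z, (treeOf s).A z β → (treeOf s).A w z → z ≠ β →
            ((treeOf s).lab z = 1 →
              ((treeOf s).ch X z ∩ F).card + 1 = ((treeOf s).ch X z).card) ∧
            ((treeOf s).lab z = 0 → (treeOf s).ch X z ∩ F = ∅)) ∧
          s'.reg 25 = ({q ∈ D | (treeOf s).A q β ∧ (treeOf s).A w q}).card ∧
          k = 2 * ({q ∈ D | (treeOf s).A q w ∧ ¬ q = w}).card + s.arr 3 w + 1))
      (2 * ({q ∈ D | (treeOf s).A q β ∧ ¬ q = β}).card + s.arr 3 β + 1) (Q := fun s' =>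
        Frame [13, 21, 25, 26] [] s s' ∧
        (s'.reg 13 = 1 ∧ ¬ PathOK (treeOf s) X V F β ∨ s'.reg 13 = 0 ∧
          (s'.reg 25 = s'.reg 23 → PathOK (treeOf s) X V F β) ∧
          (s'.reg 25 ≠ s'.reg 23 → ¬ PathOK (treeOf s) X V F β)))
        ?_ ?_ ?_).mono le_rfl ?_)).mono ?_ fun _ h => h
  · have hβX := h.lt β hβm.1
    have hm : 1 ≤ m * m := Nat.mul_pos (by omega) (by omega)
    simp [block, wp, Expr.eval, hβ, h13]
    refine ⟨by omega, by omega, ?_, hβm.1, hβm.2.1, .refl _, fun z h1 h2 h3 => ?_, ?_⟩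
    · apply_rules [Frame.setReg, Frame.refl] <;> simp
    · exact absurd (ht.antisymm hβm.1 h1 h2) h3
    · rw [eq_comm, Finset.card_eq_one]
      refine ⟨β, ?_⟩
      ext q
      simp only [Finset.mem_filter, Finset.mem_singleton]
      exact ⟨fun e => ht.antisymm hβm.1 e.2.1 e.2.2, fun e => by subst e; exact ⟨h24, .refl _,
        .refl _⟩⟩
  · rintro k s' ⟨hf, hcase⟩ hb
    have r12 := hf.1 12 (by simp)
    have r2 := hf.1 2 (by simp)
    have a2 := hf.2 2 (by simp)
    have a3 := hf.2 3 (by simp)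
    have a6 := hf.2 6 (by simp)
    have a10 := hf.2 10 (by simp)
    obtain ⟨hb1, hb2⟩ : s'.reg 26 ≠ s'.reg 2 ∧ s'.reg 13 = 0 := Expr.sub_sub_eq_ne_zero.1 hb
    rcases hcase with ⟨h1, -⟩ | ⟨h1, w, h26, hwX, hwV, hwβ, hz, h25, hk⟩
    · omega
    have hwr : w ≠ s.reg 2 := by rwa [← h26, ← r2]
    obtain ⟨hpX, hpV⟩ := ht.par_mem w hwX hwr
    obtain ⟨p, hp⟩ : ∃ p, s.arr 2 w = p := ⟨_, rfl⟩
    have hp' : (treeOf s).par w = p := hp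
    rw [hp'] at hpX hpV
    have hpm := h.lt p hpX
    have hwp : w ∈ (treeOf s).ch X p := PT.mem_ch.2 ⟨hwX, hwr, hp'⟩
    have hpw : (treeOf s).A p w := PT.IsTree.anc_of_ch hwp
    have hpβ := hpw.trans hwβ
    have hpneβ : p ≠ β := by
      rintro rfl
      exact ht.not_anc_of_ch hwp hwβ
    have hnc : s.arr 6 p = ((treeOf s).ch X p).card := h.reduced.nc_eq p hpX hpV
    have h2 : 2 ≤ s.arr 6 p := h.reduced.two_le_nc hpX hpV
    have hlabw : s.arr 3 w ≤ 1 := h.reduced.lab_le w hwX hwV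
    have hlabp : s.arr 3 p ≤ 1 := h.reduced.lab_le p hpX hpV
    have halt : s.arr 3 w ≠ s.arr 3 p := hp ▸ h.reduced.alt w hwX hwV (by simp) hwr
    have hcount := h.count p hpX
    -- On the path to `β`, no node lies strictly between `p` and its child `w`.
    have hzp : ∀ z, (treeOf s).A z β → (treeOf s).A p z → z = p ∨ (treeOf s).A w z := by
      intro z hzβ hpz
      by_cases e : z = p
      · exact .inl e
      · rcases Anc.comparable hzβ hwβ with h3 | h3
        · by_cases e' : z = w
          · exact .inr (e' ▸ .refl _)
          · have := (Anc.of_ne h3 e').2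
            rw [hp'] at this
            exact absurd (ht.antisymm hpX this hpz) e
        · exact .inr h3
    have hsub : ({q ∈ D | (treeOf s).A q p ∧ ¬ q = p}) ⊆ {q ∈ D | (treeOf s).A q w ∧ ¬ q = w} := by
      intro q hq
      rw [Finset.mem_filter] at hq ⊢
      refine ⟨hq.1, hq.2.1.trans hpw, ?_⟩
      rintro rfl
      exact ht.not_anc_of_ch hwp hq.2.1
    have hcardW : s'.reg 25 < W := by
      rw [h25]
      have := Finset.card_filter_le D fun q => (treeOf s).A q β ∧ (treeOf s).A w q
      have : 1 ≤ m * m := Nat.mul_pos (by omega) (by omega)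
      omega
    simp [block, wp, Expr.eval, r12, a2, a3, a6, a10, h26, hp]
    refine ⟨by omega, fun hl => ⟨fun hc => ⟨by omega, by omega, _, ?_, ?_, .inr ⟨h1, hpX, hpV, hpβ,
      ?_, ?_, rfl⟩⟩, fun hc => ⟨by omega, by omega, ⟨0, by omega⟩, ?_, ?_⟩⟩, fun hl => ⟨fun hc =>
      ⟨by omega, _, ?_, ?_, .inr ⟨h1, hpX, hpV, hpβ, ?_, ?_, rfl⟩⟩, fun hc => ⟨by omega, by omega,
        ⟨0,
      by omega⟩, ?_, ?_⟩⟩⟩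
    -- Having at least two children and all but one full, `p` has a full child without being full,
    -- so it is mixed.
    · have hpD : p ∈ D := by
        rw [← hD, mixedUpTo, Finset.mem_filter, h.touched, Finset.mem_filter]
        refine ⟨⟨hpX, Finset.card_pos.1 ?_⟩, ?_⟩ <;> omega
      have : ({q ∈ D | (treeOf s).A q p ∧ ¬ q = p}) ⊂ {q ∈ D | (treeOf s).A q w ∧ ¬ q = w} := by
        refine (Finset.ssubset_iff_of_subset hsub).2 ⟨p, ?_, ?_⟩
        · exact Finset.mem_filter.2 ⟨hpD, hpw, fun e => ht.ne_of_ch hwp e.symm⟩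
        · simp
      have := Finset.card_lt_card this
      omega
    · apply_rules [Frame.setReg, Frame.refl] <;> simp
    · intro z hzβ hpz hne
      rcases hzp z hzβ hpz with rfl | hwz
      · have hl' : (treeOf s).lab z = 1 := hl
        exact ⟨fun _ => by omega, fun e => by omega⟩
      · exact hz z hzβ hwz hne
    · have hpD : p ∈ D := by
        rw [← hD, mixedUpTo, Finset.mem_filter, h.touched, Finset.mem_filter]
        refine ⟨⟨hpX, Finset.card_pos.1 ?_⟩, ?_⟩ <;> omega
      rw [h25, ← Finset.card_insert_of_notMem (a := p)]
      · congr 1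
        ext q
        rw [Finset.mem_insert, Finset.mem_filter, Finset.mem_filter]
        constructor
        · rintro (rfl | hq)
          · exact ⟨hpD, hpβ, .refl _⟩
          · exact ⟨hq.1, hq.2.1, hpw.trans hq.2.2⟩
        · rintro ⟨h3, h4, h5⟩
          exact (hzp q h4 h5).imp id fun h6 => ⟨h3, h4, h6⟩
      · rw [Finset.mem_filter]
        exact fun e => ht.not_anc_of_ch hwp e.2.2
    · apply_rules [Frame.setReg, Frame.refl] <;> simp
    · intro hok
      have := (hok.2 p hpβ hpneβ).1 hl
      omega
    · have := Finset.card_le_card hsub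
      omega
    · apply_rules [Frame.setReg, Frame.refl] <;> simp
    · intro z hzβ hpz hne
      rcases hzp z hzβ hpz with rfl | hwz
      · refine ⟨fun e => absurd e hl, fun _ => ?_⟩
        rw [← Finset.card_eq_zero]
        omega
      · exact hz z hzβ hwz hne
    · rw [h25]
      congr 1
      ext q
      rw [Finset.mem_filter, Finset.mem_filter]
      refine and_congr_right fun hq => and_congr_right fun hqβ => ⟨hpw.trans, fun h5 => ?_⟩
      -- A 0-node that passes the test has no full child, so it is not mixed and register 25 rightly
      -- stays the same.
      refine (hzp q hqβ h5).resolve_left ?_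
      rintro rfl
      rw [← hD, mixedUpTo, Finset.mem_filter, h.touched, Finset.mem_filter] at hq
      have := hq.1.2.card_pos
      omega
    · apply_rules [Frame.setReg, Frame.refl] <;> simp
    · intro hok
      have h0 : (treeOf s).lab p = 0 := by
        change s.arr 3 p = 0
        omega
      have := (hok.2 p hpβ hpneβ).2 h0
      rw [← Finset.card_eq_zero] at this
      omega
  · rintro k s' ⟨hf, hcase⟩ hb
    refine ⟨hf, ?_⟩
    rcases hcase with h1 | ⟨h1, w, h26, hwX, hwV, hwβ, hz, h25, hk⟩
    · exact .inl h1
    · have r2 : s'.reg 2 = (treeOf s).root := hf.1 2 (by simp)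
      have r23 := hf.1 23 (by simp)
      have hwr : w = (treeOf s).root := by
        by_contra hne
        rw [← h26, ← r2] at hne
        exact absurd hb (Expr.sub_sub_eq_ne_zero.2 ⟨hne, h1⟩)
      subst hwr
      refine .inr ⟨h1, fun e => ⟨fun q hq => ?_, fun z hzβ hne => ?_⟩, fun e hok => e ?_⟩
      · rw [h25, r23, h23] at e
        -- Equal counts force every mixed node to be among those met on the path.
        have := Finset.eq_of_subset_of_card_le (Finset.filter_subset _ _) e.ge
        have hq' := hmemD.2 hq
        rw [← this, Finset.mem_filter] at hq'
        exact hq'.2.1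
      · exact hz z hzβ (ht.reach z (ht.mem_of_anc hβm.1 hzβ)) hne
      · rw [h25, r23, h23, Finset.filter_true_of_mem]
        intro q hq
        have hq' := hmemD.1 hq
        exact ⟨hok.1 q hq', ht.reach q hq'.1⟩
  · rintro s' ⟨hf, hcase⟩
    refine (runsWithin_wp (Q := fun s' => Frame [13, 21, 25, 26] [] s s' ∧
        (s'.reg 13 = 0 ∧ PathOK (treeOf s) X V F β ∨
          s'.reg 13 = 1 ∧ ¬ PathOK (treeOf s) X V F β)) ?_).mono ?_ fun _ h => h
    · have hβX := h.lt β hβm.1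
      have hm : 1 ≤ m * m := Nat.mul_pos (by omega) (by omega)
      refine ⟨fun e => ⟨hf, ?_⟩, fun e => ⟨by simp [Expr.eval]; omega, hf.setReg (by simp), ?_⟩⟩
      · rcases hcase with ⟨h1, h2⟩ | ⟨h1, h2, h3⟩
        · exact .inr ⟨h1, h2⟩
        · exact .inl ⟨h1, h2 (Expr.eq_ne_zero.1 e)⟩
      · rcases hcase with ⟨h1, h2⟩ | ⟨h1, h2, h3⟩
        · simpa [Expr.eval] using h2
        · simpa [Expr.eval] using h3 (Expr.eq_eq_zero.1 e)
    · simp [Program.cost, Expr.cost]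
  · have h1 := Finset.card_filter_le D fun q => (treeOf s).A q β ∧ ¬ q = β
    have h2 : s.arr 3 β ≤ 1 := h.reduced.lab_le β hβm.1 hβm.2.1
    have h3 : 1 ≤ D.card := Finset.card_pos.2 ⟨β, h24⟩
    simp [block, Program.cost, Expr.cost]
    omega

end CICograph

namespace CICograph

open Memory Program

/-! ### The construction phase: attaching the new leaf -/

theorem RunsWithin.of_wp {W B : ℕ} {p : Program} {s : Memory} {Q : Memory → Prop}
    (h : p.wp W Q s) (hB : p.cost ≤ B) : RunsWithin W p s B Q :=
  (runsWithin_wp h).mono hB fun _ h => h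

/-- The nodes of the tree on the leaves `0, …, v - 1`, with internal nodes `n, …, N - 1`. -/
def nodes (n v N : ℕ) : Finset ℕ := Finset.range v ∪ Finset.Ico n N

theorem mem_nodes {n v N x : ℕ} : x ∈ nodes n v N ↔ x < v ∨ n ≤ x ∧ x < N := by
  simp [nodes]

theorem insert_leaf_nodes (n v N : ℕ) : insert v (nodes n v N) = nodes n (v + 1) N := by
  ext x
  rw [Finset.mem_insert, mem_nodes, mem_nodes]
  omega

theorem insert_nodes {n N : ℕ} (v : ℕ) (h : n ≤ N) : insert N (nodes n v N) = nodes n v (N + 1) :=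
    by
  ext x
  rw [Finset.mem_insert, mem_nodes, mem_nodes]
  omega

/-- Attach the leaf in register 11 to the node `U` in register 27 if the label of `U` is the number
`b` in register 28; else put a node labelled `b` above `U`, and attach the leaf there. -/
def attach : Program :=
  .ite (.add (.lt (.reg 27) (.reg 10)) (.sub (.lit 1) (.eq (.read 3 (.reg 27)) (.reg 28))))
    (block [
      .set 29 (.reg 1),
      .set 1 (.add (.reg 1) (.lit 1)),
      .write 3 (.reg 29) (.reg 28),
      .write 6 (.reg 29) (.lit 2),
      .write 7 (.reg 29) (.add (.reg 27) (.reg 11)),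
      .ite (.eq (.reg 27) (.reg 2)) (block [
        .set 2 (.reg 29),
        .write 2 (.reg 29) (.reg 29)]) (block [
        .set 21 (.read 2 (.reg 27)),
        .write 2 (.reg 29) (.reg 21),
        .write 7 (.reg 21) (.sub (.add (.read 7 (.reg 21)) (.reg 29)) (.reg 27))]),
      .write 2 (.reg 27) (.reg 29),
      .write 2 (.reg 11) (.reg 29)])
    (block [
      .write 2 (.reg 11) (.reg 27),
      .write 6 (.reg 27) (.add (.read 6 (.reg 27)) (.lit 1)),
      .write 7 (.reg 27) (.add (.read 7 (.reg 27)) (.reg 11))])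

theorem attach_spec {W m n v N U b : ℕ} {s : Memory} {adj : ℕ → ℕ → Prop}
    (hsymm : ∀ u w, adj u w → adj w u)
    (h : (treeOf s).Attachable (nodes n v N) (Finset.range v) adj v U b)
    (h1 : s.reg 1 = N) (h10 : s.reg 10 = n) (h11 : s.reg 11 = v) (h27 : s.reg 27 = U)
    (h28 : s.reg 28 = b) (hv : v < n) (hN : n ≤ N) (hm : N < m) (hW : m * m + 4 * m ≤ W) :
    RunsWithin W attach s 200 fun s' => Frame [1, 2, 21, 29] [2, 3, 6, 7] s s' ∧
      s'.reg 1 ≤ N + 1 ∧ N ≤ s'.reg 1 ∧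
      (treeOf s').IsCotree (nodes n (v + 1) (s'.reg 1)) (Finset.range (v + 1)) adj := by
  obtain ⟨T, hT⟩ : ∃ T, treeOf s = T := ⟨_, rfl⟩
  rw [hT] at h
  have t1 : s.reg 1 = T.fresh := hT ▸ rfl
  have t2 : s.reg 2 = T.root := hT ▸ rfl
  have a2 : s.arr 2 = T.par := hT ▸ rfl
  have a3 : s.arr 3 = T.lab := hT ▸ rfl
  have a6 : s.arr 6 = T.nc := hT ▸ rfl
  have a7 : s.arr 7 = T.cs := hT ▸ rfl
  have hUX := h.mem
  have hlt : ∀ x ∈ nodes n v N, x < m := fun x hx => by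
    rw [mem_nodes] at hx
    omega
  have hcs : ∀ x ∈ nodes n v N, x ∉ Finset.range v → T.cs x ≤ m * m ∧ T.nc x ≤ m :=
    fun x hx hxV => by
    rw [h.reduced.nc_eq x hx hxV, h.reduced.cs_eq x hx hxV]
    exact ⟨sum_le_of_lt fun c hc => hlt c (Finset.filter_subset _ _ hc),
      card_le_of_lt fun c hc => hlt c (Finset.filter_subset _ _ hc)⟩
  have hUm := hlt U hUX
  have hvX : v ∉ nodes n v N := by
    rw [mem_nodes]
    omega
  have hNX : N ∉ nodes n v N := by
    rw [mem_nodes]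
    omega
  have hb1 := h.le_one
  have hUv : U ≠ v := fun e => hvX (e ▸ hUX)
  have hUN : U ≠ N := fun e => hNX (e ▸ hUX)
  have hUV : U ∈ Finset.range v ↔ U < n := by
    rw [mem_nodes] at hUX
    rw [Finset.mem_range]
    omega
  have hmm : 1 ≤ m * m := Nat.mul_pos (by omega) (by omega)
  have hne : ∀ x ∈ nodes n v N, x ≠ N ∧ x ≠ v := fun x hx => by
    rw [mem_nodes] at hx
    omega
  refine .of_wp ⟨fun hcond => ?_, fun hcond => ?_⟩ ?_
  · have hor : U ∉ Finset.range v → T.lab U ≠ b := by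
      intro hU e
      rw [hUV] at hU
      simp [Expr.eval, h27, h28, h10, a3, e] at hcond
      omega
    by_cases hUr : U = T.root
    · have hsub : ∀ T' : PT, T'.root = N → T'.par = Function.update (Function.update
          (Function.update T.par N N) U N) v N → T'.lab = Function.update T.lab N b →
          T'.nc = Function.update T.nc N 2 → T'.cs = Function.update T.cs N (U + v) →
          T.Subdivide T' (nodes n v N) v U b N := by
        intro T' e1 e2 e3 e4 e5
        constructor
        · exact hNX
        · exact hvX
        · omega
        · rw [if_pos hUr, e1]
        · rw [if_pos hUr, e2, Function.update_of_ne (by omega), Function.update_of_ne (by omega),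
            Function.update_self]
        · rw [e2, Function.update_of_ne hUv, Function.update_self]
        · rw [e2, Function.update_self]
        · intro x hx hxU
          rw [e2, Function.update_of_ne (hne x hx).2, Function.update_of_ne hxU,
            Function.update_of_ne (hne x hx).1]
        · intro x hx
          rw [e3, Function.update_of_ne (hne x hx).1]
        · rw [e3, Function.update_self]
        · rw [e4, Function.update_self]
        · intro x hx
          rw [e4, Function.update_of_ne (hne x hx).1]
        · rw [e5, Function.update_self]
        · exact fun e => absurd hUr e
        · intro x hx _
          rw [e5, Function.update_of_ne (hne x hx).1]
      simp [block, wp, Expr.eval, h1, h11, h27, h28, t2, a2, a7, hUr]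
      refine ⟨by omega, by omega, by omega, by omega, by omega, by omega, ?_, ?_⟩
      · apply_rules [Frame.setReg, Frame.setArr, Frame.refl] <;> simp
      · rw [← insert_leaf_nodes, ← insert_nodes v hN, Finset.range_add_one]
        refine h.subdivide hsymm hor (hsub _ ?_ ?_ ?_ ?_ ?_) <;> simp [treeOf, a2, a3, a6, a7, hUr]
    · have hpr := h.tree.par_mem U hUX hUr
      obtain ⟨p, hp⟩ : ∃ p, T.par U = p := ⟨_, rfl⟩
      rw [hp] at hpr
      have hpU : U ∈ T.ch (nodes n v N) p := PT.mem_ch.2 ⟨hUX, hUr, hp⟩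
      have hUp : U ≠ p := h.tree.ne_of_ch hpU
      -- This makes the truncated subtraction exact when `U` is replaced by the new node in the
      -- child sum of `p`.
      have hUle : U ≤ T.cs p := by
        rw [h.reduced.cs_eq p hpr.1 hpr.2]
        exact Finset.single_le_sum (f := fun x => x) (fun _ _ => Nat.zero_le _) hpU
      have hcsp := hcs p hpr.1 hpr.2
      have hpm := hlt p hpr.1
      have hpN := hne p hpr.1
      have hsub : ∀ T' : PT, T'.root = T.root → T'.par = Function.update (Function.update
          (Function.update T.par N p) U N) v N → T'.lab = Function.update T.lab N b →
          T'.nc = Function.update T.nc N 2 →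
          T'.cs = Function.update (Function.update T.cs N (U + v)) p (T.cs p + N - U) →
          T.Subdivide T' (nodes n v N) v U b N := by
        intro T' e1 e2 e3 e4 e5
        constructor
        · exact hNX
        · exact hvX
        · omega
        · rw [if_neg hUr, e1]
        · rw [if_neg hUr, e2, Function.update_of_ne (by omega), Function.update_of_ne (by omega),
            Function.update_self, hp]
        · rw [e2, Function.update_of_ne hUv, Function.update_self]
        · rw [e2, Function.update_self]
        · intro x hx hxU
          rw [e2, Function.update_of_ne (hne x hx).2, Function.update_of_ne hxU,
            Function.update_of_ne (hne x hx).1]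
        · intro x hx
          rw [e3, Function.update_of_ne (hne x hx).1]
        · rw [e3, Function.update_self]
        · rw [e4, Function.update_self]
        · intro x hx
          rw [e4, Function.update_of_ne (hne x hx).1]
        · rw [e5, Function.update_of_ne (by omega), Function.update_self]
        · intro _
          rw [hp, e5, Function.update_self]
          omega
        · intro x hx hxp
          have := hxp hUr
          rw [hp] at this
          rw [e5, Function.update_of_ne this, Function.update_of_ne (hne x hx).1]
      simp [block, wp, Expr.eval, h1, h11, h27, h28, t2, a2, a7, hUr, hp, hpN.1]
      refine ⟨by omega, by omega, by omega, by omega, by omega, by omega, by omega, by omega, ?_,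
        ?_⟩
      · apply_rules [Frame.setReg, Frame.setArr, Frame.refl] <;> simp
      · rw [← insert_leaf_nodes, ← insert_nodes v hN, Finset.range_add_one]
        refine h.subdivide hsymm hor (hsub _ ?_ ?_ ?_ ?_ ?_) <;>
          simp [treeOf, t2, a2, a3, a6, a7]
  · obtain ⟨hU, e⟩ : n ≤ U ∧ T.lab U = b := by
      simp [Expr.eval, h27, h28, h10, a3] at hcond
      refine ⟨hcond.1, ?_⟩
      by_contra hne
      simp [hne] at hcond
    have hUV' : U ∉ Finset.range v := by
      rw [hUV]
      omega
    have hsub : ∀ T' : PT, T'.root = T.root → T'.par = Function.update T.par v U →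
        T'.lab = T.lab → T'.nc = Function.update T.nc U (T.nc U + 1) →
        T'.cs = Function.update T.cs U (T.cs U + v) →
        T.AddLeaf T' (nodes n v N) (Finset.range v) v U := by
      intro T' e1 e2 e3 e4 e5
      constructor
      · exact hUX
      · exact hUV'
      · exact hvX
      · exact e1
      · rw [e2, Function.update_self]
      · intro x hx
        rw [e2, Function.update_of_ne (hne x hx).2]
      · intro x hx
        rw [e3]
      · rw [e4, Function.update_self]
      · intro x hx hxU
        rw [e4, Function.update_of_ne hxU]
      · rw [e5, Function.update_self]
      · intro x hx hxU
        rw [e5, Function.update_of_ne hxU]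
    have := hcs U hUX hUV'
    simp [block, wp, Expr.eval, h1, h11, h27, a6, a7]
    refine ⟨by omega, by omega, by omega, ?_, ?_⟩
    · exact .setArr (.setArr (.setArr .refl (by simp)) (by simp)) (by simp)
    · rw [← insert_leaf_nodes, Finset.range_add_one]
      refine h.addLeaf hsymm hUV' e (hsub _ ?_ ?_ ?_ ?_ ?_) <;>
        simp [treeOf, h1, t2, a2, a3, a6, a7]
  · simp [attach, block, Program.cost, Expr.cost]

/-! ### The construction phase: splitting a node -/

/-- Make all children of the node in register 24 that are in the queue children of the node in
register 29. -/
def move : Program :=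
  .seq (block [.set 15 (.lit 0)])
    (.loop (.lt (.reg 15) (.reg 17)) (block [
      .set 18 (.read 8 (.reg 15)),
      .ite (.eq (.read 2 (.reg 18)) (.reg 24)) (.write 2 (.reg 18) (.reg 29)) .skip,
      .set 15 (.add (.reg 15) (.lit 1))]))

theorem move_spec {W β y : ℕ} {s : Memory} (h24 : s.reg 24 = β) (h29 : s.reg 29 = y) (hy : y ≠ β)
    (hyW : y ≤ W) (hW : ∀ i < s.reg 17, s.arr 8 i ≤ W) (h17 : s.reg 17 ≤ W) :
    RunsWithin W move s (100 * (s.reg 17 + 1)) fun s' => Frame [15, 18] [2] s s' ∧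
      s'.arr 2 = fun x => if x ∈ img (s.arr 8) (s.reg 17) ∧ s.arr 2 x = β then y else s.arr 2 x :=
        by
  refine (runsWithin_init_loop (fun k s' => Frame [15, 18] [2] s s' ∧ k + s'.reg 15 = s.reg 17 ∧
      s'.arr 2 = fun x => if x ∈ img (s.arr 8) (s'.reg 15) ∧ s.arr 2 x = β then y else s.arr 2 x)
      (s.reg 17) ?_ ?_ ?_).mono ?_ fun _ h => h
  · simp [block, wp, Expr.eval, img_zero]
    apply_rules [Frame.setReg, Frame.refl] <;> simp
  · rintro k s' ⟨hf, hk, h2⟩ hb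
    have hlt : s'.reg 15 < s'.reg 17 := Expr.lt_ne_zero.1 hb
    have r24 := hf.1 24 (by simp)
    have r29 := hf.1 29 (by simp)
    have r17 := hf.1 17 (by simp)
    have a8 := hf.2 8 (by simp)
    have := hW (s'.reg 15) (by omega)
    obtain ⟨w, hw⟩ : ∃ w, s.arr 8 (s'.reg 15) = w := ⟨_, rfl⟩
    -- The test reads the parent array while it is being changed. As `y ≠ β`, an entry that still
    -- equals `β` is an original one.
    have hiff : s'.arr 2 w = β → s.arr 2 w = β := by
      rw [h2]
      dsimp only
      split_ifs with h
      · exact fun e => absurd e hy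
      · exact id
    have hiff' : s'.arr 2 w ≠ β → s.arr 2 w = β → w ∈ img (s.arr 8) (s'.reg 15) := by
      rw [h2]
      dsimp only
      split_ifs with h
      · exact fun _ _ => h.1
      · exact fun h1 h2 => absurd h2 h1
    simp [block, wp, Expr.eval, a8, hw, r24, r29, h24, h29]
    refine ⟨by omega, fun e => ⟨by omega, by omega, k - 1, by omega, ?_, by omega, ?_⟩,
      fun e => ⟨by omega, k - 1, by omega, ?_, by omega, ?_⟩⟩
    · apply_rules [Frame.setReg, Frame.setArr, Frame.refl] <;> simp
    · funext x
      rw [Function.update_apply, img_succ, hw]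
      by_cases hx : x = w
      · simp [hx, hiff e]
      · rw [if_neg hx, h2]
        simp [hx]
    · apply_rules [Frame.setReg, Frame.setArr, Frame.refl] <;> simp
    · rw [h2]
      funext x
      rw [img_succ, hw]
      by_cases hx : x = w
      · subst hx
        have := hiff' e
        by_cases h3 : s.arr 2 x = β
        · simp [h3, this h3]
        · simp [h3]
      · simp [hx]
  · rintro k s' ⟨hf, hk, h2⟩ hb
    have hge : s'.reg 17 ≤ s'.reg 15 := Expr.lt_eq_zero.1 hb
    have r17 := hf.1 17 (by simp)
    obtain rfl : k = 0 := by omega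
    rw [Nat.zero_add] at hk
    rw [hk] at h2
    exact ⟨hf, h2⟩
  · simp [block, Program.cost, Expr.cost]
    omega

end CICograph

/-! ### The construction phase: splitting the lowest mixed node and placing the new leaf. -/

namespace CICograph

open Memory Program

/-- Put a new node above the node `β` in register 24, and move the full children of `β` to it. -/
def splitUp : Program :=
  .seq (block [.set 29 (.reg 1), .set 1 (.add (.reg 1) (.lit 1))]) (.seq move (block [
    .write 3 (.reg 29) (.lit 1),
    .write 6 (.reg 29) (.add (.read 10 (.add (.reg 12) (.reg 24))) (.lit 1)),
    .write 7 (.reg 29) (.add (.read 11 (.add (.reg 12) (.reg 24))) (.reg 24)),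
    .write 6 (.reg 24) (.sub (.read 6 (.reg 24)) (.read 10 (.add (.reg 12) (.reg 24)))),
    .write 7 (.reg 24) (.sub (.read 7 (.reg 24)) (.read 11 (.add (.reg 12) (.reg 24)))),
    .ite (.eq (.reg 24) (.reg 2)) (block [
      .set 2 (.reg 29),
      .write 2 (.reg 29) (.reg 29)]) (block [
      .set 21 (.read 2 (.reg 24)),
      .write 2 (.reg 29) (.reg 21),
      .write 7 (.reg 21) (.sub (.add (.read 7 (.reg 21)) (.reg 29)) (.reg 24))]),
    .write 2 (.reg 24) (.reg 29),
    .set 27 (.reg 24),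
    .set 28 (.lit 0)]))

/-- Put a new node below the node `β` in register 24, and move the full children of `β` to it. -/
def splitDown : Program :=
  .seq (block [.set 29 (.reg 1), .set 1 (.add (.reg 1) (.lit 1))]) (.seq move (block [
    .write 2 (.reg 29) (.reg 24),
    .write 3 (.reg 29) (.lit 0),
    .write 6 (.reg 29) (.read 10 (.add (.reg 12) (.reg 24))),
    .write 7 (.reg 29) (.read 11 (.add (.reg 12) (.reg 24))),
    .write 6 (.reg 24)
      (.sub (.add (.read 6 (.reg 24)) (.lit 1)) (.read 10 (.add (.reg 12) (.reg 24)))),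
    .write 7 (.reg 24)
      (.sub (.add (.read 7 (.reg 24)) (.reg 29)) (.read 11 (.add (.reg 12) (.reg 24)))),
    .set 27 (.reg 29),
    .set 28 (.lit 1)]))

/-- Find the place for the new leaf, at the mixed node `β` in register 24. -/
def site : Program :=
  .ite (.eq (.read 3 (.reg 24)) (.lit 1))
    (.ite (.eq (.add (.read 10 (.add (.reg 12) (.reg 24))) (.lit 1)) (.read 6 (.reg 24)))
      (block [
        .set 27 (.sub (.read 7 (.reg 24)) (.read 11 (.add (.reg 12) (.reg 24)))),
        .set 28 (.lit 0)]) splitUp)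
    (.ite (.eq (.read 10 (.add (.reg 12) (.reg 24))) (.lit 1))
      (block [
        .set 27 (.read 11 (.add (.reg 12) (.reg 24))),
        .set 28 (.lit 1)]) splitDown)

/-- What the search for the place of the new leaf achieves. -/
def Placed (n v N : ℕ) (adj : ℕ → ℕ → Prop) (s s' : Memory) : Prop :=
  Frame [1, 2, 15, 18, 21, 27, 28, 29] [2, 3, 6, 7] s s' ∧ N ≤ s'.reg 1 ∧ s'.reg 1 ≤ N + 1 ∧
    (treeOf s').Attachable (nodes n v (s'.reg 1)) (Finset.range v) adj v (s'.reg 27) (s'.reg 28)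

section

variable {W m n v N β : ℕ} {s : Memory} {F : Finset ℕ} {adj : ℕ → ℕ → Prop}

/-- The situation at the beginning of `site`. -/
structure AtSite (s : Memory) (F : Finset ℕ) (adj : ℕ → ℕ → Prop) (n v N m W β : ℕ) : Prop where
  marked : Marked s (nodes n v N) (Finset.range v) F m
  cotree : (treeOf s).IsCotree (nodes n v N) (Finset.range v) adj
  isSite : (treeOf s).IsSite (nodes n v N) (Finset.range v) F adj v β
  mixed : (treeOf s).IsMixed (nodes n v N) (Finset.range v) F β
  reg_fresh : s.reg 1 = N
  reg_site : s.reg 24 = β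
  reg_queue : s.reg 17 = F.card
  lt : v < n
  le : n ≤ N
  bound : N < m
  word : m * m + 4 * m ≤ W

namespace AtSite

theorem mem (h : AtSite s F adj n v N m W β) : β ∈ nodes n v N := h.mixed.1

theorem card_lt (h : AtSite s F adj n v N m W β) :
    ((treeOf s).ch (nodes n v N) β ∩ F).card < ((treeOf s).ch (nodes n v N) β).card := by
  refine Finset.card_lt_card ⟨Finset.inter_subset_left, fun h2 => h.mixed.2.2.1 ?_⟩
  exact (h.marked.node β h.mixed.1 h.mixed.2.1).2 fun c hc => (Finset.mem_inter.1 (h2 hc)).2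

theorem nonempty (h : AtSite s F adj n v N m W β) :
    ((treeOf s).ch (nodes n v N) β ∩ F).Nonempty := by
  obtain ⟨-, -, -, c, hc, hcF⟩ := h.mixed
  exact ⟨c, Finset.mem_inter.2 ⟨hc, hcF⟩⟩

theorem notMem_nodes (h : AtSite s F adj n v N m W β) : N ∉ nodes n v N := by
  have := h.lt
  have := h.le
  rw [mem_nodes]
  omega

theorem ne_fresh (h : AtSite s F adj n v N m W β) : β ≠ N := fun e =>
  h.notMem_nodes (e ▸ h.mem)

/-- After the moving of the full children of `β`. -/
theorem move_spec (h : AtSite s F adj n v N m W β) {B : ℕ} {p : Program} {Q : Memory → Prop}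
    (hp : ∀ s', Frame [1, 15, 18, 29] [2] s s' → s'.reg 1 = N + 1 → s'.reg 29 = N →
      (∀ x ∈ (treeOf s).ch (nodes n v N) β ∩ F, s'.arr 2 x = N) →
      (∀ x ∈ nodes n v N, x ∉ (treeOf s).ch (nodes n v N) β ∩ F → s'.arr 2 x = s.arr 2 x) →
      p.wp W Q s') (hB : p.cost ≤ B) :
    RunsWithin W (.seq (block [.set 29 (.reg 1), .set 1 (.add (.reg 1) (.lit 1))]) (.seq move p)) s
      (20 + (100 * (F.card + 1) + B)) Q := by
  have hlt := h.marked.lt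
  have hFm : F.card ≤ m := card_le_of_lt fun x hx => hlt x (h.marked.sub hx)
  have := h.word
  have := h.bound
  have hmm : 1 ≤ m * m := Nat.mul_pos (by omega) (by omega)
  have hβF := h.mixed.2.2.1
  refine runsWithin_seq (.of_wp (Q := fun s' => RunsWithin W (.seq move p) s' _ Q) ?_ ?_)
  · simp only [block, List.foldr, wp, Expr.eval, setReg_reg]
    simp [h.reg_fresh]
    refine ⟨by omega, by omega, runsWithin_seq ?_⟩
    refine (CICograph.move_spec (β := β) (y := N) (by simp [h.reg_site]) (by simp)
      h.ne_fresh.symm (by omega) ?_ ?_).mono ?_ ?_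
    · intro i hi
      have : s.arr 8 i ∈ F := by
        rw [← h.marked.queue]
        exact mem_img.2 ⟨i, by simpa using hi, rfl⟩
      have := hlt _ (h.marked.sub this)
      simp
      omega
    · simp [h.reg_queue]
      omega
    · simp [h.reg_queue]
    · rintro s' ⟨hf, h2⟩
      have e2 : s'.arr 2 = fun x => if x ∈ F ∧ s.arr 2 x = β then N else s.arr 2 x := by
        simpa [h.marked.queue] using h2
      refine .of_wp (hp s' ?_ ?_ ?_ ?_ ?_) hB
      · refine .trans ?_ (hf.mono (by simp) (by simp))
        exact .setReg (.setReg .refl (by simp)) (by simp)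
      · rw [hf.1 1 (by simp)]
        simp
      · rw [hf.1 29 (by simp)]
        simp
      · intro x hx
        rw [Finset.mem_inter, PT.mem_ch] at hx
        rw [e2]
        exact if_pos ⟨hx.2, hx.1.2.2⟩
      · intro x hx hxM
        rw [e2]
        refine if_neg fun hx' => hxM ?_
        -- If `β` is the root, then the test for a child of `β` also succeeds for the root, its own
        -- parent. The root is not moved then, because `β` is not full and hence not in the queue.
        have hne : x ≠ s.reg 2 := by
          rintro rfl
          have : s.arr 2 (s.reg 2) = s.reg 2 := h.marked.reduced.par_root
          rw [this] at hx'
          exact hβF (hx'.2 ▸ hx'.1)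
        exact Finset.mem_inter.2 ⟨PT.mem_ch.2 ⟨hx, hne, hx'.2⟩, hx'.1⟩
  · simp [block, Program.cost, Expr.cost]

/-- Bounds for the numbers of children and the sums of children. -/
theorem counts (h : AtSite s F adj n v N m W β) {x : ℕ} (hx : x ∈ nodes n v N)
    (hxV : x ∉ Finset.range v) : s.arr 6 x ≤ m ∧ s.arr 7 x ≤ m * m := by
  have h6 : s.arr 6 x = _ := h.marked.reduced.nc_eq x hx hxV
  have h7 : s.arr 7 x = _ := h.marked.reduced.cs_eq x hx hxV
  rw [h6, h7]
  exact ⟨card_le_of_lt fun c hc => h.marked.lt c (Finset.filter_subset _ _ hc),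
    sum_le_of_lt fun c hc => h.marked.lt c (Finset.filter_subset _ _ hc)⟩

theorem sum_le (h : AtSite s F adj n v N m W β) :
    ∑ c ∈ (treeOf s).ch (nodes n v N) β ∩ F, c ≤ s.arr 7 β := by
  have h7 : s.arr 7 β = _ := h.marked.reduced.cs_eq β h.mixed.1 h.mixed.2.1
  rw [h7]
  exact Finset.sum_le_sum_of_subset Finset.inter_subset_left

theorem fresh_notMem (h : AtSite s F adj n v N m W β) :
    N ∉ (treeOf s).ch (nodes n v N) β ∩ F := fun e =>
  h.notMem_nodes (Finset.filter_subset _ _ (Finset.mem_inter.1 e).1)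

theorem ne_of_mem (h : AtSite s F adj n v N m W β) {x : ℕ}
    (hx : x ∈ (treeOf s).ch (nodes n v N) β ∩ F) : x ≠ β ∧ x ≠ N := by
  refine ⟨?_, ?_⟩
  · rintro rfl
    exact h.mixed.2.2.1 (Finset.mem_inter.1 hx).2
  · rintro rfl
    exact h.fresh_notMem hx

theorem ne_fresh_of_mem (h : AtSite s F adj n v N m W β) {x : ℕ} (hx : x ∈ nodes n v N) : x ≠ N :=
    by
  rintro rfl
  exact h.notMem_nodes hx

theorem splitDown_spec (h : AtSite s F adj n v N m W β) (hβ : s.arr 3 β = 0)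
    (hcard : 2 ≤ ((treeOf s).ch (nodes n v N) β ∩ F).card) :
    RunsWithin W splitDown s (100 * F.card + 300) (Placed n v N adj s) := by
  obtain ⟨M, hM⟩ : ∃ M, (treeOf s).ch (nodes n v N) β ∩ F = M := ⟨_, rfl⟩
  have hc := h.counts h.mem h.mixed.2.1
  have hnc : s.arr 6 β = _ := h.marked.reduced.nc_eq β h.mem h.mixed.2.1
  have hsum := h.sum_le
  have hMlt := h.card_lt
  have hcount := h.marked.count β h.mem
  have hsumM := h.marked.sum β h.mem
  have hword := h.word
  have hbound := h.bound
  have hβm := h.marked.lt β h.mem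
  have hβN := h.ne_fresh
  have hMN := h.fresh_notMem
  have hMne : ∀ x ∈ M, x ≠ β ∧ x ≠ N := fun x hx => h.ne_of_mem (hM ▸ hx)
  have hsite T' := h.isSite.attachable_splitDown (T' := T') h.cotree hβ hM.symm (hM ▸ hcard)
    (hM ▸ hMlt) (y := N)
  rw [hM] at hcard hsum hMlt hcount hsumM hMN
  have hmm : 1 ≤ m * m := Nat.mul_pos (by omega) (by omega)
  refine (h.move_spec (B := 100) ?_ (by simp [block, Program.cost, Expr.cost])).mono (by omega)
    fun _ h => h
  rw [hM]
  intro s' hf e1 e29 hmv hnm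
  have r24 := (hf.1 24 (by simp)).trans h.reg_site
  have r12 := hf.1 12 (by simp)
  have r2 := hf.1 2 (by simp)
  have a3 := hf.2 3 (by simp)
  have a6 := hf.2 6 (by simp)
  have a7 := hf.2 7 (by simp)
  have a10 := hf.2 10 (by simp)
  have a11 := hf.2 11 (by simp)
  have hsub : ∀ T' : PT, T'.root = s.reg 2 → T'.par = Function.update (s'.arr 2) N β →
      T'.lab = Function.update (s.arr 3) N 0 →
      T'.nc = Function.update (Function.update (s.arr 6) N M.card) β (s.arr 6 β + 1 - M.card) →
      T'.cs = Function.update (Function.update (s.arr 7) N (∑ c ∈ M, c)) β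
        (s.arr 7 β + N - ∑ c ∈ M, c) →
      (treeOf s).SplitDown T' (nodes n v N) (Finset.range v) M β N := by
    intro T' t1 t2 t3 t4 t5
    constructor
    · exact h.mem
    · exact h.mixed.2.1
    · exact h.notMem_nodes
    · rw [← hM]
      exact Finset.inter_subset_left
    · exact t1
    · rw [t2, Function.update_self]
    · intro x hx
      rw [t2, Function.update_of_ne (hMne x hx).2, hmv x hx]
    · intro x hx hxM
      rw [t2, Function.update_of_ne (h.ne_fresh_of_mem hx), hnm x hx hxM]
      rfl
    · intro x hx
      rw [t3, Function.update_of_ne (h.ne_fresh_of_mem hx)]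
      rfl
    · rw [t3, Function.update_self]
      exact hβ.symm
    · rw [t4, Function.update_of_ne hβN.symm, Function.update_self]
    · rw [t4, Function.update_self]
      change _ = s.arr 6 β + 1
      omega
    · intro x hx hxβ
      rw [t4, Function.update_of_ne hxβ, Function.update_of_ne (h.ne_fresh_of_mem hx)]
      rfl
    · rw [t5, Function.update_of_ne hβN.symm, Function.update_self]
    · rw [t5, Function.update_self]
      change _ = s.arr 7 β + N
      omega
    · intro x hx hxβ
      rw [t5, Function.update_of_ne hxβ, Function.update_of_ne (h.ne_fresh_of_mem hx)]
      rfl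
  have hplaced : ∀ t : Memory, Frame [2, 21, 27, 28] [2, 3, 6, 7] s' t → t.reg 27 = N → t.reg 28 =
    1 →
      (treeOf s).SplitDown (treeOf t) (nodes n v N) (Finset.range v) M β N → Placed n v N adj s t :=
        by
    intro t hft h27 h28 hs
    have t1 := (hft.1 1 (by simp)).trans e1
    refine ⟨(hf.mono (by simp) (by simp)).trans (hft.mono (by simp) (by simp)), by omega, by omega,
      ?_⟩
    rw [t1, h27, h28, ← insert_nodes v h.le]
    exact hsite _ hs
  simp [block, wp, Expr.eval, r24, r12, e29, a6, a7, a10, a11, hcount, hsumM, hβN]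
  refine ⟨by omega, by omega, by omega, by omega, by omega, by omega, by omega,
    hplaced _ ?_ (by simp) (by simp) (hsub _ ?_ ?_ ?_ ?_ ?_)⟩
  · apply_rules [Frame.setReg, Frame.setArr, Frame.refl] <;> simp
  all_goals simp [treeOf, r2, a3, a6, a7]

theorem splitUp_spec (h : AtSite s F adj n v N m W β) (hβ : s.arr 3 β = 1)
    (hcard : ((treeOf s).ch (nodes n v N) β ∩ F).card + 2 ≤
      ((treeOf s).ch (nodes n v N) β).card) :
    RunsWithin W splitUp s (100 * F.card + 300) (Placed n v N adj s) := by
  obtain ⟨M, hM⟩ : ∃ M, (treeOf s).ch (nodes n v N) β ∩ F = M := ⟨_, rfl⟩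
  have hc := h.counts h.mem h.mixed.2.1
  have hnc : s.arr 6 β = _ := h.marked.reduced.nc_eq β h.mem h.mixed.2.1
  have hsum := h.sum_le
  have hMlt := h.card_lt
  have hcount := h.marked.count β h.mem
  have hsumM := h.marked.sum β h.mem
  have hword := h.word
  have hbound := h.bound
  have hβm := h.marked.lt β h.mem
  have hβN := h.ne_fresh
  have hMN := h.fresh_notMem
  have hMne : ∀ x ∈ M, x ≠ β ∧ x ≠ N := fun x hx => h.ne_of_mem (hM ▸ hx)
  have hβM : β ∉ M := fun e => (hMne β e).1 rfl
  have hsite T' := h.isSite.attachable_splitUp (T' := T') h.cotree hβ hM.symm (hM ▸ h.nonempty)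
    (hM ▸ hcard) (y := N)
  rw [hM] at hcard hsum hMlt hcount hsumM hMN
  have hmm : 1 ≤ m * m := Nat.mul_pos (by omega) (by omega)
  refine (h.move_spec (B := 160) ?_ (by simp [block, Program.cost, Expr.cost])).mono (by omega)
    fun _ h => h
  rw [hM]
  intro s' hf e1 e29 hmv hnm
  have r24 := (hf.1 24 (by simp)).trans h.reg_site
  have r12 := hf.1 12 (by simp)
  have r2 := hf.1 2 (by simp)
  have a3 := hf.2 3 (by simp)
  have a6 := hf.2 6 (by simp)
  have a7 := hf.2 7 (by simp)
  have a10 := hf.2 10 (by simp)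
  have a11 := hf.2 11 (by simp)
  have pβ : s'.arr 2 β = s.arr 2 β := hnm β h.mem hβM
  -- The update of the child sum of the parent must not touch the cells of `β` and of the new node,
  -- and its truncated subtraction must be exact.
  have hpar : β ≠ s.reg 2 → s.arr 2 β ≠ β ∧ s.arr 2 β ≠ N ∧ β ≤ s.arr 7 (s.arr 2 β) := fun hr => by
    have hch : β ∈ (treeOf s).ch (nodes n v N) (s.arr 2 β) := PT.mem_ch.2 ⟨h.mem, hr, rfl⟩
    have hp := h.marked.tree.par_mem β h.mem hr
    refine ⟨(h.marked.tree.ne_of_ch hch).symm, h.ne_fresh_of_mem hp.1, ?_⟩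
    have : s.arr 7 (s.arr 2 β) = _ := h.marked.reduced.cs_eq _ hp.1 hp.2
    rw [this]
    exact Finset.single_le_sum (f := fun x => x) (fun _ _ => Nat.zero_le _) hch
  have hsub : ∀ T' : PT, (T'.root = if β = s.reg 2 then N else s.reg 2) →
      T'.par = Function.update (Function.update (s'.arr 2) N (if β = s.reg 2 then N else s.arr 2 β))
        β N →
      T'.lab = Function.update (s.arr 3) N 1 →
      T'.nc = Function.update (Function.update (s.arr 6) N (M.card + 1)) β (s.arr 6 β - M.card) →
      (∀ f, f = Function.update (Function.update (s.arr 7) N (∑ c ∈ M, c + β)) β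
        (s.arr 7 β - ∑ c ∈ M, c) → T'.cs = if β = s.reg 2 then f else
          Function.update f (s.arr 2 β) (s.arr 7 (s.arr 2 β) + N - β)) →
      (treeOf s).SplitUp T' (nodes n v N) (Finset.range v) M β N := by
    intro T' t1 t2 t3 t4 t5
    replace t5 := t5 _ rfl
    constructor
    · exact h.mem
    · exact h.notMem_nodes
    · rw [← hM]
      exact Finset.inter_subset_left
    · exact t1
    · rw [t2, Function.update_of_ne hβN.symm, Function.update_self]
      rfl
    · rw [t2, Function.update_self]
    · intro x hx
      rw [t2, Function.update_of_ne (hMne x hx).1, Function.update_of_ne (hMne x hx).2, hmv x hx]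
    · intro x hx hxβ hxM
      rw [t2, Function.update_of_ne hxβ, Function.update_of_ne (h.ne_fresh_of_mem hx), hnm x hx hxM]
      rfl
    · intro x hx
      rw [t3, Function.update_of_ne (h.ne_fresh_of_mem hx)]
      rfl
    · rw [t3, Function.update_self]
      exact fun _ => hβ.symm
    · rw [t4, Function.update_of_ne hβN.symm, Function.update_self]
    · intro _
      rw [t4, Function.update_self]
      change _ = s.arr 6 β
      omega
    · intro x hx hxβ
      rw [t4, Function.update_of_ne hxβ, Function.update_of_ne (h.ne_fresh_of_mem hx)]
      rfl
    · rw [t5]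
      split_ifs with hr
      · rw [Function.update_of_ne hβN.symm, Function.update_self]
      · rw [Function.update_of_ne (hpar hr).2.1.symm, Function.update_of_ne hβN.symm,
          Function.update_self]
    · intro _
      rw [t5]
      change _ = s.arr 7 β
      split_ifs with hr
      · rw [Function.update_self]
        omega
      · rw [Function.update_of_ne (hpar hr).1.symm, Function.update_self]
        omega
    · intro hr
      have := (hpar hr).2.2
      change T'.cs (s.arr 2 β) + β = s.arr 7 (s.arr 2 β) + N
      rw [t5, if_neg (by exact hr), Function.update_self]
      omega
    · intro x hx hxβ hxp
      rw [t5]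
      split_ifs with hr
      · rw [Function.update_of_ne hxβ, Function.update_of_ne (h.ne_fresh_of_mem hx)]
        rfl
      · have hxp' : x ≠ s.arr 2 β := hxp hr
        rw [Function.update_of_ne hxp', Function.update_of_ne hxβ,
          Function.update_of_ne (h.ne_fresh_of_mem hx)]
        rfl
  have hplaced : ∀ t : Memory, Frame [2, 21, 27, 28] [2, 3, 6, 7] s' t → t.reg 27 = β → t.reg 28 =
    0 →
      (treeOf s).SplitUp (treeOf t) (nodes n v N) (Finset.range v) M β N → Placed n v N adj s t :=
        by
    intro t hft h27 h28 hs
    have t1 := (hft.1 1 (by simp)).trans e1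
    refine ⟨(hf.mono (by simp) (by simp)).trans (hft.mono (by simp) (by simp)), by omega, by omega,
      ?_⟩
    rw [t1, h27, h28, ← insert_nodes v h.le]
    exact hsite _ hs
  by_cases hr : β = s.reg 2
  · have r2' := r2.trans hr.symm
    simp [block, wp, Expr.eval, r24, r12, r2', e29, a6, a7, a10, a11, hcount, hsumM, hβN, pβ]
    refine ⟨by omega, by omega, by omega, by omega, by omega, by omega, by omega,
      hplaced _ ?_ (by simp) (by simp) (hsub _ ?_ ?_ ?_ ?_ ?_)⟩
    · apply_rules [Frame.setReg, Frame.setArr, Frame.refl] <;> simp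
    all_goals simp [treeOf, a3, a6, a7, ← hr]
  · have hp := h.marked.tree.par_mem β h.mem hr
    have hp' : s.arr 2 β ∈ nodes n v N := hp.1
    have hpm : s.arr 2 β < m := h.marked.lt _ hp.1
    have hcp : _ ∧ s.arr 7 (s.arr 2 β) ≤ _ := h.counts hp.1 hp.2
    obtain ⟨hpβ, hpN, hple⟩ := hpar hr
    simp [block, wp, Expr.eval, r24, r12, r2, e29, a6, a7, a10, a11, hcount, hsumM, hβN, hr, pβ,
      hpβ, hpN]
    refine ⟨by omega, by omega, by omega, by omega, by omega, by omega, by omega, by omega, by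
      omega,
      hplaced _ ?_ (by simp) (by simp) (hsub _ ?_ ?_ ?_ ?_ ?_)⟩
    · apply_rules [Frame.setReg, Frame.setArr, Frame.refl] <;> simp
    all_goals simp [treeOf, r2, a3, a6, a7, hr]

/-- Four cases, by the label of `β` and by whether exactly one child is on the exceptional side (not
full for a 1-node, full for a 0-node). Splitting costs `O(F.card)` steps, since only full children
are moved. -/
theorem site_spec (h : AtSite s F adj n v N m W β) :
    RunsWithin W site s (100 * F.card + 400) (Placed n v N adj s) := by
  have hc := h.counts h.mem h.mixed.2.1
  have hnc : s.arr 6 β = _ := h.marked.reduced.nc_eq β h.mem h.mixed.2.1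
  have hcs : s.arr 7 β = _ := h.marked.reduced.cs_eq β h.mem h.mixed.2.1
  have hsum := h.sum_le
  have hMlt := h.card_lt
  have hcount := h.marked.count β h.mem
  have hsumM := h.marked.sum β h.mem
  have hword := h.word
  have hbound := h.bound
  have hne := h.nonempty.card_pos
  have hlab : s.arr 3 β ≤ 1 := h.marked.reduced.lab_le β h.mem h.mixed.2.1
  have r1 := h.reg_fresh
  have r24 := h.reg_site
  have hmm : 1 ≤ m * m := Nat.mul_pos (by omega) (by omega)
  have hplaced : ∀ U b t, Frame [27, 28] [] s t → t.reg 27 = U → t.reg 28 = b →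
      (treeOf s).Attachable (nodes n v N) (Finset.range v) adj v U b → Placed n v N adj s t := by
    intro U b t hf h27 h28 ha
    have t1 := (hf.1 1 (by simp)).trans r1
    refine ⟨hf.mono (by simp) (by simp), by omega, by omega, ?_⟩
    have : treeOf t = treeOf s := by
      rw [treeOf, treeOf, hf.2 2 (by simp), hf.2 3 (by simp), hf.2 6 (by simp), hf.2 7 (by simp),
        hf.1 1 (by simp), hf.1 2 (by simp)]
    rwa [t1, h27, h28, this]
  refine (runsWithin_ite (B := 100 * F.card + 350) (fun h1 => ?_) fun h1 => ?_).mono ?_ fun _ h => h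
  · have h1 : s.arr 3 β = 1 := r24 ▸ Expr.eq_ne_zero.1 h1
    refine (runsWithin_ite (B := 100 * F.card + 300) (fun h2 => ?_)
      fun h2 => ?_).mono ?_ fun _ h => h
    · replace h2 : s.arr 10 (s.reg 12 + s.reg 24) + 1 = s.arr 6 (s.reg 24) := Expr.eq_ne_zero.1 h2
      rw [r24, hcount, hnc] at h2
      have hsd : ((treeOf s).ch (nodes n v N) β \ F).card = 1 := by
        have := Finset.card_sdiff_add_card_inter ((treeOf s).ch (nodes n v N) β) F
        omega
      obtain ⟨U, hU⟩ := Finset.card_eq_one.1 hsd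
      have hUm : U ∈ (treeOf s).ch (nodes n v N) β \ F := by simp [hU]
      rw [Finset.mem_sdiff] at hUm
      -- The only child that is not full is found in constant time, as the sum of all children minus
      -- that of the full ones.
      have hUs : s.arr 7 β - ∑ c ∈ (treeOf s).ch (nodes n v N) β ∩ F, c = U := by
        rw [hcs, ← Finset.sum_inter_add_sum_sdiff ((treeOf s).ch (nodes n v N) β) F, hU,
          Finset.sum_singleton]
        omega
      refine .of_wp (?_ : wp W _ _ s) (by simp [block, Program.cost, Expr.cost])
      simp [block, wp, Expr.eval, r24, hsumM, hUs]
      refine ⟨by omega, hplaced U 0 _ ?_ (by simp) (by simp) ?_⟩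
      · exact .setReg (.setReg .refl (by simp)) (by simp)
      · refine h.isSite.attachable_child h.cotree hUm.1 (by simp) (by simp [treeOf, h1])
          (by simp [hUm.2]) fun c hc hcU => ?_
        refine iff_of_true ?_ h1
        by_contra hcF
        have : c ∈ (treeOf s).ch (nodes n v N) β \ F := Finset.mem_sdiff.2 ⟨hc, hcF⟩
        rw [hU, Finset.mem_singleton] at this
        exact hcU this
    · replace h2 : s.arr 10 (s.reg 12 + s.reg 24) + 1 ≠ s.arr 6 (s.reg 24) := Expr.eq_eq_zero.1 h2
      rw [r24, hcount, hnc] at h2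
      exact h.splitUp_spec h1 (by omega)
    · simp [Expr.cost]
      omega
  · replace h1 : s.arr 3 (s.reg 24) ≠ 1 := Expr.eq_eq_zero.1 h1
    rw [r24] at h1
    refine (runsWithin_ite (B := 100 * F.card + 300) (fun h2 => ?_)
      fun h2 => ?_).mono ?_ fun _ h => h
    · replace h2 : s.arr 10 (s.reg 12 + s.reg 24) = 1 := Expr.eq_ne_zero.1 h2
      rw [r24, hcount] at h2
      obtain ⟨U, hU⟩ := Finset.card_eq_one.1 h2
      have hUm : U ∈ (treeOf s).ch (nodes n v N) β ∩ F := by simp [hU]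
      have hUm' := h.marked.lt U (h.marked.sub (Finset.mem_inter.1 hUm).2)
      rw [Finset.mem_inter] at hUm
      rw [hU, Finset.sum_singleton] at hsumM
      refine .of_wp (?_ : wp W _ _ s) (by simp [block, Program.cost, Expr.cost])
      simp [block, wp, Expr.eval, r24, hsumM]
      refine ⟨by omega, by omega, hplaced U 1 _ ?_ (by simp) (by simp) ?_⟩
      · exact .setReg (.setReg .refl (by simp)) (by simp)
      · have h0 : (treeOf s).lab β = 0 := by
          change s.arr 3 β = 0
          omega
        refine h.isSite.attachable_child h.cotree hUm.1 (by simp) (by simp [h0])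
          (by simp [hUm.2]) fun c hc hcU => ?_
        rw [h0]
        simp only [zero_ne_one, iff_false]
        intro hcF
        have : c ∈ (treeOf s).ch (nodes n v N) β ∩ F := Finset.mem_inter.2 ⟨hc, hcF⟩
        rw [hU, Finset.mem_singleton] at this
        exact hcU this
    · replace h2 : s.arr 10 (s.reg 12 + s.reg 24) ≠ 1 := Expr.eq_eq_zero.1 h2
      rw [r24, hcount] at h2
      exact h.splitDown_spec (by omega) (by omega)
    · simp [Expr.cost]
      omega
  · simp [Expr.cost]
    omega

end AtSite

end

end CICograph

namespace CICograph

open Memory Program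

/-! ### The construction phase: inserting a vertex -/

theorem treeOf_eq {R A : List ℕ} {s s' : Memory} (h : Frame R A s s') (hR : 1 ∉ R ∧ 2 ∉ R)
    (hA : 2 ∉ A ∧ 3 ∉ A ∧ 6 ∉ A ∧ 7 ∉ A) : treeOf s' = treeOf s := by
  rw [treeOf, treeOf, h.1 1 hR.1, h.1 2 hR.2, h.2 2 hA.1, h.2 3 hA.2.1, h.2 6 hA.2.2.1,
    h.2 7 hA.2.2.2]

section

variable {W m n v N : ℕ} {s s' : Memory} {X V F : Finset ℕ} {adj : ℕ → ℕ → Prop}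

theorem mixedUpTo_frame (hf : Frame [13, 19, 21, 23, 24, 25, 26] [12] s s') (k : ℕ) :
    mixedUpTo s' k = mixedUpTo s k := by
  rw [mixedUpTo, mixedUpTo, hf.2 9 (by simp), hf.2 10 (by simp), hf.2 6 (by simp),
    hf.1 12 (by simp)]

theorem Marked.of_frame (h : Marked s X V F m) (hf : Frame [13, 19, 21, 23, 24, 25, 26] [12] s s') :
    Marked s' X V F m := by
  have ht := treeOf_eq hf (by simp) (by simp)
  have r12 := hf.1 12 (by simp)
  constructor
  · rw [ht]; exact h.tree
  · rw [ht]; exact h.reduced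
  · exact h.lt
  · rw [hf.2 8 (by simp), hf.1 17 (by simp)]; exact h.queue
  · exact h.sub
  · rw [ht]; exact h.node
  · rw [ht, r12, hf.2 10 (by simp)]; exact h.count
  · rw [ht, r12, hf.2 11 (by simp)]; exact h.sum
  · rw [ht, hf.2 9 (by simp), hf.1 20 (by simp)]; exact h.touched
  · rw [hf.2 9 (by simp), hf.1 20 (by simp)]; exact h.card_touched

theorem MarkInv.marked {S : Finset ℕ} (h : MarkInv s X V S m s')
    (ht : (treeOf s).IsTree X V) (hr : (treeOf s).IsReduced X V ∅) (hX : ∀ x ∈ X, x < m)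
    (hend : s'.reg 19 = s'.reg 17) : Marked s' X V (img (s'.arr 8) (s'.reg 17)) m := by
  have hT := treeOf_eq h.frame (by simp) (by simp)
  have r12 := h.frame.1 12 (by simp)
  have h1 := h.node
  have h2 := h.count
  have h3 := h.sum
  have h4 := h.touched
  rw [hend] at h1 h2 h3 h4
  constructor
  · rw [hT]; exact ht
  · rw [hT]; exact hr
  · exact hX
  · rfl
  · exact h.queue_sub
  · rw [hT]; exact h1
  · rw [hT, r12]; exact h2
  · rw [hT, r12]; exact h3
  · rw [hT]; exact h4
  · exact h.card_touched

/-- Find the place for the new leaf. -/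
def place : Program :=
  .ite (.eq (.reg 23) (.lit 0)) (block [.set 27 (.reg 2), .set 28 (.lt (.lit 0) (.reg 22))])
    (.seq pick (.seq walk (.ite (.eq (.reg 13) (.lit 0)) site .skip)))

/-- Failure is a proof that the graph is not a cograph: in a cograph some mixed node is unflagged,
so the picked one is unflagged, hence the lowest, and the climb succeeds. -/
theorem place_spec (hsymm : ∀ u w, adj u w → adj w u)
    (hm : Marked s (nodes n v N) (Finset.range v) F m)
    (hc : (treeOf s).IsCotree (nodes n v N) (Finset.range v) adj)
    (hF : (treeOf s).IsFull (nodes n v N) (Finset.range v) F adj v)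
    (h1 : s.reg 1 = N) (h13 : s.reg 13 = 0) (h17 : s.reg 17 = F.card)
    (h22 : s.reg 22 = 0 ↔ ∀ u < v, ¬ adj v u)
    (h23 : s.reg 23 = (mixedUpTo s (s.reg 20)).card)
    (h24 : (mixedUpTo s (s.reg 20)).Nonempty → s.reg 24 ∈ mixedUpTo s (s.reg 20))
    (hfl : ∀ x, (s.arr 12 (s.reg 12 + x) ≠ 0 ↔ ∃ p ∈ mixedUpTo s (s.reg 20),
      p ≠ s.reg 2 ∧ (s.arr 2 p = x ∨ s.arr 2 (s.arr 2 p) = x)))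
    (hv : v < n) (hN : n ≤ N) (hNm : N < m) (hW : m * m + 4 * m ≤ W) :
    RunsWithin W place s (400 * s.reg 20 + 100 * F.card + 1000) fun s' =>
      Frame [1, 2, 13, 15, 18, 19, 21, 24, 25, 26, 27, 28, 29] [2, 3, 6, 7] s s' ∧
        (s'.reg 13 = 0 ∧ N ≤ s'.reg 1 ∧ s'.reg 1 ≤ N + 1 ∧
            (treeOf s').Attachable (nodes n v (s'.reg 1)) (Finset.range v) adj v (s'.reg 27)
              (s'.reg 28) ∨
          s'.reg 13 = 1 ∧ s'.reg 1 = N ∧ ¬ NoP4 adj) := by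
  have hrm : s.reg 2 < m := hm.lt _ hc.tree.root_mem
  have hmm : 1 ≤ m * m := Nat.mul_pos (by omega) (by omega)
  refine (runsWithin_ite (B := 400 * s.reg 20 + 100 * F.card + 950)
    (fun hb => ?_) fun hb => ?_).mono (by simp [Expr.cost]; omega) fun _ h => h
  · have h0 : s.reg 23 = 0 := Expr.eq_ne_zero.1 hb
    rw [h0, eq_comm, Finset.card_eq_zero] at h23
    have hno : ∀ q, ¬ (treeOf s).IsMixed (nodes n v N) (Finset.range v) F q := fun q hq => by
      have := hm.mem_mixed.2 hq
      simp [h23] at this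
    -- Without mixed nodes, a single neighbour of `v` already makes the root full.
    have hall : ∀ u < v, adj v u → ∀ w < v, adj v w := by
      intro u hu hvu w hw
      have hur : u ∈ Finset.range v := Finset.mem_range.2 hu
      have hwr : w ∈ Finset.range v := Finset.mem_range.2 hw
      have hwX := hc.tree.sub hwr
      by_cases hr : (treeOf s).root ∈ F
      · exact (hF.leaf w hwr).1 (hF.of_anc hc.tree hwX (hc.tree.reach w hwX) hr)
      · have huX := hc.tree.sub hur
        obtain ⟨q, hq, -⟩ := hF.exists_mixed hc.tree huX (hc.tree.reach u huX) hr
          ((hF.leaf u hur).2 hvu)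
        exact absurd hq (hno q)
    refine .of_wp (?_ : wp W _ _ s) (by simp [block, Program.cost, Expr.cost])
    simp [block, wp, Expr.eval]
    refine ⟨by omega, by split_ifs <;> omega, .setReg (.setReg .refl (by simp)) (by simp),
      .inl ⟨h13, by omega, by omega, ?_⟩⟩
    rw [h1]
    refine PT.IsCotree.attachable_root hc (by split_ifs <;> omega) fun u hu => ?_
    rw [Finset.mem_range] at hu
    by_cases h0 : s.reg 22 = 0
    · simp [h0, h22.1 h0 u hu]
    · have : 0 < s.reg 22 := by omega
      rw [h22] at h0
      push Not at h0
      obtain ⟨w, hw, hvw⟩ := h0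
      simp [this, hall w hw hvw u hu]
  · have hb : s.reg 23 ≠ 0 := Expr.eq_eq_zero.1 hb
    rw [h23] at hb
    replace h24 := h24 (Finset.card_pos.1 (by omega))
    refine (runsWithin_seq (B₁ := 200 * (s.reg 20 + 1)) (B₂ := 200 * (s.reg 20 + 1)
      + (100 * F.card + 500))
      ((pick_spec hm (by omega) h24).mono le_rfl ?_)).mono (by omega) fun _ h => h
    rintro s₁ ⟨hf₁, h24₁, hun⟩
    have hf₁' : Frame [13, 19, 21, 23, 24, 25, 26] [12] s s₁ := hf₁.mono (by simp) (by simp)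
    have hm₁ := hm.of_frame hf₁'
    have hT₁ := treeOf_eq hf₁ (by simp) (by simp)
    have hD := mixedUpTo_frame hf₁' (s.reg 20)
    have r20 := hf₁.1 20 (by simp)
    have hmix := hm.mem_mixed.1 h24₁
    refine runsWithin_seq ((walk_spec hm₁ (by omega) ((hf₁.1 13 (by simp)).trans h13)
      ?_ ?_).mono ?_ ?_)
    · rw [r20, hD, hf₁.1 23 (by simp), h23]
    · rwa [r20, hD]
    · rw [r20]
    · rintro s₂ ⟨hf₂, hcase⟩
      have hf₂' : Frame [13, 19, 21, 23, 24, 25, 26] [12] s s₂ :=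
        hf₁'.trans (hf₂.mono (by simp) (by simp))
      have hm₂ := hm.of_frame hf₂'
      have hT₂ := treeOf_eq hf₂' (by simp) (by simp)
      rw [hT₁] at hcase
      have r24 := hf₂.1 24 (by simp)
      have hff : Frame [1, 2, 13, 15, 18, 19, 21, 24, 25, 26, 27, 28, 29] [2, 3, 6, 7] s s₂ :=
        (hf₁.mono (by simp) (by simp)).trans (hf₂.mono (by simp) (by simp))
      refine (runsWithin_ite (B := 100 * F.card + 450) (fun hb => ?_) fun hb => ?_).mono
        (by simp [Expr.cost]; omega) fun _ h => h
      · have hb : s₂.reg 13 = 0 := Expr.eq_ne_zero.1 hb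
        obtain ⟨-, hok⟩ := hcase.resolve_right (by omega)
        refine (AtSite.site_spec (s := s₂) (F := F) (adj := adj) (n := n) (v := v) (N := N) (m := m)
          (β := s₁.reg 24) ?_).mono (by omega) ?_
        · constructor
          · exact hm₂
          · rw [hT₂]; exact hc
          · rw [hT₂]; exact hF.isSite hc hmix hok.1 hok.2
          · rw [hT₂]; exact hmix
          · rw [hf₂'.1 1 (by simp), h1]
          · exact r24
          · rw [hf₂'.1 17 (by simp), h17]
          · exact hv
          · exact hN
          · exact hNm
          · exact hW
        · rintro s₃ ⟨hf₃, h3, h4, h5⟩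
          refine ⟨hff.trans (hf₃.mono (by simp) (by simp)), .inl ⟨?_, h3, h4, h5⟩⟩
          rw [hf₃.1 13 (by simp), hb]
      · have hb : s₂.reg 13 ≠ 0 := Expr.eq_eq_zero.1 hb
        obtain ⟨h13', hok⟩ := hcase.resolve_left (by omega)
        refine .of_wp (p := .skip) ?_ (by simp [Program.cost])
        -- It remains to see that `PathOK` would hold in the absence of induced paths, contrary to
        -- the outcome of the climb.
        refine ⟨hff, .inr ⟨h13', by rw [hf₂'.1 1 (by simp), h1], fun hP => hok ?_⟩⟩
        have hflag : ∀ x, s.arr 12 (s.reg 12 + x) = 0 ↔ ∀ p,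
            (treeOf s).IsMixed (nodes n v N) (Finset.range v) F p → p ≠ (treeOf s).root →
              (treeOf s).par p ≠ x ∧ (treeOf s).par ((treeOf s).par p) ≠ x := by
          intro x
          have := hfl x
          rw [← not_iff_not, ← ne_eq, this]
          push Not
          simp only [hm.mem_mixed]
          refine exists_congr fun p => and_congr_right fun _ => and_congr_right fun _ => ?_
          rw [or_iff_not_imp_left]
          rfl
        obtain ⟨β, hβ, hβu⟩ := hc.exists_unflagged hsymm hP hF hmix
        exact hc.bottom_of_unflagged hsymm hP hF hmix
          ((hflag _).1 (hun ⟨β, hm.mem_mixed.2 hβ, (hflag β).2 hβu⟩))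

/-- Insert the vertex in register 11 into the tree; register 13 is set to 1 if this fails. -/
def insertVertex : Program :=
  .seq collect (.seq mark (.seq flag (.seq place
    (.ite (.eq (.reg 13) (.lit 0)) attach .skip))))

/-- Reading the list costs `O(l.length + 1)`, and all other stages are linear in the number of
earlier neighbours, plus a constant. At most two nodes are created, one by a split and one by a
subdivision. -/
theorem insertVertex_spec {l : List ℕ} (hsymm : ∀ u w, adj u w → adj w u)
    (hc : (treeOf s).IsCotree (nodes n v N) (Finset.range v) adj)
    (hnd : l.Nodup) (hl : ∀ x ∈ l, x < n) (hadj : ∀ u < v, (adj v u ↔ u ∈ l))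
    (h1 : s.reg 1 = N) (h10 : s.reg 10 = n) (h11 : s.reg 11 = v) (h13 : s.reg 13 = 0)
    (h0 : ∀ j, s.reg 12 ≤ j → s.arr 10 j = 0 ∧ s.arr 11 j = 0 ∧ s.arr 12 j = 0)
    (hend : s.arr 0 (v + 1) = s.arr 0 v + l.length)
    (harr : ∀ i (h : i < l.length), s.arr 1 (s.arr 0 v + i) = l[i])
    (hsize : s.arr 0 (v + 1) ≤ W)
    (hv : v < n) (hN : n ≤ N) (hNm : N + 1 < m) (hW : m * m + 4 * m ≤ W) :
    RunsWithin W insertVertex s (2000 * (l.length + 1)) fun s' =>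
      Frame [1, 2, 13, 15, 16, 17, 18, 19, 20, 21, 22, 23, 24, 25, 26, 27, 28, 29]
          [2, 3, 6, 7, 8, 9, 10, 11, 12] s s' ∧ N ≤ s'.reg 1 ∧ s'.reg 1 ≤ N + 2 ∧
        (∀ j, s.reg 12 + m ≤ j → s'.arr 10 j = 0 ∧ s'.arr 11 j = 0 ∧ s'.arr 12 j = 0) ∧
        (s'.reg 13 = 0 ∧ (treeOf s').IsCotree (nodes n (v + 1) (s'.reg 1)) (Finset.range (v + 1))
          adj ∨
          s'.reg 13 = 1 ∧ ¬ NoP4 adj) := by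
  obtain ⟨S, hS⟩ : ∃ S : Finset ℕ, {u ∈ l.toFinset | u < v} = S := ⟨_, rfl⟩
  have hlt : ∀ x ∈ nodes n v N, x < m := fun x hx => by
    rw [mem_nodes] at hx
    omega
  have hSl : S.card ≤ l.length := by
    rw [← hS]
    exact (Finset.card_filter_le _ _).trans (List.toFinset_card_le _)
  have hSmem : ∀ u, u ∈ S ↔ u ∈ l ∧ u < v := fun u => by simp [← hS]
  have hSV : S ⊆ Finset.range v := fun u hu => Finset.mem_range.2 ((hSmem u).1 hu).2
  refine (runsWithin_seq (B₂ := 1900 * (S.card + 1))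
    ((collect_spec l hnd hl h11 hend harr (by omega) hsize).mono
    le_rfl ?_)).mono (by omega) fun _ h => h
  rw [hS]
  rintro s₁ ⟨hf₁, h8, h17⟩
  have hT₁ := treeOf_eq hf₁ (by simp) (by simp)
  have hc₁ := hc
  rw [← hT₁] at hc₁
  have r12 := hf₁.1 12 (by simp)
  refine (runsWithin_seq (B₂ := 1700 * (S.card + 1)) ((mark_spec hc₁.tree hc₁.reduced hlt (by omega)
    hSV h8 h17
    fun j hj => ?_).mono le_rfl ?_)).mono (by omega) fun _ h => h
  · rw [hf₁.2 10 (by simp), hf₁.2 11 (by simp)]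
    exact ⟨(h0 j (by omega)).1, (h0 j (by omega)).2.1⟩
  rintro s₂ ⟨hI, h19⟩
  have hq := hI.queue_le_two_mul hc₁.reduced
  have hpot := hI.potential
  have hm := hI.marked hc₁.tree hc₁.reduced hlt h19
  have hleaf := hI.leaf
  have hcq := hI.card_queue
  obtain ⟨F, hF⟩ : ∃ F, img (s₂.arr 8) (s₂.reg 17) = F := ⟨_, rfl⟩
  rw [hF] at hm hleaf hcq
  have hf₂ := hI.frame
  have hT₂ := treeOf_eq hf₂ (by simp) (by simp)
  have hc₂ := hc₁
  rw [← hT₂] at hc₂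
  have r12' := (hf₂.1 12 (by simp)).trans r12
  refine (runsWithin_seq (B₂ := 1500 * (S.card + 1)) ((flag_spec hm (by omega)
    fun j hj => ?_).mono le_rfl ?_)).mono
    (by omega) fun _ h => h
  · rw [hf₂.2 12 (by simp), hf₁.2 12 (by simp)]
    exact (h0 j (by omega)).2.2
  rintro s₃ ⟨hf₃, h23, h24, hfl, hz⟩
  have hf₃' : Frame [13, 19, 21, 23, 24, 25, 26] [12] s₂ s₃ := hf₃.mono (by simp) (by simp)
  have hm₃ := hm.of_frame hf₃'
  have hT₃ := treeOf_eq hf₃ (by simp) (by simp)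
  have hD := mixedUpTo_frame hf₃' (s₂.reg 20)
  have hc₃ := hc₂
  rw [← hT₃] at hc₃
  have r20 := hf₃.1 20 (by simp)
  have r17 := hf₃.1 17 (by simp)
  have hall : Frame [15, 16, 17, 18, 19, 20, 21, 22, 23, 24] [8, 9, 10, 11, 12] s s₃ :=
    ((hf₁.mono (by simp) (by simp)).trans (hf₂.mono (by simp) (by simp))).trans
      (hf₃.mono (by simp) (by simp))
  have hfull : (treeOf s₃).IsFull (nodes n v N) (Finset.range v) F adj v := by
    refine ⟨fun u hu => ?_, hm₃.node⟩
    have hu' := Finset.mem_range.1 hu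
    rw [hleaf u hu, hSmem, hadj u hu']
    simp [hu']
  refine (runsWithin_seq (B₂ := 300) ((place_spec hsymm hm₃ hc₃ hfull ?_ ?_ ?_ ?_ ?_ ?_ ?_ hv hN
    (by omega) hW).mono le_rfl ?_)).mono (by omega) fun _ h => h
  · rw [hall.1 1 (by simp), h1]
  · rw [hall.1 13 (by simp), h13]
  · rw [r17, hcq]
  · rw [hf₃.1 22 (by simp), hI.start, Finset.card_eq_zero, Finset.eq_empty_iff_forall_notMem]
    refine ⟨fun h u hu hvu => h u ((hSmem u).2 ⟨(hadj u hu).1 hvu, hu⟩), fun h u hu => ?_⟩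
    obtain ⟨hul, huv⟩ := (hSmem u).1 hu
    exact h u huv ((hadj u huv).2 hul)
  · rw [h23, r20, hD]
  · rw [r20, hD]
    exact h24
  · rw [r20, hD, hf₃.1 12 (by simp), hf₃.1 2 (by simp), hf₃.2 2 (by simp)]
    exact hfl
  rintro s₄ ⟨hf₄, hcase⟩
  have hall₄ : Frame [1, 2, 13, 15, 16, 17, 18, 19, 20, 21, 22, 23, 24, 25, 26, 27, 28, 29]
      [2, 3, 6, 7, 8, 9, 10, 11, 12] s s₄ :=
    (hall.mono (by simp) (by simp)).trans (hf₄.mono (by simp) (by simp))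
  have hz₄ : ∀ j, s.reg 12 + m ≤ j → s₄.arr 10 j = 0 ∧ s₄.arr 11 j = 0 ∧ s₄.arr 12 j = 0 := by
    intro j hj
    rw [hf₄.2 10 (by simp), hf₄.2 11 (by simp), hf₄.2 12 (by simp), hf₃.2 10 (by simp),
      hf₃.2 11 (by simp)]
    have := hI.zero j (by omega)
    exact ⟨this.1, this.2, hz j (by omega)⟩
  refine (runsWithin_ite (B := 250) (fun hb => ?_) fun hb => ?_).mono (by simp [Expr.cost])
    fun _ h => h
  · have hb : s₄.reg 13 = 0 := Expr.eq_ne_zero.1 hb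
    obtain ⟨-, hN₁, hN₂, hatt⟩ := hcase.resolve_right (by omega)
    refine (attach_spec hsymm hatt rfl ?_ ?_ rfl rfl hv (by omega) (by omega) hW).mono (by omega) ?_
    · rw [hall₄.1 10 (by simp), h10]
    · rw [hall₄.1 11 (by simp), h11]
    · rintro s₅ ⟨hf₅, h3, h4, h5⟩
      refine ⟨hall₄.trans (hf₅.mono (by simp) (by simp)), by omega, by omega, ?_, .inl ⟨?_, h5⟩⟩
      · rw [hf₅.2 10 (by simp), hf₅.2 11 (by simp), hf₅.2 12 (by simp)]
        exact hz₄
      · rw [hf₅.1 13 (by simp), hb]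
  · have hb : s₄.reg 13 ≠ 0 := Expr.eq_eq_zero.1 hb
    obtain ⟨h13', h1', hP⟩ := hcase.resolve_left (by omega)
    exact .of_wp (p := .skip) ⟨hall₄, by omega, by omega, hz₄, .inr ⟨h13', hP⟩⟩
      (by simp [Program.cost])

end

end CICograph

namespace CICograph

open Memory Program

/-! ### The construction phase: the whole program -/

/-- The adjacency relation of a graph on `Fin n`, as a relation between natural numbers. -/
def natAdj {n : ℕ} (G : SimpleGraph (Fin n)) (u w : ℕ) : Prop :=
  ∃ (hu : u < n) (hw : w < n), G.Adj ⟨u, hu⟩ ⟨w, hw⟩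

theorem natAdj_symm {n : ℕ} (G : SimpleGraph (Fin n)) (u w : ℕ) (h : natAdj G u w) :
    natAdj G w u := by
  obtain ⟨hu, hw, h⟩ := h
  exact ⟨hw, hu, h.symm⟩

theorem flatten_getElem? {α : Type*} (L : List (List α)) (v i : ℕ) (hv : v < L.length)
    (hi : i < L[v].length) :
    L.flatten[((L.take v).map List.length).sum + i]? = some L[v][i] := by
  induction L generalizing v with
  | nil => simp at hv
  | cons l L ih =>
    cases v with
    | zero =>
      have hi : i < l.length := hi
      simp [List.getElem?_append_left hi]
    | succ v =>
      have := ih v (by simpa using hv) hi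
      simp only [List.take_succ_cons, List.map_cons, List.sum_cons, List.flatten_cons,
        List.getElem_cons_succ]
      rw [add_assoc, List.getElem?_append_right (by omega), Nat.add_sub_cancel_left, this]

section

variable {n : ℕ} {G : SimpleGraph (Fin n)} {adj : Fin n → List (Fin n)}

theorem inputMemory_start (v : Fin n) : (inputMemory n adj).arr 0 (v + 1) =
    (inputMemory n adj).arr 0 v + (adj v).length := by
  have h1 : (v : ℕ) + 1 ≤ n := v.2
  have h2 : (v : ℕ) ≤ n := by omega
  simp only [inputMemory, if_true, h1, h2]
  rw [List.take_add_one, List.getElem?_eq_getElem (by simp)]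
  simp

theorem inputMemory_list (v : Fin n) (i : ℕ) (h : i < (adj v).length) :
    (inputMemory n adj).arr 1 ((inputMemory n adj).arr 0 v + i) = (adj v)[i] := by
  have h2 : (v : ℕ) ≤ n := by omega
  simp only [inputMemory, if_true, h2, one_ne_zero, if_false]
  have := flatten_getElem? (List.ofFn adj) v i (by simp) (by simpa using h)
  rw [List.getD_eq_getElem?_getD, List.getElem?_map, this]
  simp

theorem inputMemory_end (hadj : IsAdjacencyLists G adj) :
    (inputMemory n adj).arr 0 n = 2 * G.edgeSet.ncard := by
  classical
  simp only [inputMemory, if_true, le_refl]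
  rw [List.take_of_length_le (by simp), List.map_ofFn, List.sum_ofFn]
  rw [Set.ncard_eq_toFinset_card', ← SimpleGraph.edgeFinset,
    ← SimpleGraph.sum_degrees_eq_twice_card_edges]
  refine Finset.sum_congr rfl fun v _ => ?_
  rw [Function.comp_apply, ← List.toFinset_card_of_nodup (hadj v).1,
    ← SimpleGraph.card_neighborFinset_eq_degree]
  congr 1
  ext w
  simp [(hadj v).2 w]

theorem inputMemory_mono {v w : ℕ} (h : v ≤ w) (hw : w ≤ n) :
    (inputMemory n adj).arr 0 v ≤ (inputMemory n adj).arr 0 w := by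
  induction w, h using Nat.le_induction with
  | base => exact le_rfl
  | succ w _ ih =>
    refine (ih (by omega)).trans ?_
    rw [inputMemory_start ⟨w, hw⟩]
    exact Nat.le_add_right _ _

/-- Positions in the concatenated adjacency lists are kept in registers, so they have to respect the
word bound. -/
theorem two_mul_edges_le (hadj : IsAdjacencyLists G adj) : 2 * G.edgeSet.ncard ≤ n * n := by
  rw [← inputMemory_end hadj]
  have : ∀ v ≤ n, (inputMemory n adj).arr 0 v ≤ v * n := by
    intro v hv
    induction v with
    | zero => simp [inputMemory]
    | succ v ih =>
      rw [inputMemory_start ⟨v, hv⟩, Nat.succ_mul]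
      have := (hadj ⟨v, hv⟩).1.length_le_card
      rw [Fintype.card_fin] at this
      exact Nat.add_le_add (ih (by omega)) this
  exact this n le_rfl

/-- The construction phase. -/
def build : Program :=
  .seq (block [
    .set 10 (.reg 0),
    .set 1 (.reg 0),
    .set 14 (.add (.reg 0) (.add (.reg 0) (.reg 0))),
    .set 11 (.lit 1)])
  (.seq (.loop (.sub (.lt (.reg 11) (.reg 10)) (.reg 13)) (.seq insertVertex (block [
      .set 11 (.add (.reg 11) (.lit 1)),
      .set 12 (.add (.reg 12) (.reg 14))])))
    (block [.set 0 (.sub (.lit 1) (.reg 13))]))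

/-- The start of the construction: memory filled with zeros already represents the tree whose only
node is the leaf `0`. -/
theorem isCotree_single {T : PT} {adj : ℕ → ℕ → Prop} (n : ℕ) (hr : T.root = 0) (hp : T.par 0 = 0) :
    T.IsCotree (nodes n 1 n) (Finset.range 1) adj := by
  have h : nodes n 1 n = {0} := by
    ext x
    rw [mem_nodes, Finset.mem_singleton]
    omega
  rw [h]
  refine ⟨⟨by simp [hr], fun x hx => ?_, fun x hx hxr => ?_, by simp⟩, fun u hu w hw huw => ?_, ?_⟩
  · rw [Finset.mem_singleton.1 hx, hr]
    exact .refl _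
  · rw [Finset.mem_singleton.1 hx, hr] at hxr
    exact absurd rfl hxr
  · simp at hu hw
    omega
  · constructor
    all_goals first | (intro x hx hxV; simp at hx hxV; omega) | skip
    rw [hr, hp]

/-- The invariant of the main loop, with `k` vertices and edges still to be processed. -/
def BuildInv (G : SimpleGraph (Fin n)) (adj : Fin n → List (Fin n)) (k : ℕ) (s : Memory) : Prop :=
  Frame [1, 2, 10, 11, 12, 13, 14, 15, 16, 17, 18, 19, 20, 21, 22, 23, 24, 25, 26, 27, 28, 29]
      [2, 3, 6, 7, 8, 9, 10, 11, 12] (inputMemory n adj) s ∧ s.reg 10 = n ∧ s.reg 14 = 3 * n ∧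
    (s.reg 13 = 1 ∧ ¬ NoP4 (natAdj G) ∨ s.reg 13 = 0 ∧ ∃ u, u < n ∧ s.reg 11 = u + 1 ∧
      s.reg 12 = 3 * n * u ∧ n ≤ s.reg 1 ∧ s.reg 1 ≤ n + 2 * u ∧
      (∀ j, s.reg 12 ≤ j → s.arr 10 j = 0 ∧ s.arr 11 j = 0 ∧ s.arr 12 j = 0) ∧
      (treeOf s).IsCotree (nodes n (u + 1) (s.reg 1)) (Finset.range (u + 1)) (natAdj G) ∧
      k + (3000 * (inputMemory n adj).arr 0 (u + 1) + 3000 * u) =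
        3000 * (inputMemory n adj).arr 0 n + 3000 * n)

/-- Each entry of an adjacency list and each vertex pays 3000 steps. Two new nodes per insertion
keep all node numbers below `3 * n`, which is therefore also the length of a scratch block. -/
theorem BuildInv.step {W : ℕ} (hadj : IsAdjacencyLists G adj) (hW : 9 * (n * n) + 12 * n ≤ W)
    {k : ℕ} {s : Memory} (h : BuildInv G adj k s)
    (hb : (Expr.sub (.lt (.reg 11) (.reg 10)) (.reg 13)).eval s ≠ 0) :
    ∃ B, RunsWithin W (.seq insertVertex (block [
      .set 11 (.add (.reg 11) (.lit 1)),
      .set 12 (.add (.reg 12) (.reg 14))])) s B fun s' => ∃ k', BuildInv G adj k' s' ∧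
        B + (Expr.sub (.lt (.reg 11) (.reg 10)) (.reg 13)).cost + 1 + k' ≤ k := by
  obtain ⟨hf, h10, h14, hcase⟩ := h
  rcases hcase with ⟨h13, -⟩ | ⟨h13, u, hu, h11, h12, hN, hN', h0, hc, hk⟩
  · exact absurd (by by_cases h : s.reg 11 < s.reg 10 <;> simp [Expr.eval, h, h13]) hb
  have hlt : u + 1 < n := by
    by_contra hge
    have : ¬ s.reg 11 < s.reg 10 := by omega
    simp [Expr.eval, this] at hb
  have hstart := inputMemory_start (adj := adj) ⟨u + 1, hlt⟩
  have hle := inputMemory_mono (adj := adj) (show u + 1 + 1 ≤ n from hlt) le_rfl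
  have hend := inputMemory_end hadj
  have hedges := two_mul_edges_le hadj
  have hsq : 3 * n * (u + 1) ≤ 3 * n * n := Nat.mul_le_mul_left _ hu
  have hsq' : 3 * n * n = 3 * (n * n) := by ring
  have hsq'' : 3 * n * (u + 1) = 3 * n * u + 3 * n := by ring
  have e0 := hf.2 0 (by simp)
  have e1 := hf.2 1 (by simp)
  dsimp only at hstart
  obtain ⟨l, hl⟩ : ∃ l, adj ⟨u + 1, hlt⟩ = l := ⟨_, rfl⟩
  have hlist := inputMemory_list (adj := adj) ⟨u + 1, hlt⟩
  have hadjl := hadj ⟨u + 1, hlt⟩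
  rw [hl] at hstart hlist hadjl
  refine ⟨2000 * (l.length + 1) + 50, runsWithin_seq ((insertVertex_spec (v := u + 1) (m := 3 * n)
    (l := l.map Fin.val) (natAdj_symm G) hc ?_ ?_ ?_ rfl h10 h11 h13 h0 ?_ ?_ ?_ hlt hN (by omega)
    ?_).mono (by simp) ?_)⟩
  · exact hadjl.1.map Fin.val_injective
  · intro x hx
    obtain ⟨y, -, rfl⟩ := List.mem_map.1 hx
    exact y.2
  · intro w hw
    rw [List.mem_map]
    constructor
    · rintro ⟨h1, h2, h3⟩
      exact ⟨⟨w, h2⟩, (hadjl.2 _).2 h3, rfl⟩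
    · rintro ⟨y, hy, rfl⟩
      exact ⟨hlt, y.2, (hadjl.2 _).1 hy⟩
  · rw [e0, List.length_map, hstart]
  · intro i hi
    rw [List.length_map] at hi
    rw [e0, e1, hlist i hi, List.getElem_map]
  · rw [e0]
    omega
  · nlinarith
  · rintro s' ⟨hf', h1, h2, hz, hcase⟩
    refine .of_wp ?_ (by simp [block, Program.cost, Expr.cost])
    have r10 := (hf'.1 10 (by simp)).trans h10
    have r11 := (hf'.1 11 (by simp)).trans h11
    have r12 := (hf'.1 12 (by simp)).trans h12
    have r14 := (hf'.1 14 (by simp)).trans h14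
    simp [block, wp, Expr.eval, r11, r12, r14]
    refine ⟨by omega, by omega, ?_⟩
    have hfr := (hf.trans (hf'.mono (by simp) (by simp))).setReg (i := 11) (v := u + 1 + 1)
      (by simp)
    have hfr := hfr.setReg (i := 12) (v := 3 * n * u + 3 * n) (by simp)
    rcases hcase with ⟨h13', hc'⟩ | ⟨h13', hP⟩
    · refine ⟨k - 3000 * l.length - 3000, ⟨hfr, by simpa, by simpa,
        .inr ⟨by simpa, u + 1, hlt, by simp, ?_, ?_, ?_, ?_, ?_, ?_⟩⟩, ?_⟩
      · simp; ring
      · simp; omega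
      · simp; omega
      · simp
        intro j hj
        exact hz j (by omega)
      · simpa [treeOf] using hc'
      · omega
      · simp [Expr.cost]
        omega
    · refine ⟨0, ⟨hfr, by simpa, by simpa, .inl ⟨by simpa, hP⟩⟩, ?_⟩
      simp [Expr.cost]
      omega

theorem build_spec {W : ℕ} (hadj : IsAdjacencyLists G adj) (hW : 9 * (n * n) + 12 * n ≤ W)
    (hn : 0 < n) :
    RunsWithin W build (inputMemory n adj) (7000 * (n + G.edgeSet.ncard)) fun s =>
      (s.reg 0 = 0 ∧ ¬ NoP4 (natAdj G)) ∨ (s.reg 0 = 1 ∧ s.reg 10 = n ∧ n ≤ s.reg 1 ∧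
        s.reg 1 ≤ 3 * n ∧
        (treeOf s).IsCotree (Finset.range (s.reg 1)) (Finset.range n) (natAdj G)) := by
  have hend := inputMemory_end hadj
  refine (runsWithin_seq (B₁ := 50) (B₂ := 3000 * (inputMemory n adj).arr 0 n + 3000 * n + 50)
    (.of_wp ?_ (by simp [block, Program.cost, Expr.cost]))).mono (by omega) fun _ h => h
  have r0 : (inputMemory n adj).reg 0 = n := rfl
  simp [block, wp, Expr.eval, r0]
  refine ⟨by omega, by omega, by omega, ?_⟩
  -- The vertex `0` is in the tree from the start, so its adjacency list is never read and is not
  -- charged.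
  have hinv : BuildInv G adj (3000 * (inputMemory n adj).arr 0 n + 3000 * n -
      3000 * (inputMemory n adj).arr 0 1)
      (((((inputMemory n adj).setReg 10 n).setReg 1 n).setReg 14 (n + (n + n))).setReg 11 1) := by
    have hle := inputMemory_mono (adj := adj) (show 1 ≤ n from hn) le_rfl
    refine ⟨?_, by simp, by simp; ring, .inr ⟨rfl, 0, hn, by simp, by simp [inputMemory], by simp,
      by simp, ?_, ?_, ?_⟩⟩
    · apply_rules [Frame.setReg, Frame.refl] <;> simp
    · intro j _
      simp [inputMemory]
    · simp only [setReg_reg, zero_add]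
      exact isCotree_single n rfl rfl
    · simp only [zero_add]
      omega
  refine (runsWithin_seq (B₂ := 20) ((runsWithin_loop (BuildInv G adj)
    (fun k s h hb => h.step hadj hW hb) ?_ hinv).mono le_rfl fun _ h => h)).mono
    (by simp [Expr.cost]; omega) fun _ h => h
  rintro k s ⟨hf, h10, h14, hcase⟩ hb
  refine .of_wp ?_ (by simp [Program.cost, Expr.cost])
  simp [wp, Expr.eval, h10]
  refine ⟨by omega, ?_⟩
  rcases hcase with ⟨h13, hP⟩ | ⟨h13, u, hu, h11, h12, hN, hN', h0, hc, hk⟩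
  · exact .inl ⟨by omega, hP⟩
  · have hge : n ≤ u + 1 := by
      by_contra hlt
      have : s.reg 11 < s.reg 10 := by omega
      simp [Expr.eval, this, h13] at hb
    obtain rfl : u + 1 = n := by omega
    refine .inr ⟨by omega, hN, by omega, ?_⟩
    have hr : nodes (u + 1) (u + 1) (s.reg 1) = Finset.range (s.reg 1) := by
      ext x
      rw [mem_nodes, Finset.mem_range]
      omega
    rwa [hr] at hc

end

end CICograph

namespace CICograph

/-! ### Cographs and cotrees -/

theorem isCograph_iff {n : ℕ} (G : SimpleGraph (Fin n)) : IsCograph G ↔ NoP4 (natAdj G) := by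
  have hna : ∀ u v : Fin n, natAdj G u v ↔ G.Adj u v := fun u v =>
    ⟨fun ⟨_, _, h⟩ => h, fun h => ⟨u.2, v.2, h⟩⟩
  constructor
  · intro h a b c d hab hbc hcd hac had hbd
    obtain ⟨a, rfl⟩ : ∃ x : Fin n, (x : ℕ) = a := ⟨⟨a, hab.1⟩, rfl⟩
    obtain ⟨b, rfl⟩ : ∃ x : Fin n, (x : ℕ) = b := ⟨⟨b, hbc.1⟩, rfl⟩
    obtain ⟨c, rfl⟩ : ∃ x : Fin n, (x : ℕ) = c := ⟨⟨c, hcd.1⟩, rfl⟩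
    obtain ⟨d, rfl⟩ : ∃ x : Fin n, (x : ℕ) = d := ⟨⟨d, hcd.2.1⟩, rfl⟩
    rw [hna] at hab hbc hcd hac had hbd
    -- `NoP4` does not require distinct vertices; the pattern of edges and nonedges forces it.
    have h1 : a ≠ c := fun e => had (e ▸ hcd)
    have h2 : a ≠ d := fun e => hac (e ▸ hcd.symm)
    have h3 : b ≠ d := fun e => had (e ▸ hab)
    refine h ⟨⟨⟨![a, b, c, d], ?_⟩, ?_⟩⟩
    · intro i j hij
      fin_cases i <;> fin_cases j <;> simp at hij ⊢ <;>
        simp_all [hcd.ne']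
    · intro i j
      change G.Adj (![a, b, c, d] i) (![a, b, c, d] j) ↔ _
      simp only [SimpleGraph.pathGraph_adj]
      fin_cases i <;> fin_cases j <;>
        simp [hab, hbc, hcd, hac, had, hbd, hab.symm, hbc.symm, hcd.symm, G.adj_comm c a,
          G.adj_comm d a, G.adj_comm d b]
  · rintro h ⟨f⟩
    have key : ∀ i j : Fin 4, natAdj G (f i) (f j) ↔ (i.val + 1 = j.val ∨ j.val + 1 = i.val) := by
      intro i j
      rw [hna, f.map_adj_iff, SimpleGraph.pathGraph_adj]
    refine h (f 0) (f 1) (f 2) (f 3) ?_ ?_ ?_ ?_ ?_ ?_ <;> rw [key] <;> decide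

/-! ### Graphs of cotrees are cographs; the family in terms of the stored tree. -/

namespace PT

variable {T : PT} {X V : Finset ℕ} {adj : ℕ → ℕ → Prop}

/-- The path on four vertices and its complement are both connected. At a node above all four
vertices, nonadjacent pairs (label 1) or adjacent pairs (label 0) lie below a common child, so all
four do. Descending further, this never ends. -/
theorem IsCotree.false_of_path (h : T.IsCotree X V adj) {a b c d : ℕ} (ha : a ∈ V) (hb : b ∈ V)
    (hc : c ∈ V) (hd : d ∈ V) (hab : adj a b) (hbc : adj b c) (hcd : adj c d) (hac : ¬ adj a c)
    (had : ¬ adj a d) (hbd : ¬ adj b d) (hne : a ≠ b) : False := by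
  have key : ∀ x ∈ X, ¬ (T.A x a ∧ T.A x b ∧ T.A x c ∧ T.A x d) := by
    refine h.tree.induction_down fun x hx ih ⟨hxa, hxb, hxc, hxd⟩ => ?_
    have hxV : x ∉ V := fun hxV => hne ((h.tree.anc_leaf (h.tree.sub ha) hxV hxa).symm.trans
      (h.tree.anc_leaf (h.tree.sub hb) hxV hxb))
    have hex : ∀ u ∈ V, T.A x u → ∃ y ∈ T.ch X x, T.A y u := fun u hu hxu =>
      h.tree.exists_child (h.tree.sub hu) hxu fun e => hxV (e ▸ hu)
    obtain ⟨p, hp, hpa⟩ := hex a ha hxa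
    obtain ⟨q, hq, hqb⟩ := hex b hb hxb
    obtain ⟨r, hr, hrc⟩ := hex c hc hxc
    obtain ⟨s, hs, hsd⟩ := hex d hd hxd
    have iff : ∀ {u w y z}, u ∈ V → w ∈ V → y ∈ T.ch X x → z ∈ T.ch X x → T.A y u → T.A z w →
        y ≠ z → (adj u w ↔ T.lab x = 1) := fun hu hw hy hz hyu hzw hyz =>
      h.tree.adj_iff h.meets hu hw hy hz hyz hyu hzw
    have h1 := iff ha hb hp hq hpa hqb
    have h2 := iff hb hc hq hr hqb hrc
    have h3 := iff hc hd hr hs hrc hsd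
    have h4 := iff ha hc hp hr hpa hrc
    have h5 := iff ha hd hp hs hpa hsd
    have h6 := iff hb hd hq hs hqb hsd
    have : p = q ∧ p = r ∧ p = s := by
      by_cases hl : T.lab x = 1
      · simp only [hl, hac, had, hbd, iff_true, imp_false, not_not] at h4 h5 h6
        grind
      · simp only [hl, hab, hbc, hcd, iff_false, imp_false, not_not, not_true] at h1 h2 h3
        grind
    obtain ⟨rfl, rfl, rfl⟩ := this
    exact ih p hp ⟨hpa, hqb, hrc, hsd⟩
  exact key T.root h.tree.root_mem ⟨h.tree.reach _ (h.tree.sub ha), h.tree.reach _ (h.tree.sub hb),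
    h.tree.reach _ (h.tree.sub hc), h.tree.reach _ (h.tree.sub hd)⟩

/-- The conditions on the trees of the family `𝒯_C`. -/
def InFamily (T : PT) (X V : Finset ℕ) : Prop :=
  T.root ∈ V ∨ (T.lab T.root = 1 ∧
    ({x ∈ X | x ∉ V ∧ T.lab x = 0}).card ≤ ({x ∈ V | T.par x = T.root}).card ∧
    ∀ x ∈ X, x ∉ V → T.lab x = 0 → T.nc x = 2 ∧ T.par x = T.root)

end PT

section

variable {T : PT} {n N : ℕ} {G : SimpleGraph (Fin n)}

theorem noP4_of_isCotree (h : T.IsCotree (Finset.range N) (Finset.range n) (natAdj G)) :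
    NoP4 (natAdj G) := by
  intro a b c d hab hbc hcd hac had hbd
  refine h.false_of_path (Finset.mem_range.2 hab.1) (Finset.mem_range.2 hbc.1)
    (Finset.mem_range.2 hcd.1) (Finset.mem_range.2 hcd.2.1) hab hbc hcd hac had hbd ?_
  rintro rfl
  exact hab.2.2.ne rfl

/-! ### From the stored tree to `Cotree`. -/

namespace PT.IsCotree

theorem par_lt (h : T.IsCotree (Finset.range N) (Finset.range n) (natAdj G)) {x : ℕ} (hx : x < N) :
    T.par x < N := by
  by_cases hr : x = T.root
  · rw [hr, h.reduced.par_root]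
    exact Finset.mem_range.1 h.tree.root_mem
  · exact Finset.mem_range.1 (h.tree.par_mem x (Finset.mem_range.2 hx) hr).1

theorem le (h : T.IsCotree (Finset.range N) (Finset.range n) (natAdj G)) : n ≤ N :=
  Finset.range_subset_range.1 h.tree.sub

theorem anc_of_iterate {par : Fin N → Fin N} (hpar : ∀ x, (par x : ℕ) = T.par x)
    (hr : T.par T.root = T.root) {x y : Fin N} {k : ℕ} (h : par^[k] y = x) : T.A x y := by
  induction k generalizing y with
  | zero => exact h ▸ .refl _
  | succ k ih =>
    have := ih (y := par y) h
    rw [hpar] at this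
    by_cases hy : (y : ℕ) = T.root
    · rw [hy, hr] at this
      rwa [hy]
    · exact .up hy this

theorem iterate_of_anc {par : Fin N → Fin N} (hpar : ∀ x, (par x : ℕ) = T.par x) {x w : ℕ}
    (h : T.A x w) : ∀ y : Fin N, (y : ℕ) = w → ∃ k, (par^[k] y : ℕ) = x := by
  induction h with
  | refl => exact fun y hy => ⟨0, hy⟩
  | @up w hw _ ih =>
    rintro y rfl
    obtain ⟨k, hk⟩ := ih (par y) (hpar y)
    exact ⟨k + 1, hk⟩

/-- The cotree stored in memory. -/
def toCotree (h : T.IsCotree (Finset.range N) (Finset.range n) (natAdj G)) :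
    Cotree (Fin n) N where
  root := ⟨T.root, Finset.mem_range.1 h.tree.root_mem⟩
  parent x := ⟨T.par x, h.par_lt x.2⟩
  label x := decide (T.lab x = 1)
  leaf v := Fin.castLE h.le v
  parent_root := Fin.ext h.reduced.par_root
  reaches_root x := by
    obtain ⟨k, hk⟩ := iterate_of_anc (par := fun x : Fin N => ⟨T.par x, h.par_lt x.2⟩)
      (fun _ => rfl) (h.tree.reach x (Finset.mem_range.2 x.2)) x rfl
    exact ⟨k, Fin.ext hk⟩
  leaf_injective := Fin.castLE_injective h.le
  leaf_iff x := by
    constructor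
    · rintro ⟨v, rfl⟩ y ⟨hy, hyv⟩
      have := h.tree.par_mem y (Finset.mem_range.2 y.2) fun e => hy (Fin.ext e)
      have hyv' : T.par y = v := congrArg Fin.val hyv
      rw [hyv'] at this
      exact this.2 (Finset.mem_range.2 v.2)
    · intro hx
      by_contra hv
      have hxV : (x : ℕ) ∉ Finset.range n := fun h' => hv ⟨⟨x, Finset.mem_range.1 h'⟩, rfl⟩
      obtain ⟨c, hc⟩ := PT.IsTree.ch_nonempty h.reduced (Finset.mem_range.2 x.2) hxV
      obtain ⟨h1, h2, h3⟩ := PT.mem_ch.1 hc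
      exact hx ⟨c, Finset.mem_range.1 h1⟩ ⟨fun e => h2 (congrArg Fin.val e), Fin.ext h3⟩
  two_children x hx := by
    have hxV : (x : ℕ) ∉ Finset.range n := fun h' => hx ⟨⟨x, Finset.mem_range.1 h'⟩, rfl⟩
    obtain ⟨c, hc, d, hd, hcd⟩ := Finset.one_lt_card.1
      (h.reduced.two x (Finset.mem_range.2 x.2) hxV)
    obtain ⟨h1, h2, h3⟩ := PT.mem_ch.1 hc
    obtain ⟨h4, h5, h6⟩ := PT.mem_ch.1 hd
    exact ⟨⟨c, Finset.mem_range.1 h1⟩, ⟨d, Finset.mem_range.1 h4⟩,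
      fun e => hcd (congrArg Fin.val e), ⟨fun e => h2 (congrArg Fin.val e), Fin.ext h3⟩,
      ⟨fun e => h5 (congrArg Fin.val e), Fin.ext h6⟩⟩
  alternate y hy hyl := by
    have hyX := Finset.mem_range.2 y.2
    have hyV : (y : ℕ) ∉ Finset.range n := fun h' => hyl ⟨⟨y, Finset.mem_range.1 h'⟩, rfl⟩
    have hyr : (y : ℕ) ≠ T.root := fun e => hy (Fin.ext e)
    have h1 := h.reduced.alt y hyX hyV (by simp) hyr
    have h2 := h.reduced.lab_le y hyX hyV
    have hp := h.tree.par_mem y hyX hyr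
    have h3 := h.reduced.lab_le _ hp.1 hp.2
    intro e
    rw [decide_eq_decide] at e
    dsimp only at e
    omega

variable (h : T.IsCotree (Finset.range N) (Finset.range n) (natAdj G))

theorem isAncestor_iff {x y : Fin N} : h.toCotree.IsAncestor x y ↔ T.A x y := by
  constructor
  · rintro ⟨k, hk⟩
    exact anc_of_iterate (fun _ => rfl) h.reduced.par_root hk
  · intro hxy
    obtain ⟨k, hk⟩ := iterate_of_anc (par := h.toCotree.parent) (fun _ => rfl) hxy y rfl
    exact ⟨k, Fin.ext hk⟩

theorem isLeaf_iff {x : Fin N} : h.toCotree.IsLeaf x ↔ (x : ℕ) ∈ Finset.range n := by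
  rw [Finset.mem_range]
  constructor
  · rintro ⟨v, rfl⟩
    exact v.2
  · exact fun hx => ⟨⟨x, hx⟩, rfl⟩

theorem isChild_iff {x y : Fin N} : h.toCotree.IsChild y x ↔ (y : ℕ) ∈ T.ch (Finset.range N) x := by
  rw [PT.mem_ch, Finset.mem_range]
  exact ⟨fun ⟨h1, h2⟩ => ⟨y.2, fun e => h1 (Fin.ext e), congrArg Fin.val h2⟩,
    fun ⟨_, h1, h2⟩ => ⟨fun e => h1 (congrArg Fin.val e), Fin.ext h2⟩⟩

theorem isOneNode_iff {x : Fin N} :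
    h.toCotree.IsOneNode x ↔ (x : ℕ) ∉ Finset.range n ∧ T.lab x = 1 := by
  rw [Cotree.IsOneNode, h.isLeaf_iff]
  exact and_congr_right fun _ => decide_eq_true_iff

theorem isZeroNode_iff {x : Fin N} :
    h.toCotree.IsZeroNode x ↔ (x : ℕ) ∉ Finset.range n ∧ T.lab x = 0 := by
  rw [Cotree.IsZeroNode, h.isLeaf_iff]
  refine and_congr_right fun hx => decide_eq_false_iff_not.trans ?_
  have := h.reduced.lab_le x (Finset.mem_range.2 x.2) hx
  omega

/-- A fork of two leaves is their lowest common ancestor by `anc_fork`, and lowest common ancestors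
are unique by antisymmetry. -/
theorem toCotree_graph : h.toCotree.graph = G := by
  ext u v
  have hu : (u : ℕ) ∈ Finset.range n := Finset.mem_range.2 u.2
  have hv : (v : ℕ) ∈ Finset.range n := Finset.mem_range.2 v.2
  by_cases huv : u = v
  · subst huv
    simp
  obtain ⟨z, c, d, hcd, hc, hd, hcu, hdv, hadj⟩ := h.meets u hu v hv fun e => huv (Fin.ext e)
  have hz := h.tree.mem_of_ch hc
  have hzN := Finset.mem_range.1 hz.1
  have hG : G.Adj u v ↔ natAdj G u v := ⟨fun h => ⟨u.2, v.2, h⟩, fun ⟨_, _, h⟩ => h⟩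
  have hlca : h.toCotree.IsLCA ⟨z, hzN⟩ (h.toCotree.leaf u) (h.toCotree.leaf v) := by
    simp only [Cotree.IsLCA, h.isAncestor_iff]
    refine ⟨(PT.IsTree.anc_of_ch hc).trans hcu, (PT.IsTree.anc_of_ch hd).trans hdv,
      fun w hwu hwv => ?_⟩
    exact h.tree.anc_fork (h.tree.sub hu) hc hd hcd hcu hdv (h.tree.sub hv) hwu hwv
  rw [hG, hadj]
  constructor
  · rintro ⟨-, w, hw, hone⟩
    have h1 := hlca.2.2 w hw.1 hw.2.1
    have h2 := hw.2.2 _ hlca.1 hlca.2.1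
    rw [h.isAncestor_iff] at h1 h2
    rw [← h.tree.antisymm hz.1 h1 h2]
    exact (h.isOneNode_iff.1 hone).2
  · exact fun hl => ⟨huv, _, hlca, h.isOneNode_iff.2 ⟨hz.2, hl⟩⟩

theorem ncard_eq_card {p : Fin N → Prop} {s : Finset ℕ} (hs : ∀ x ∈ s, x < N)
    (hp : ∀ x : Fin N, p x ↔ (x : ℕ) ∈ s) : {x | p x}.ncard = s.card := by
  rw [← Set.ncard_coe_finset, ← Set.ncard_image_of_injective _ Fin.val_injective]
  congr 1
  ext x
  simp only [Set.mem_image, Set.mem_ofPred_eq, Finset.mem_coe]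
  constructor
  · rintro ⟨y, hy, rfl⟩
    exact (hp y).1 hy
  · exact fun hx => ⟨⟨x, hs x hx⟩, (hp _).2 hx, rfl⟩

/-- By alternation, a 1-node other than the root has only leaves as children exactly if no 0-node is
its child. So, under a 1-root, this condition says that the parent of every 0-node is the root; then
counting the 0-nodes below the root amounts to counting all of them. -/
theorem inTC_iff : h.toCotree.InTC ↔ T.InFamily (Finset.range N) (Finset.range n) := by
  have hroot : ∀ {x}, T.root ∉ Finset.range n → x ∈ Finset.range n → x ≠ T.root := by
    rintro _ h1 h2 rfl
    exact h1 h2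
  have hleaf : T.root ∉ Finset.range n →
      {y | h.toCotree.IsChild y h.toCotree.root ∧ h.toCotree.IsLeaf y}.ncard =
        ({x ∈ Finset.range n | T.par x = T.root}).card := fun hr => by
    refine ncard_eq_card (fun x hx => ?_) fun x => ?_
    · exact (Finset.mem_range.1 (Finset.mem_filter.1 hx).1).trans_le h.le
    · rw [h.isChild_iff, h.isLeaf_iff, PT.mem_ch, Finset.mem_filter]
      exact ⟨fun ⟨⟨_, _, h1⟩, h2⟩ => ⟨h2, h1⟩,
        fun ⟨h1, h2⟩ => ⟨⟨Finset.mem_range.2 x.2, hroot hr h1, h2⟩, h1⟩⟩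
  have hzero : T.lab T.root = 1 →
      (∀ x ∈ Finset.range N, x ∉ Finset.range n → T.lab x = 0 → T.par x = T.root) →
      {y | h.toCotree.IsChild y h.toCotree.root ∧ h.toCotree.IsZeroNode y}.ncard =
        ({x ∈ Finset.range N | x ∉ Finset.range n ∧ T.lab x = 0}).card := fun hl hp => by
    refine ncard_eq_card (fun x hx => Finset.mem_range.1 (Finset.mem_filter.1 hx).1) fun x => ?_
    rw [h.isChild_iff, h.isZeroNode_iff, PT.mem_ch, Finset.mem_filter]
    refine ⟨fun ⟨⟨h1, _, _⟩, h2⟩ => ⟨h1, h2⟩, fun ⟨h1, h2⟩ => ⟨⟨h1, ?_, hp x h1 h2.1 h2.2⟩, h2⟩⟩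
    intro e
    rw [e, hl] at h2
    exact one_ne_zero h2.2
  have hch : ∀ x : Fin N, {y | h.toCotree.IsChild y x}.ncard = (T.ch (Finset.range N) x).card :=
    fun x => ncard_eq_card (fun y hy => Finset.mem_range.1 (PT.mem_ch.1 hy).1)
      fun y => h.isChild_iff
  rw [Cotree.InTC, PT.InFamily, h.isLeaf_iff, h.isOneNode_iff]
  refine or_congr_right' fun hr => ?_
  change T.root ∉ Finset.range n at hr
  rw [hleaf hr]
  constructor
  · rintro ⟨⟨-, hl⟩, h1, h2, h3⟩
    have hp : ∀ x ∈ Finset.range N, x ∉ Finset.range n → T.lab x = 0 → T.par x = T.root := by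
      intro x hx hxV hx0
      by_contra hne
      have hxr : x ≠ T.root := by
        rintro rfl
        rw [show T.lab T.root = 1 from hl] at hx0
        exact one_ne_zero hx0
      have hp := h.tree.par_mem x hx hxr
      have halt := h.reduced.alt x hx hxV (by simp) hxr
      have hle := h.reduced.lab_le _ hp.1 hp.2
      have := h3 ⟨T.par x, Finset.mem_range.1 hp.1⟩ (h.isOneNode_iff.2 ⟨hp.2, by dsimp only; omega⟩)
        (fun e => hne (congrArg Fin.val e)) ⟨x, Finset.mem_range.1 hx⟩
        (h.isChild_iff.2 (PT.mem_ch.2 ⟨hx, hxr, rfl⟩))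
      exact hxV (h.isLeaf_iff.1 this)
    rw [hzero hl hp] at h1
    refine ⟨hl, h1, fun x hx hxV hx0 => ⟨?_, hp x hx hxV hx0⟩⟩
    rw [h.reduced.nc_eq x hx hxV, ← hch ⟨x, Finset.mem_range.1 hx⟩]
    exact h2 _ (h.isZeroNode_iff.2 ⟨hxV, hx0⟩)
  · rintro ⟨hl, h1, h2⟩
    refine ⟨⟨hr, hl⟩, ?_, fun x hx => ?_, fun x hx hxr y hy => ?_⟩
    · rwa [hzero hl fun x hx hxV hx0 => (h2 x hx hxV hx0).2]
    · rw [h.isZeroNode_iff] at hx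
      have hxX := Finset.mem_range.2 x.2
      rw [hch, ← h.reduced.nc_eq x hxX hx.1]
      exact (h2 x hxX hx.1 hx.2).1
    · rw [h.isLeaf_iff]
      by_contra hyV
      rw [h.isChild_iff, PT.mem_ch] at hy
      rw [h.isOneNode_iff] at hx
      have halt := h.reduced.alt y hy.1 hyV (by simp) hy.2.1
      rw [hy.2.2, hx.2] at halt
      have hle := h.reduced.lab_le _ hy.1 hyV
      have := (h2 y hy.1 hyV (by omega)).2
      rw [hy.2.2] at this
      exact hxr (Fin.ext this)

end PT.IsCotree

end

end CICograph

namespace CICograph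

/-! ### Every C-I cograph has its cotree in the family -/

section

variable {V : Type*} [P : PartialOrder V]

theorem not_adj_iff {u v : V} (huv : u ≠ v) : ¬ (coverIncompGraph P).Adj u v ↔
    (∃ t, u < t ∧ t < v) ∨ ∃ t, v < t ∧ t < u := by
  have h1 : ∀ {u v : V}, u < v → (¬ u ⋖ v ↔ ∃ t, u < t ∧ t < v) := fun h => by
    simp [CovBy, h]
  change ¬ (u ⋖ v ∨ v ⋖ u ∨ (¬ u ≤ v ∧ ¬ v ≤ u)) ↔ _
  constructor
  · intro h
    push Not at h
    obtain ⟨h2, h3, h4⟩ := h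
    by_cases h5 : u ≤ v
    · exact .inl ((h1 (lt_of_le_of_ne h5 huv)).1 h2)
    · exact .inr ((h1 (lt_of_le_of_ne (h4 h5) huv.symm)).1 h3)
  · rintro (⟨t, h2, h3⟩ | ⟨t, h2, h3⟩) (h | h | h)
    · exact h.2 h2 h3
    · exact (h2.trans h3).asymm h.lt
    · exact h.1 (h2.trans h3).le
    · exact (h2.trans h3).asymm h.lt
    · exact h.2 h2 h3
    · exact h.2 (h2.trans h3).le

theorem not_adj_of_lt {u t v : V} (h1 : u < t) (h2 : t < v) : ¬ (coverIncompGraph P).Adj u v :=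
  (not_adj_iff (h1.trans h2).ne).2 (.inl ⟨t, h1, h2⟩)

/-- The order of a C-I cograph has no chains of four elements. -/
theorem no_chain [Finite V] (hP : ∀ a b c d : V, (coverIncompGraph P).Adj a b →
    (coverIncompGraph P).Adj b c → (coverIncompGraph P).Adj c d → ¬ (coverIncompGraph P).Adj a c →
    ¬ (coverIncompGraph P).Adj a d → ¬ (coverIncompGraph P).Adj b d → False)
    {a b c d : V} (hab : a < b) (hbc : b < c) (hcd : c < d) : False := by
  -- Finiteness provides covers `a' ⋖ b ⋖ c' ⋖ d'`. Consecutive elements are adjacent, all other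
  -- pairs have an element strictly between, so this is an induced path.
  obtain ⟨a', -, ha⟩ := exists_le_covBy_of_lt hab
  obtain ⟨c', hc, hcc⟩ := exists_covBy_le_of_lt hbc
  obtain ⟨d', hd, -⟩ := exists_covBy_le_of_lt (hcc.trans_lt hcd)
  exact hP a' b c' d' (.inl ha) (.inl hc) (.inl hd) (not_adj_of_lt ha.lt hc.lt)
    (not_adj_of_lt ha.lt (hc.lt.trans hd.lt)) (not_adj_of_lt hc.lt hd.lt)

/-- A nonneighbour of `t` is separated from `t` by a further element above or below, which extends
`u < t` or `t < v` to a chain of four. -/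
theorem adj_of_between (hP : ∀ {a b c d : V}, a < b → b < c → c < d → False) {u t v : V}
    (h1 : u < t) (h2 : t < v) {x : V} (hx : t ≠ x) : (coverIncompGraph P).Adj t x := by
  by_contra h
  rcases (not_adj_iff hx).1 h with ⟨y, h3, h4⟩ | ⟨y, h3, h4⟩
  · exact hP h1 h3 h4
  · exact hP h3 h4 h2

/-- Pairwise nonadjacent elements form a chain, with a further element inside each of its two steps:
this is one element too many. -/
theorem no_triangle (hP : ∀ {a b c d : V}, a < b → b < c → c < d → False) {u v w : V}
    (huv : u ≠ v) (hvw : v ≠ w) (huw : u ≠ w) (h1 : ¬ (coverIncompGraph P).Adj u v)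
    (h2 : ¬ (coverIncompGraph P).Adj v w) (h3 : ¬ (coverIncompGraph P).Adj u w) : False := by
  rcases (not_adj_iff huv).1 h1 with ⟨x, hx, hx'⟩ | ⟨x, hx, hx'⟩ <;>
  rcases (not_adj_iff hvw).1 h2 with ⟨y, hy, hy'⟩ | ⟨y, hy, hy'⟩
  · exact hP hx hx' hy
  · rcases (not_adj_iff huw).1 h3 with ⟨z, hz, hz'⟩ | ⟨z, hz, hz'⟩
    · exact hP hz hz' hy
    · exact hP hz hz' hx
  · rcases (not_adj_iff huw).1 h3 with ⟨z, hz, hz'⟩ | ⟨z, hz, hz'⟩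
    · exact hP hx hx' hz
    · exact hP hy hy' hz
  · exact hP hy hy' hx

end

/-! ### Universal vertices and the shape of the cotree. -/

namespace PT.IsCotree

variable {T : PT} {X V : Finset ℕ} {adj : ℕ → ℕ → Prop}

theorem exists_separated (h : T.IsCotree X V adj) {z c d : ℕ} (hc : c ∈ T.ch X z)
    (hd : d ∈ T.ch X z) (hcd : c ≠ d) {u w : ℕ} (hu : u ∈ V) (hw : w ∈ V) (hcu : T.A c u)
    (hdw : T.A d w) : u ≠ w ∧ (adj u w ↔ T.lab z = 1) :=
  ⟨fun e => hcd (h.tree.sibling_eq_of_anc hc hd hcu (e ▸ hdw)),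
    h.tree.adj_iff h.meets hu hw hc hd hcd hcu hdw⟩

/-- A proper ancestor `z` of `t` has a second child, and a leaf below that child meets `t` in `z`.
-/
theorem lab_of_universal (h : T.IsCotree X V adj) {t z : ℕ} (ht : t ∈ V)
    (hu : ∀ x ∈ V, t ≠ x → adj t x) (hz : T.A z t) (hzt : z ≠ t) : T.lab z = 1 := by
  obtain ⟨c, hc, hct⟩ := h.tree.exists_child (h.tree.sub ht) hz hzt
  obtain ⟨hzX, hzV⟩ := h.tree.mem_of_ch hc
  obtain ⟨d, hd, hdc⟩ := PT.IsTree.exists_other_child h.reduced hzX hzV c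
  obtain ⟨x, hx, hdx⟩ := h.tree.exists_leaf h.reduced d (PT.mem_ch.1 hd).1
  obtain ⟨h1, h2⟩ := h.exists_separated hc hd hdc.symm ht hx hct hdx
  exact h2.1 (hu x hx h1)

/-- All proper ancestors of a universal leaf are 1-nodes, and alternation leaves room for only one
of them. -/
theorem par_of_universal (h : T.IsCotree X V adj) (hr : T.root ∉ V) {t : ℕ} (ht : t ∈ V)
    (hu : ∀ x ∈ V, t ≠ x → adj t x) : T.par t = T.root := by
  have htX := h.tree.sub ht
  have htr : t ≠ T.root := fun e => hr (e ▸ ht)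
  by_contra hp
  obtain ⟨hpX, hpV⟩ := h.tree.par_mem t htX htr
  have hq := h.tree.par_mem _ hpX hp
  have h1 := h.lab_of_universal ht hu (.up htr (.refl _)) fun e => hpV (e.symm ▸ ht)
  have h2 := h.lab_of_universal ht hu (.up htr (.up hp (.refl _))) fun e => hq.2 (e.symm ▸ ht)
  exact h.reduced.alt _ hpX hpV (by simp) hp (h1.trans h2.symm)

/-- Of the order, only three facts are used: there are no three pairwise nonadjacent vertices
(`h3`), every nonadjacent pair has a universal vertex strictly between (`hR`), and conversely a
vertex strictly between makes a pair nonadjacent (`hR'`). -/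
theorem inFamily_of_order (h : T.IsCotree X V adj) (R : ℕ → ℕ → Prop)
    (h3 : ∀ u ∈ V, ∀ v ∈ V, ∀ w ∈ V, u ≠ v → v ≠ w → u ≠ w → ¬ adj u v → ¬ adj v w → adj u w)
    (hR : ∀ u ∈ V, ∀ v ∈ V, u ≠ v → ¬ adj u v →
      ∃ t ∈ V, (∀ x ∈ V, t ≠ x → adj t x) ∧ (R u t ∧ R t v ∨ R v t ∧ R t u))
    (hR' : ∀ u t v, R u t → R t v → ¬ adj u v) : T.InFamily X V := by
  by_cases hr : T.root ∈ V
  · exact .inl hr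
  have hleaf : ∀ {z c}, c ∈ T.ch X z → ∃ u ∈ V, T.A c u := fun hc =>
    h.tree.exists_leaf h.reduced _ (PT.mem_ch.1 hc).1
  have hpair : ∀ {z}, z ∈ X → z ∉ V → T.lab z ≠ 1 → ∃ u ∈ V, ∃ w ∈ V, u ≠ w ∧ ¬ adj u w ∧
      T.A z u ∧ T.A z w := by
    intro z hz hzV hl
    obtain ⟨c, hc, d, hd, hcd⟩ := Finset.one_lt_card.1 (h.reduced.two z hz hzV)
    obtain ⟨u, hu, hcu⟩ := hleaf hc
    obtain ⟨w, hw, hdw⟩ := hleaf hd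
    obtain ⟨h1, h2⟩ := h.exists_separated hc hd hcd hu hw hcu hdw
    exact ⟨u, hu, w, hw, h1, fun e => hl (h2.1 e), (PT.IsTree.anc_of_ch hc).trans hcu,
      (PT.IsTree.anc_of_ch hd).trans hdw⟩
  have hroot : T.lab T.root = 1 := by
    by_contra hl
    obtain ⟨u, hu, w, hw, huw, hadj, -, -⟩ := hpair h.tree.root_mem hr hl
    obtain ⟨t, ht, huniv, -⟩ := hR u hu w hw huw hadj
    exact hl (h.lab_of_universal ht huniv (h.tree.reach t (h.tree.sub ht)) fun e => hr (e ▸ ht))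
  have hpar : ∀ x ∈ X, x ∉ V → T.lab x = 0 → x ≠ T.root ∧ T.par x = T.root := by
    intro x hx hxV hx0
    have hxr : x ≠ T.root := by
      rintro rfl
      rw [hroot] at hx0
      exact one_ne_zero hx0
    refine ⟨hxr, ?_⟩
    by_contra hp
    obtain ⟨hpX, hpV⟩ := h.tree.par_mem x hx hxr
    obtain ⟨hqX, hqV⟩ := h.tree.par_mem _ hpX hp
    have halt := h.reduced.alt x hx hxV (by simp) hxr
    have halt' := h.reduced.alt _ hpX hpV (by simp) hp
    have hle := h.reduced.lab_le _ hpX hpV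
    have hpq : T.par x ∈ T.ch X (T.par (T.par x)) := PT.mem_ch.2 ⟨hpX, hp, rfl⟩
    obtain ⟨d, hd, hdp⟩ := PT.IsTree.exists_other_child h.reduced hqX hqV (T.par x)
    obtain ⟨s, hs, hds⟩ := hleaf hd
    obtain ⟨u, hu, w, hw, huw, hadj, hxu, hxw⟩ := hpair hx hxV (by omega)
    have hpx : T.A (T.par x) x := .up hxr (.refl _)
    obtain ⟨h4, h5⟩ := h.exists_separated hpq hd hdp.symm hu hs (hpx.trans hxu) hds
    obtain ⟨h6, h7⟩ := h.exists_separated hpq hd hdp.symm hw hs (hpx.trans hxw) hds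
    -- If `T.par x` is not the root, it is a 1-node below a 0-node. A leaf `s` below a sibling of
    -- `T.par x` is then nonadjacent to the nonadjacent pair `u`, `w` below `x`.
    have := h3 u hu w hw s hs huw h6 h4 hadj (fun e => by have := h7.1 e; omega)
    have := h5.1 this
    omega
  refine .inr ⟨hroot, ?_, fun x hx hxV hx0 => ⟨?_, (hpar x hx hxV hx0).2⟩⟩
  · have hex : ∀ x, x ∈ ({x ∈ X | x ∉ V ∧ T.lab x = 0}) → ∃ t, t ∈ ({x ∈ V | T.par x = T.root}) ∧
        ∃ u ∈ V, ∃ w ∈ V, T.A x u ∧ T.A x w ∧ R u t ∧ R t w := by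
      intro x hx
      rw [Finset.mem_filter] at hx
      obtain ⟨u, hu, w, hw, huw, hadj, hxu, hxw⟩ := hpair hx.1 hx.2.1 (by omega)
      obtain ⟨t, ht, huniv, hcase⟩ := hR u hu w hw huw hadj
      refine ⟨t, Finset.mem_filter.2 ⟨ht, h.par_of_universal hr ht huniv⟩, ?_⟩
      rcases hcase with ⟨h1, h2⟩ | ⟨h1, h2⟩
      · exact ⟨u, hu, w, hw, hxu, hxw, h1, h2⟩
      · exact ⟨w, hw, u, hu, hxw, hxu, h1, h2⟩
    choose! f hf hf' using hex
    -- The universal vertex chosen for a 0-node lies between two leaves below that node. If `x` and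
    -- `y` shared it, a leaf below `x` and one below `y` would be nonadjacent, although they meet in
    -- the root.
    refine Finset.card_le_card_of_injOn f hf fun x hx y hy hxy => ?_
    by_contra hne
    obtain ⟨u, hu, -, -, hxu, -, h4, -⟩ := hf' x hx
    obtain ⟨-, -, w, hw, -, hyw, -, h5⟩ := hf' y hy
    rw [← hxy] at h5
    rw [Finset.mem_coe, Finset.mem_filter] at hx hy
    have hx' := hpar x hx.1 hx.2.1 hx.2.2
    have hy' := hpar y hy.1 hy.2.1 hy.2.2
    exact hR' u _ w h4 h5 ((h.exists_separated (PT.mem_ch.2 ⟨hx.1, hx'⟩) (PT.mem_ch.2 ⟨hy.1, hy'⟩)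
      hne hu hw hxu hyw).2.2 hroot)
  · rw [h.reduced.nc_eq x hx hxV]
    refine le_antisymm ?_ (h.reduced.two x hx hxV)
    by_contra hlt
    rw [not_le, Finset.two_lt_card] at hlt
    obtain ⟨a, ha, b, hb, c, hc, hab, hac, hbc⟩ := hlt
    obtain ⟨u, hu, hau⟩ := hleaf ha
    obtain ⟨v, hv, hbv⟩ := hleaf hb
    obtain ⟨w, hw, hcw⟩ := hleaf hc
    obtain ⟨h4, h5⟩ := h.exists_separated ha hb hab hu hv hau hbv
    obtain ⟨h6, h7⟩ := h.exists_separated hb hc hbc hv hw hbv hcw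
    obtain ⟨h8, h9⟩ := h.exists_separated ha hc hac hu hw hau hcw
    rw [hx0] at h5 h7 h9
    have := h9.1 (h3 u hu v hv w hw h4 h6 h8 (fun e => by simpa using h5.1 e)
      fun e => by simpa using h7.1 e)
    simp at this

theorem inFamily_of_isCIGraph {n N : ℕ} {G : SimpleGraph (Fin n)}
    (h : T.IsCotree (Finset.range N) (Finset.range n) (natAdj G)) (hG : IsCIGraph G) :
    T.InFamily (Finset.range N) (Finset.range n) := by
  obtain ⟨P, rfl⟩ := hG
  have hna : ∀ u v : Fin n, natAdj (coverIncompGraph P) u v ↔ (coverIncompGraph P).Adj u v :=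
    fun u v => ⟨fun ⟨_, _, h⟩ => h, fun h => ⟨u.2, v.2, h⟩⟩
  have hP4 := noP4_of_isCotree h
  have hch : ∀ {a b c d : Fin n}, P.lt a b → P.lt b c → P.lt c d → False :=
    fun hab hbc hcd => no_chain (P := P) (fun a b c d => by
      simp only [← hna]
      exact hP4 a b c d) hab hbc hcd
  have hlift : ∀ x ∈ Finset.range n, ∃ y : Fin n, (y : ℕ) = x := fun x hx =>
    ⟨⟨x, Finset.mem_range.1 hx⟩, rfl⟩
  refine h.inFamily_of_order (fun a b => ∃ u v : Fin n, (u : ℕ) = a ∧ (v : ℕ) = b ∧ P.lt u v)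
    ?_ ?_ ?_
  · intro u hu v hv w hw huv hvw huw h1 h2
    obtain ⟨u, rfl⟩ := hlift u hu
    obtain ⟨v, rfl⟩ := hlift v hv
    obtain ⟨w, rfl⟩ := hlift w hw
    rw [hna] at h1 h2 ⊢
    by_contra h3
    exact no_triangle (P := P) hch (fun e => huv (congrArg Fin.val e))
      (fun e => hvw (congrArg Fin.val e))
      (fun e => huw (congrArg Fin.val e)) h1 h2 h3
  · intro u hu v hv huv h1
    obtain ⟨u, rfl⟩ := hlift u hu
    obtain ⟨v, rfl⟩ := hlift v hv
    rw [hna, not_adj_iff fun e => huv (congrArg Fin.val e)] at h1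
    rcases h1 with ⟨t, h2, h3⟩ | ⟨t, h2, h3⟩
    · refine ⟨t, Finset.mem_range.2 t.2, fun x hx htx => ?_, .inl ⟨⟨u, t, rfl, rfl, h2⟩,
        ⟨t, v, rfl, rfl, h3⟩⟩⟩
      obtain ⟨x, rfl⟩ := hlift x hx
      rw [hna]
      exact adj_of_between hch h2 h3 fun e => htx (congrArg Fin.val e)
    · refine ⟨t, Finset.mem_range.2 t.2, fun x hx htx => ?_, .inr ⟨⟨v, t, rfl, rfl, h2⟩,
        ⟨t, u, rfl, rfl, h3⟩⟩⟩
      obtain ⟨x, rfl⟩ := hlift x hx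
      rw [hna]
      exact adj_of_between hch h2 h3 fun e => htx (congrArg Fin.val e)
  · rintro _ _ _ ⟨u, t, rfl, rfl, h1⟩ ⟨t', v, e, rfl, h2⟩
    obtain rfl := Fin.ext e
    rw [hna]
    exact not_adj_of_lt h1 h2

end PT.IsCotree

end CICograph

namespace CICograph

/-! ### Sums of completely ranked posets -/

section

variable {V ι : Type*} {κ : V → ι} {ρ : V → ℕ}

/-- The sum of completely ranked posets with summands given by `κ` and ranks given by `ρ`. -/
def rankedSum (κ : V → ι) (ρ : V → ℕ) : PartialOrder V where
  le u v := u = v ∨ κ u = κ v ∧ ρ u < ρ v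
  le_refl _ := .inl rfl
  le_trans u v w := by
    rintro (rfl | ⟨h1, h2⟩) (rfl | ⟨h3, h4⟩)
    · exact .inl rfl
    · exact .inr ⟨h3, h4⟩
    · exact .inr ⟨h1, h2⟩
    · exact .inr ⟨h1.trans h3, h2.trans h4⟩
  le_antisymm u v := by
    rintro (rfl | ⟨_, h2⟩) (h | ⟨_, h4⟩)
    · rfl
    · rfl
    · exact h.symm
    · omega

theorem rankedSum_lt {u v : V} : (rankedSum κ ρ).lt u v ↔ κ u = κ v ∧ ρ u < ρ v := by
  let := rankedSum κ ρ
  change u < v ↔ _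
  rw [lt_iff_le_and_ne]
  constructor
  · rintro ⟨rfl | h, h2⟩
    · exact absurd rfl h2
    · exact h
  · rintro ⟨h1, h2⟩
    exact ⟨.inr ⟨h1, h2⟩, fun e => by simp [e] at h2⟩

/-- As no summand misses a rank, an element fits between any two whose ranks differ by two. The
alternative with all ranks `0` is the antichain that represents a complete graph. -/
theorem rankedSum_covBy (hρ : ∀ v, ρ v ≤ 2)
    (hκ : (∀ v, ρ v = 0) ∨ ∀ i, ∀ j ≤ 2, ∃ v, κ v = i ∧ ρ v = j) {u v : V} :
    @CovBy V (rankedSum κ ρ).toLT u v ↔ κ u = κ v ∧ ρ v = ρ u + 1 := by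
  let := rankedSum κ ρ
  have hlt : ∀ {u v : V}, u < v ↔ κ u = κ v ∧ ρ u < ρ v := rankedSum_lt
  change u ⋖ v ↔ _
  constructor
  · rintro ⟨h1, h2⟩
    rw [hlt] at h1
    refine ⟨h1.1, ?_⟩
    by_contra hne
    rcases hκ with h0 | hall
    · have := h0 u
      have := h0 v
      omega
    · have := hρ v
      obtain ⟨w, hw, hw'⟩ := hall (κ u) (ρ u + 1) (by omega)
      exact h2 (hlt.2 ⟨hw.symm, by omega⟩) (hlt.2 ⟨hw.trans h1.1, by omega⟩)
  · rintro ⟨h1, h2⟩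
    refine ⟨hlt.2 ⟨h1, by omega⟩, fun w h3 h4 => ?_⟩
    rw [hlt] at h3 h4
    omega

theorem coverIncompGraph_rankedSum (hρ : ∀ v, ρ v ≤ 2)
    (hκ : (∀ v, ρ v = 0) ∨ ∀ i, ∀ j ≤ 2, ∃ v, κ v = i ∧ ρ v = j) {u v : V} (huv : u ≠ v) :
    (coverIncompGraph (rankedSum κ ρ)).Adj u v ↔
      ¬ (κ u = κ v ∧ (ρ u + 2 = ρ v ∨ ρ v + 2 = ρ u)) := by
  have hle : ∀ {u v : V}, (rankedSum κ ρ).le u v ↔ u = v ∨ κ u = κ v ∧ ρ u < ρ v := Iff.rfl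
  change (@CovBy V (rankedSum κ ρ).toLT u v ∨ @CovBy V (rankedSum κ ρ).toLT v u ∨
    (¬ (rankedSum κ ρ).le u v ∧ ¬ (rankedSum κ ρ).le v u)) ↔ _
  rw [rankedSum_covBy hρ hκ, rankedSum_covBy hρ hκ, hle, hle]
  have h1 := hρ u
  have h2 := hρ v
  simp only [huv, huv.symm, false_or]
  by_cases h : κ u = κ v
  · simp only [h, true_and]
    omega
  · simp [h, Ne.symm h]

theorem isCompletelyRanked_of_lt (P : PartialOrder V) (hlt : ∀ {a b}, P.lt a b ↔ ρ a < ρ b)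
    (h0 : ∀ a, 0 < ρ a → ∃ w, ρ w = 0) (h1 : ∀ a b, ρ a + 1 < ρ b → ∃ w, ρ w = ρ a + 1) :
    IsCompletelyRanked P fun v => (ρ v : ℤ) := by
  have hcov : ∀ {a b : V}, a ⋖ b ↔ ρ b = ρ a + 1 := by
    intro a b
    constructor
    · rintro ⟨h2, h3⟩
      have h2' := hlt.1 h2
      by_contra hne
      obtain ⟨w, hw⟩ := h1 a b (by omega)
      exact h3 (hlt.2 (by omega : ρ a < ρ w)) (hlt.2 (by omega))
    · intro h2
      refine ⟨hlt.2 (by omega), fun w h3 h4 => ?_⟩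
      have h3' := hlt.1 h3
      have h4' := hlt.1 h4
      omega
  refine ⟨⟨fun v hv => ?_, fun a b hab => ?_⟩, fun a b hab => ?_⟩
  · change (ρ v : ℤ) = 0
    by_contra hne
    obtain ⟨w, hw⟩ := h0 v (by omega)
    exact hv.not_lt (hlt.2 (by omega : ρ w < ρ v))
  · change (ρ b : ℤ) = ρ a + 1
    rw [hcov.1 hab]
    push_cast
    ring
  · change (ρ a : ℤ) = ρ b - 1 at hab
    exact hcov.2 (by omega)

/-- The clause on exact rank holds because ranks that are all `0` make every pair adjacent by `hG`,
so that `G = ⊤`. -/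
theorem storesPoset_rankedSum {n r : ℕ} {s : Memory} {G : SimpleGraph (Fin n)} {κ : Fin n → Fin r}
    {ρ : Fin n → ℕ} (hρ : ∀ v, ρ v ≤ 2) (hsurj : Function.Surjective κ)
    (hκ : (∀ v, ρ v = 0) ∨ ∀ i, ∀ j ≤ 2, ∃ v, κ v = i ∧ ρ v = j)
    (hG : ∀ u v, u ≠ v → (G.Adj u v ↔ ¬ (κ u = κ v ∧ (ρ u + 2 = ρ v ∨ ρ v + 2 = ρ u))))
    (h3 : s.reg 3 = r) (h4 : ∀ v : Fin n, s.arr 4 v = κ v) (h5 : ∀ v : Fin n, s.arr 5 v = ρ v) :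
    ∃ P : PartialOrder (Fin n), coverIncompGraph P = G ∧ StoresPoset s P (G ≠ ⊤) := by
  subst h3
  refine ⟨rankedSum κ ρ, ?_, κ, fun i => @PartialOrder.lift _ _ (rankedSum κ ρ) Subtype.val
    Subtype.val_injective, h4, hsurj, fun u v => ?_, fun i => ?_, fun v => ?_, fun hne i => ?_⟩
  · ext u v
    by_cases huv : u = v
    · simp [huv]
    · rw [coverIncompGraph_rankedSum hρ hκ huv, hG u v huv]
  · constructor
    · intro h
      have huv : κ v = κ u := by
        rcases h with rfl | h
        · rfl
        · exact h.1.symm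
      exact ⟨κ u, rfl, huv, h⟩
    · rintro ⟨_, _, _, h⟩
      exact h
  · simp only [h5]
    refine isCompletelyRanked_of_lt (ρ := fun v : {v : Fin n // κ v = i} => ρ v) _
      (fun {a b} => (rankedSum_lt (κ := κ) (ρ := ρ)).trans
        ⟨fun h => h.2, fun h => ⟨a.2.trans b.2.symm, h⟩⟩) (fun a ha => ?_) fun a b hab => ?_
    · rcases hκ with h0 | hall
      · simp [h0] at ha
      · obtain ⟨w, hw, hw'⟩ := hall i 0 (by omega)
        exact ⟨⟨w, hw⟩, hw'⟩
    · rcases hκ with h0 | hall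
      · simp [h0] at hab
      · have := hρ b
        obtain ⟨w, hw, hw'⟩ := hall i (ρ a + 1) (by omega)
        exact ⟨⟨w, hw⟩, hw'⟩
  · rw [h5]
    exact hρ v
  · rcases hκ with h0 | hall
    · refine absurd ?_ hne
      ext u v
      by_cases huv : u = v
      · simp [huv]
      · simp [hG u v huv, h0, huv]
    · obtain ⟨v, hv, hv'⟩ := hall i 2 le_rfl
      exact ⟨v, hv, (h5 v).trans hv'⟩

end

end CICograph

namespace CICograph

open Memory

/-! ### The poset of a cotree in the family -/

namespace PT

variable {T : PT} {n N z : ℕ} {G : SimpleGraph (Fin n)} {idx : ℕ → ℕ} {s : Memory}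

/-- The numbering of the summands and the ranks which the checking phase computes: `z` is the number
of 0-nodes, and `idx` numbers them. -/
structure Ranked (T : PT) (n N z : ℕ) (idx : ℕ → ℕ) (s : Memory) : Prop where
  root_notMem : T.root ∉ Finset.range n
  lab_root : T.lab T.root = 1
  zero : ∀ x ∈ Finset.range N, x ∉ Finset.range n → T.lab x = 0 → T.nc x = 2 ∧ T.par x = T.root
  img : ({x ∈ Finset.range N | x ∉ Finset.range n ∧ T.lab x = 0}).image idx = Finset.range z
  card : ({x ∈ Finset.range N | x ∉ Finset.range n ∧ T.lab x = 0}).card = z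
  root : ∀ v < n, T.par v = T.root → s.arr 4 v < max z 1 ∧ s.arr 5 v = if 0 < z then 1 else 0
  surj : ∀ i < z, ∃ v < n, T.par v = T.root ∧ s.arr 4 v = i
  nonroot : ∀ v < n, T.par v ≠ T.root → ∃ q ∈ Finset.range N, q ∉ Finset.range n ∧ T.lab q = 0 ∧
    ∃ c ∈ T.ch (Finset.range N) q, T.A c v ∧ s.arr 4 v = idx q ∧
      s.arr 5 v = if c + c < T.cs q then 0 else 2
  reg : s.reg 3 = max z 1

/-! ### Reading adjacency off the computed summands and ranks. -/

namespace Ranked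

theorem idx_lt (hr : T.Ranked n N z idx s) {q : ℕ} (hq : q ∈ Finset.range N)
    (hqV : q ∉ Finset.range n) (hl : T.lab q = 0) :
    idx q < z := by
  rw [← Finset.mem_range, ← hr.img]
  exact Finset.mem_image_of_mem _ (Finset.mem_filter.2 ⟨hq, hqV, hl⟩)

theorem idx_inj (hr : T.Ranked n N z idx s) {q q' : ℕ} (hq : q ∈ Finset.range N)
    (hqV : q ∉ Finset.range n) (hl : T.lab q = 0)
    (hq' : q' ∈ Finset.range N) (hqV' : q' ∉ Finset.range n) (hl' : T.lab q' = 0)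
    (e : idx q = idx q') : q = q' := by
  have hinj : Set.InjOn idx ({x ∈ Finset.range N | x ∉ Finset.range n ∧ T.lab x = 0} : Finset ℕ) :=
    by
    rw [← Finset.card_image_iff, hr.img, hr.card, Finset.card_range]
  exact hinj (Finset.mem_coe.2 (Finset.mem_filter.2 ⟨hq, hqV, hl⟩))
    (Finset.mem_coe.2 (Finset.mem_filter.2 ⟨hq', hqV', hl'⟩)) e

theorem mem_ch (hr : T.Ranked n N z idx s) {q : ℕ} (hq : q ∈ Finset.range N)
    (hqV : q ∉ Finset.range n) (hl : T.lab q = 0) :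
    q ∈ T.ch (Finset.range N) T.root := by
  refine PT.mem_ch.2 ⟨hq, ?_, (hr.zero q hq hqV hl).2⟩
  rintro rfl
  rw [hr.lab_root] at hl
  exact one_ne_zero hl

/-- The two children of a 0-node. -/
theorem exists_children (hr : T.Ranked n N z idx s)
    (h : T.IsCotree (Finset.range N) (Finset.range n) (natAdj G)) {q : ℕ} (hq : q ∈ Finset.range N)
      (hqV : q ∉ Finset.range n)
    (hl : T.lab q = 0) : ∃ a b, a < b ∧ T.ch (Finset.range N) q = {a, b} ∧ a + a < T.cs q ∧
      ¬ b + b < T.cs q := by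
  have h2 := (hr.zero q hq hqV hl).1
  rw [h.reduced.nc_eq q hq hqV, Finset.card_eq_two] at h2
  obtain ⟨a, b, hab, he⟩ := h2
  have hcs := h.reduced.cs_eq q hq hqV
  rw [he, Finset.sum_pair hab] at hcs
  rcases lt_or_gt_of_ne hab with h3 | h3
  · exact ⟨a, b, h3, he, by omega, by omega⟩
  · exact ⟨b, a, h3, by rw [he, Finset.pair_comm], by omega, by omega⟩

/-- `nonroot` only provides some 0-node and some child of it. Both are determined by `v`: all
0-nodes are siblings below the root, and siblings have no common descendants. -/
theorem below (hr : T.Ranked n N z idx s)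
    (h : T.IsCotree (Finset.range N) (Finset.range n) (natAdj G))
      {q c v : ℕ} (hq : q ∈ Finset.range N) (hqV : q ∉ Finset.range n) (hl : T.lab q = 0)
    (hc : c ∈ T.ch (Finset.range N) q) (hcv : T.A c v) (hv : v < n) :
    T.par v ≠ T.root ∧ s.arr 4 v = idx q ∧ s.arr 5 v = if c + c < T.cs q then 0 else 2 := by
  have hqr := hr.mem_ch hq hqV hl
  have hvV := Finset.mem_range.2 hv
  have hpar : T.par v ≠ T.root := by
    intro e
    have hvr : v ≠ T.root := fun e => hr.root_notMem (e ▸ hvV)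
    have := h.tree.sibling_eq hqr (PT.mem_ch.2 ⟨h.tree.sub hvV, hvr, e⟩)
      ((PT.IsTree.anc_of_ch hc).trans hcv)
    exact hqV (this ▸ hvV)
  obtain ⟨q', hq', hqV', hl', c', hc', hcv', h4, h5⟩ := hr.nonroot v hv hpar
  obtain rfl := h.tree.sibling_eq_of_anc hqr (hr.mem_ch hq' hqV' hl')
    ((PT.IsTree.anc_of_ch hc).trans hcv) ((PT.IsTree.anc_of_ch hc').trans hcv')
  obtain rfl := h.tree.sibling_eq_of_anc hc hc' hcv hcv'
  exact ⟨hpar, h4, h5⟩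

/-- Ranks 0 and 2 come from leaves below the two children of the 0-node, and rank 1 from a leaf
child of the root; that there are enough of these is the counting condition of the family. -/
theorem exists_rank (hr : T.Ranked n N z idx s)
    (h : T.IsCotree (Finset.range N) (Finset.range n) (natAdj G)) {i j : ℕ} (hi : i < z)
      (hj : j ≤ 2) : ∃ v < n, s.arr 4 v = i ∧ s.arr 5 v = j := by
  have hi' := hi
  rw [← Finset.mem_range, ← hr.img, Finset.mem_image] at hi'
  obtain ⟨q, hqf, hqi⟩ := hi'
  obtain ⟨hq, hqV, hl⟩ := Finset.mem_filter.1 hqf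
  obtain ⟨a, b, hab, he, ha, hb⟩ := hr.exists_children h hq hqV hl
  have hach : a ∈ T.ch (Finset.range N) q := by simp [he]
  have hbch : b ∈ T.ch (Finset.range N) q := by simp [he]
  obtain rfl | rfl | rfl : j = 0 ∨ j = 1 ∨ j = 2 := by omega
  · obtain ⟨v, hv, hav⟩ := h.tree.exists_leaf h.reduced a (PT.mem_ch.1 hach).1
    have := hr.below h hq hqV hl hach hav (Finset.mem_range.1 hv)
    rw [if_pos ha] at this
    exact ⟨v, Finset.mem_range.1 hv, this.2.1.trans hqi, this.2.2⟩
  · obtain ⟨v, hv, hvr, hv4⟩ := hr.surj i hi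
    have := (hr.root v hv hvr).2
    rw [if_pos (by omega)] at this
    exact ⟨v, hv, hv4, this⟩
  · obtain ⟨v, hv, hbv⟩ := h.tree.exists_leaf h.reduced b (PT.mem_ch.1 hbch).1
    have := hr.below h hq hqV hl hbch hbv (Finset.mem_range.1 hv)
    rw [if_neg hb] at this
    exact ⟨v, Finset.mem_range.1 hv, this.2.1.trans hqi, this.2.2⟩

theorem adj_of_root (hr : T.Ranked n N z idx s)
    (h : T.IsCotree (Finset.range N) (Finset.range n) (natAdj G)) {u v : ℕ} (hu : u < n)
      (hv : v < n) (huv : u ≠ v) (hur : T.par u = T.root) :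
    natAdj G u v := by
  have huV := Finset.mem_range.2 hu
  have hvV := Finset.mem_range.2 hv
  have huc : u ∈ T.ch (Finset.range N) T.root :=
    PT.mem_ch.2 ⟨h.tree.sub huV, fun e => hr.root_notMem (e ▸ huV), hur⟩
  obtain ⟨d, hd, hdv⟩ := h.tree.exists_child (h.tree.sub hvV) (h.tree.reach v (h.tree.sub hvV))
    fun e => hr.root_notMem (e ▸ hvV)
  refine (h.exists_separated huc hd ?_ huV hvV (.refl _) hdv).2.2 hr.lab_root
  rintro rfl
  exact huv (h.tree.anc_leaf (h.tree.sub hvV) huV hdv)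

/-- Two leaves are nonadjacent exactly if they lie below different children of the same 0-node, and
just these have equal summands and ranks 0 and 2. A leaf child of the root is universal, and its
rank never differs by two from another. Leaves below different 0-nodes meet in the root and have
different summands. Leaves below one child of a 0-node are adjacent and have equal ranks. -/
theorem adj_iff_ranks (hr : T.Ranked n N z idx s)
    (h : T.IsCotree (Finset.range N) (Finset.range n) (natAdj G)) {u v : ℕ} (hu : u < n)
      (hv : v < n) (huv : u ≠ v) : natAdj G u v ↔
    ¬ (s.arr 4 u = s.arr 4 v ∧ (s.arr 5 u + 2 = s.arr 5 v ∨ s.arr 5 v + 2 = s.arr 5 u)) := by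
  have huV := Finset.mem_range.2 hu
  have hvV := Finset.mem_range.2 hv
  have hz : ∀ {w}, w < n → T.par w ≠ T.root → 0 < z := fun hw hwr => by
    obtain ⟨q, hq, hqV, hl, -⟩ := hr.nonroot _ hw hwr
    exact Nat.zero_lt_of_lt (hr.idx_lt hq hqV hl)
  have h5 : ∀ {w}, w < n → T.par w ≠ T.root → s.arr 5 w = 0 ∨ s.arr 5 w = 2 := fun hw hwr => by
    obtain ⟨q, hq, hqV, hl, c, hc, hcv, -, h5⟩ := hr.nonroot _ hw hwr
    rw [h5]
    split_ifs <;> simp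
  by_cases hur : T.par u = T.root
  · have h1 := (hr.root u hu hur).2
    refine iff_of_true (hr.adj_of_root h hu hv huv hur) fun ⟨_, h2⟩ => ?_
    by_cases hvr : T.par v = T.root
    · have := (hr.root v hv hvr).2
      omega
    · rw [if_pos (hz hv hvr)] at h1
      have := h5 hv hvr
      omega
  · by_cases hvr : T.par v = T.root
    · have h1 := (hr.root v hv hvr).2
      refine iff_of_true (natAdj_symm G _ _ (hr.adj_of_root h hv hu huv.symm hvr)) fun ⟨_, h2⟩ => ?_
      rw [if_pos (hz hu hur)] at h1
      have := h5 hu hur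
      omega
    · obtain ⟨q, hq, hqV, hl, c, hc, hcu, hu4, hu5⟩ := hr.nonroot u hu hur
      obtain ⟨q', hq', hqV', hl', c', hc', hcv, hv4, hv5⟩ := hr.nonroot v hv hvr
      by_cases hqq : q = q'
      · subst hqq
        by_cases hcc : c = c'
        · subst hcc
          refine iff_of_true ?_ fun ⟨_, h2⟩ => by omega
          have hcX := (PT.mem_ch.1 hc).1
          have hcr := (PT.mem_ch.1 hc).2.1
          have hcV : c ∉ Finset.range n := fun hcV => huv
            ((h.tree.anc_leaf (h.tree.sub huV) hcV hcu).symm.trans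
              (h.tree.anc_leaf (h.tree.sub hvV) hcV hcv))
          have halt := h.reduced.alt c hcX hcV (by simp) hcr
          rw [(PT.mem_ch.1 hc).2.2, hl] at halt
          have hcl := h.reduced.lab_le c hcX hcV
          -- The 1-node `c` has only leaves as children: an internal child would be a 0-node, hence
          -- a child of the root.
          have hleaf : ∀ {w}, w ∈ Finset.range n → T.A c w → w ∈ T.ch (Finset.range N) c := by
            intro w hw hcw
            obtain ⟨d, hd, hdw⟩ := h.tree.exists_child (h.tree.sub hw) hcw fun e => hcV (e ▸ hw)
            by_cases hdV : d ∈ Finset.range n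
            · rwa [← h.tree.anc_leaf (h.tree.sub hw) hdV hdw]
            · obtain ⟨h6, h7, h8⟩ := PT.mem_ch.1 hd
              have halt' := h.reduced.alt d h6 hdV (by simp) h7
              have hdl := h.reduced.lab_le d h6 hdV
              rw [h8] at halt'
              have := (hr.zero d h6 hdV (by omega)).2
              exact absurd (h8.symm.trans this) hcr
          exact (h.exists_separated (hleaf huV hcu) (hleaf hvV hcv) huv huV hvV (.refl _)
            (.refl _)).2.2 (by omega)
        · have hnadj := (h.exists_separated hc hc' hcc huV hvV hcu hcv).2
          rw [hl] at hnadj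
          refine iff_of_false (fun e => by simpa using hnadj.1 e) (not_not.2 ⟨hu4.trans hv4.symm,
            ?_⟩)
          obtain ⟨a, b, hab, he, ha, hb⟩ := hr.exists_children h hq hqV hl
          rw [he, Finset.mem_insert, Finset.mem_singleton] at hc hc'
          rw [hu5, hv5]
          rcases hc with rfl | rfl <;> rcases hc' with rfl | rfl
          · exact absurd rfl hcc
          · simp [ha, hb]
          · simp [ha, hb]
          · exact absurd rfl hcc
      · refine iff_of_true ?_ fun ⟨h2, _⟩ => hqq (hr.idx_inj hq hqV hl hq' hqV' hl' ?_)
        · exact (h.exists_separated (hr.mem_ch hq hqV hl) (hr.mem_ch hq' hqV' hl') hqq huV hvV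
            ((PT.IsTree.anc_of_ch hc).trans hcu) ((PT.IsTree.anc_of_ch hc').trans hcv)).2.2
              hr.lab_root
        · rw [← hu4, ← hv4, h2]

theorem exists_poset (hr : T.Ranked n N z idx s)
    (h : T.IsCotree (Finset.range N) (Finset.range n) (natAdj G)) (hn : 0 < n) :
    ∃ P : PartialOrder (Fin n), coverIncompGraph P = G ∧ StoresPoset s P (G ≠ ⊤) := by
  have hlt : ∀ v < n, s.arr 4 v < max z 1 := by
    intro v hv
    by_cases hvr : T.par v = T.root
    · exact (hr.root v hv hvr).1
    · obtain ⟨q, hq, hqV, hl, -, -, -, h4, -⟩ := hr.nonroot v hv hvr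
      rw [h4]
      exact (hr.idx_lt hq hqV hl).trans_le (le_max_left _ _)
  have hz0 : z = 0 → ∀ v < n, s.arr 5 v = 0 := by
    rintro hz v hv
    by_cases hvr : T.par v = T.root
    · have := (hr.root v hv hvr).2
      rwa [if_neg (by omega)] at this
    · obtain ⟨q, hq, hqV, hl, -⟩ := hr.nonroot v hv hvr
      have := hr.idx_lt hq hqV hl
      omega
  refine storesPoset_rankedSum (κ := fun v => ⟨s.arr 4 v, hlt v v.2⟩) (ρ := fun v => s.arr 5 v)
    (fun v => ?_) (fun i => ?_) ?_ (fun u v huv => ?_) hr.reg (fun v => rfl) fun v => rfl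
  · by_cases hvr : T.par v = T.root
    · rw [(hr.root v v.2 hvr).2]
      split_ifs <;> omega
    · obtain ⟨_, _, _, _, _, _, _, _, h5⟩ := hr.nonroot v v.2 hvr
      rw [h5]
      split_ifs <;> omega
  · by_cases hi : (i : ℕ) < z
    · obtain ⟨v, hv, h4, -⟩ := hr.exists_rank h hi (Nat.zero_le 2)
      exact ⟨⟨v, hv⟩, Fin.ext h4⟩
    -- Here `z = 0`, and `max z 1` leaves only the summand `0`.
    · have := i.2
      have h1 := hlt 0 hn
      exact ⟨⟨0, hn⟩, Fin.ext (by dsimp only; omega)⟩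
  · by_cases hz : z = 0
    · exact .inl fun v => hz0 hz v v.2
    · refine .inr fun i j hj => ?_
      have := i.2
      obtain ⟨v, hv, h4, h5⟩ := hr.exists_rank h (show (i : ℕ) < z by omega) hj
      exact ⟨⟨v, hv⟩, Fin.ext h4, h5⟩
  · have hna : natAdj G u v ↔ G.Adj u v := ⟨fun ⟨_, _, h⟩ => h, fun h => ⟨u.2, v.2, h⟩⟩
    rw [← hna, hr.adj_iff_ranks h u.2 v.2 fun e => huv (Fin.ext e)]
    simp

end Ranked

end PT

end CICograph

namespace CICograph

open Memory Program

/-! ### The checking phase -/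

/-- Number the 0-nodes; register 13 is set to 1 if one of them has not exactly two children, or is
not a child of the root. -/
def scan : Program :=
  .seq (block [.set 13 (.lit 0), .set 17 (.lit 0), .set 15 (.reg 10)])
    (.loop (.lt (.reg 15) (.reg 1)) (block [
      .ite (.eq (.read 3 (.reg 15)) (.lit 0))
        (.ite (.eq (.read 6 (.reg 15)) (.lit 2))
          (.ite (.eq (.read 2 (.reg 15)) (.reg 2)) (block [
            .write 13 (.reg 15) (.reg 17),
            .set 17 (.add (.reg 17) (.lit 1))]) (.set 13 (.lit 1)))
          (.set 13 (.lit 1))) .skip,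
      .set 15 (.add (.reg 15) (.lit 1))]))

/-- Compute the summand and the rank of every vertex; register 18 counts the children of the root
which are leaves. -/
def emit : Program :=
  .seq (block [.set 18 (.lit 0), .set 15 (.lit 0)])
    (.loop (.lt (.reg 15) (.reg 10)) (block [
      .set 21 (.read 2 (.reg 15)),
      .ite (.eq (.reg 21) (.reg 2)) (block [
        .ite (.lt (.reg 18) (.reg 17)) (.write 4 (.reg 15) (.reg 18)) (.write 4 (.reg 15) (.lit 0)),
        .write 5 (.reg 15) (.lt (.lit 0) (.reg 17)),
        .set 18 (.add (.reg 18) (.lit 1))]) (block [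
        .set 16 (.reg 15),
        .ite (.eq (.read 3 (.reg 21)) (.lit 0)) .skip (block [
          .set 16 (.reg 21),
          .set 21 (.read 2 (.reg 21))]),
        .write 4 (.reg 15) (.read 13 (.reg 21)),
        .ite (.lt (.add (.reg 16) (.reg 16)) (.read 7 (.reg 21)))
          (.write 5 (.reg 15) (.lit 0)) (.write 5 (.reg 15) (.lit 2))]),
      .set 15 (.add (.reg 15) (.lit 1))]))

/-- The checking phase. -/
def check : Program :=
  .ite (.lt (.reg 2) (.reg 10))
    (block [
      .set 3 (.lit 1), .write 4 (.lit 0) (.lit 0), .write 5 (.lit 0) (.lit 0), .set 0 (.lit 2)])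
    (.ite (.eq (.read 3 (.reg 2)) (.lit 1))
      (.seq scan (.ite (.reg 13) (.set 0 (.lit 1))
        (.seq emit (.ite (.lt (.reg 18) (.reg 17)) (.set 0 (.lit 1)) (block [
          .set 0 (.lit 2),
          .ite (.eq (.reg 17) (.lit 0)) (.set 3 (.lit 1)) (.set 3 (.reg 17))])))))
      (.set 0 (.lit 1)))

/-- The 0-nodes smaller than `k`. -/
def zeroNodes (T : PT) (n k : ℕ) : Finset ℕ :=
  {x ∈ Finset.range k | x ∉ Finset.range n ∧ T.lab x = 0}

theorem zeroNodes_succ (T : PT) (n k : ℕ) : zeroNodes T n (k + 1) =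
    if k ∉ Finset.range n ∧ T.lab k = 0 then insert k (zeroNodes T n k) else zeroNodes T n k := by
  rw [zeroNodes, Finset.range_add_one, Finset.filter_insert]
  rfl

theorem mem_zeroNodes {T : PT} {n k x : ℕ} :
    x ∈ zeroNodes T n k ↔ x < k ∧ n ≤ x ∧ T.lab x = 0 := by
  simp [zeroNodes]

section

variable {W n N : ℕ} {s : Memory} {G : SimpleGraph (Fin n)}

theorem scan_spec (h1 : s.reg 1 = N) (h10 : s.reg 10 = n) (hN : n ≤ N) (hW : N + 2 ≤ W) :
    RunsWithin W scan s (100 * (N + 1)) fun s' => Frame [13, 15, 17] [13] s s' ∧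
      (s'.reg 13 = 0 ∧ (∀ x ∈ zeroNodes (treeOf s) n N, s.arr 6 x = 2 ∧ s.arr 2 x = s.reg 2) ∧
          (zeroNodes (treeOf s) n N).image (s'.arr 13) = Finset.range (s'.reg 17) ∧
          (zeroNodes (treeOf s) n N).card = s'.reg 17 ∨
        s'.reg 13 ≠ 0 ∧ ¬ ∀ x ∈ zeroNodes (treeOf s) n N, s.arr 6 x = 2 ∧ s.arr 2 x = s.reg 2) := by
  refine (runsWithin_init_loop (fun k s' => Frame [13, 15, 17] [13] s s' ∧
    k + s'.reg 15 = N ∧ n ≤ s'.reg 15 ∧ s'.reg 17 ≤ s'.reg 15 ∧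
      (s'.reg 13 = 0 ∧
          (∀ x ∈ zeroNodes (treeOf s) n (s'.reg 15), s.arr 6 x = 2 ∧ s.arr 2 x = s.reg 2) ∧
          (zeroNodes (treeOf s) n (s'.reg 15)).image (s'.arr 13) = Finset.range (s'.reg 17) ∧
          (zeroNodes (treeOf s) n (s'.reg 15)).card = s'.reg 17 ∨
        s'.reg 13 ≠ 0 ∧
          ∃ x ∈ zeroNodes (treeOf s) n N, ¬ (s.arr 6 x = 2 ∧ s.arr 2 x = s.reg 2))) (N - n)
    ?_ ?_ ?_).mono ?_ fun _ h => h
  · have : zeroNodes (treeOf s) n n = ∅ := by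
      ext x
      simp [mem_zeroNodes]
      omega
    simp [block, wp, Expr.eval, h10, this]
    refine ⟨by omega, ?_, by omega⟩
    apply_rules [Frame.setReg, Frame.refl] <;> simp
  · rintro k s' ⟨hf, hk, hn, h17, hcase⟩ hb
    have r1 := (hf.1 1 (by simp)).trans h1
    have r2 := hf.1 2 (by simp)
    have a2 := hf.2 2 (by simp)
    have a3 := hf.2 3 (by simp)
    have a6 := hf.2 6 (by simp)
    have hlt : s'.reg 15 < N := r1 ▸ Expr.lt_ne_zero.1 hb
    obtain ⟨x, hx⟩ : ∃ x, s'.reg 15 = x := ⟨_, rfl⟩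
    rw [hx] at hcase hlt hn hk h17
    have hsucc := zeroNodes_succ (treeOf s) n x
    have hxn : x ∉ Finset.range n := by simpa using hn
    have hxZ : x ∉ zeroNodes (treeOf s) n x := by simp [mem_zeroNodes]
    have hbad : s.arr 3 x = 0 → ¬ (s.arr 6 x = 2 ∧ s.arr 2 x = s.reg 2) →
        ∃ x ∈ zeroNodes (treeOf s) n N, ¬ (s.arr 6 x = 2 ∧ s.arr 2 x = s.reg 2) := fun h3 h4 =>
      ⟨x, mem_zeroNodes.2 ⟨hlt, hn, h3⟩, h4⟩
    by_cases h0 : s.arr 3 x = 0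
    · rw [if_pos ⟨hxn, h0⟩] at hsucc
      by_cases h6 : s.arr 6 x = 2
      · by_cases hp : s.arr 2 x = s.reg 2
        · simp [block, wp, Expr.eval, r2, a2, a3, a6, hx, h0, h6, hp]
          refine ⟨by omega, by omega, by omega, k - 1, by omega, ?_, by omega, by omega, by omega,
            ?_⟩
          · apply_rules [Frame.setReg, Frame.setArr] <;> simp
          · rcases hcase with ⟨h3, h4, h5, h7⟩ | h3
            · refine .inl ⟨h3, ?_, ?_, ?_⟩
              · rw [hsucc]
                intro y hy
                rcases Finset.mem_insert.1 hy with rfl | hy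
                · exact ⟨h6, hp⟩
                · exact h4 y hy
              · rw [hsucc, Finset.image_insert, Function.update_self, Finset.range_add_one, ← h5]
                congr 1
                refine Finset.image_congr fun y hy => Function.update_of_ne ?_ _ _
                rintro rfl
                exact hxZ (Finset.mem_coe.1 hy)
              · rw [hsucc, Finset.card_insert_of_notMem hxZ, h7]
            · refine .inr ⟨h3.1, ?_⟩
              simpa using h3.2
        · simp [block, wp, Expr.eval, r2, a2, a3, a6, hx, h0, h6, hp]
          refine ⟨by omega, by omega, k - 1, by omega, ?_, by omega, by omega, by omega, ?_⟩
          · apply_rules [Frame.setReg, Frame.setArr] <;> simp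
          · simpa using hbad h0 (by simp [hp])
      · simp [block, wp, Expr.eval, r2, a2, a3, a6, hx, h0, h6]
        refine ⟨by omega, by omega, k - 1, by omega, ?_, by omega, by omega, by omega, ?_⟩
        · apply_rules [Frame.setReg, Frame.setArr] <;> simp
        · simpa using hbad h0 (by simp [h6])
    · rw [if_neg fun e => h0 e.2] at hsucc
      simp [block, wp, Expr.eval, a3, hx, h0, hsucc]
      refine ⟨by omega, k - 1, by omega, ?_, by omega, by omega, by omega, ?_⟩
      · apply_rules [Frame.setReg, Frame.setArr] <;> simp
      · simpa using hcase
  · rintro k s' ⟨hf, hk, hn, h17, hcase⟩ hb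
    have r1 := (hf.1 1 (by simp)).trans h1
    have hge : N ≤ s'.reg 15 := r1 ▸ Expr.lt_eq_zero.1 hb
    have e : s'.reg 15 = N := by omega
    rw [e] at hcase
    refine ⟨hf, hcase.imp id fun h => ⟨h.1, fun hall => ?_⟩⟩
    obtain ⟨x, hx, hx'⟩ := h.2
    exact hx' (hall x hx)
  · simp [block, Program.cost, Expr.cost]
    omega

/-- The result of the computation of the summands and ranks for the vertices smaller than `v`. -/
structure Emitted (T : PT) (n N z : ℕ) (idx : ℕ → ℕ) (v : ℕ) (s : Memory) : Prop where
  count : s.reg 18 = ({x ∈ Finset.range v | T.par x = T.root}).card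
  root : ∀ u < v, T.par u = T.root → s.arr 4 u < max z 1 ∧ s.arr 5 u = if 0 < z then 1 else 0
  surj : ∀ i < z, i < s.reg 18 → ∃ u < v, T.par u = T.root ∧ s.arr 4 u = i
  nonroot : ∀ u < v, T.par u ≠ T.root → ∃ q ∈ Finset.range N, q ∉ Finset.range n ∧ T.lab q = 0 ∧
    ∃ c ∈ T.ch (Finset.range N) q, T.A c u ∧ s.arr 4 u = idx q ∧
      s.arr 5 u = if c + c < T.cs q then 0 else 2

/-- A leaf whose parent is not the root has a 0-node as parent or as grandparent. Of the two
children of that 0-node, the smaller is recognized by comparing its double with their sum. -/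
theorem emit_spec {z : ℕ} {idx : ℕ → ℕ}
    (h : (treeOf s).IsCotree (Finset.range N) (Finset.range n) (natAdj G))
    (hr : (treeOf s).root ∉ Finset.range n)
    (hidx : ∀ x ∈ zeroNodes (treeOf s) n N, idx x < z) (h13 : s.arr 13 = idx) (h17 : s.reg 17 = z)
    (h10 : s.reg 10 = n) (hz : z ≤ N) (hW : N + 2 ≤ W) :
    RunsWithin W emit s (200 * (n + 1)) fun s' => Frame [15, 16, 18, 21] [4, 5] s s' ∧
      Emitted (treeOf s) n N z idx n s' := by
  have hN := h.le
  refine (runsWithin_init_loop (fun k s' => Frame [15, 16, 18, 21] [4, 5] s s' ∧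
    k + s'.reg 15 = n ∧ Emitted (treeOf s) n N z idx (s'.reg 15) s') n
    ?_ ?_ ?_).mono ?_ fun _ h => h
  · simp [block, wp, Expr.eval]
    refine ⟨?_, ?_⟩
    · apply_rules [Frame.setReg, Frame.refl] <;> simp
    · constructor <;> simp
  · rintro k s' ⟨hf, hk, hE⟩ hb
    have r2 := hf.1 2 (by simp)
    have r10 := (hf.1 10 (by simp)).trans h10
    have r17 := (hf.1 17 (by simp)).trans h17
    have a2 := hf.2 2 (by simp)
    have a3 := hf.2 3 (by simp)
    have a7 := hf.2 7 (by simp)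
    have a13 := (hf.2 13 (by simp)).trans h13
    have hlt : s'.reg 15 < n := r10 ▸ Expr.lt_ne_zero.1 hb
    obtain ⟨v, hv⟩ : ∃ v, s'.reg 15 = v := ⟨_, rfl⟩
    rw [hv] at hE hlt hk
    have hvV : v ∈ Finset.range n := Finset.mem_range.2 hlt
    have hvX := h.tree.sub hvV
    have hvr : v ≠ s.reg 2 := by
      rintro rfl
      exact hr hvV
    have hroot : s.reg 2 < N := Finset.mem_range.1 h.tree.root_mem
    have h18 : s'.reg 18 ≤ v := by
      rw [hE.count]
      exact (Finset.card_filter_le _ _).trans (by simp)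
    have hfilter := Finset.filter_insert (fun x => (treeOf s).par x = (treeOf s).root) v
      (Finset.range v)
    rw [← Finset.range_add_one] at hfilter
    by_cases hp : s.arr 2 v = s.reg 2
    · have hcount : ∀ t : Memory, t.reg 18 = s'.reg 18 + 1 →
          t.reg 18 = ({x ∈ Finset.range (v + 1) | (treeOf s).par x = (treeOf s).root}).card := by
        intro t ht
        rw [hfilter, if_pos (show (treeOf s).par v = (treeOf s).root from hp),
          Finset.card_insert_of_notMem (by simp), ht, hE.count]
      have hemit : ∀ t : Memory, t.reg 18 = s'.reg 18 + 1 →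
          t.arr 4 = Function.update (s'.arr 4) v (if s'.reg 18 < z then s'.reg 18 else 0) →
          t.arr 5 = Function.update (s'.arr 5) v (if 0 < z then 1 else 0) →
          Emitted (treeOf s) n N z idx (v + 1) t := by
        intro t ht h4 h5
        refine ⟨hcount t ht, fun u hu hur => ?_, fun i hi hi' => ?_, fun u hu hur => ?_⟩
        · rw [h4, h5]
          by_cases huv : u = v
          · rw [huv, Function.update_self, Function.update_self]
            exact ⟨by split_ifs <;> omega, rfl⟩
          · rw [Function.update_of_ne huv, Function.update_of_ne huv]
            exact hE.root u (by omega) hur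
        · rw [h4]
          by_cases hi'' : i < s'.reg 18
          · obtain ⟨u, hu, hur, hu4⟩ := hE.surj i hi hi''
            exact ⟨u, by omega, hur, by rw [Function.update_of_ne (by omega), hu4]⟩
          · refine ⟨v, by omega, hp, ?_⟩
            -- The leaf children of the root are numbered consecutively, so the vertex with number
            -- `i` is the current one.
            rw [Function.update_self, if_pos (by omega)]
            omega
        · have huv : u ≠ v := by
            rintro rfl
            exact hur hp
          rw [h4, h5, Function.update_of_ne huv, Function.update_of_ne huv]
          exact hE.nonroot u (by omega) hur
      simp [block, wp, Expr.eval, r2, r17, a2, hv, hp]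
      refine ⟨by omega, fun h3 => ⟨by omega, by split_ifs <;> omega, by omega, by omega, k - 1,
        by omega, ?_, by omega, hemit _ ?_ ?_ ?_⟩, fun h3 => ⟨by split_ifs <;> omega, by omega,
        by omega, k - 1, by omega, ?_, by omega, hemit _ ?_ ?_ ?_⟩⟩
      · apply_rules [Frame.setReg, Frame.setArr] <;> simp
      · simp
      · simp [h3]
      · simp
      · apply_rules [Frame.setReg, Frame.setArr] <;> simp
      · simp
      · simp [h3.not_gt]
      · simp
    · have hpX := h.tree.par_mem v hvX hvr
      obtain ⟨p, hpp⟩ : ∃ p, s.arr 2 v = p := ⟨_, rfl⟩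
      have hpp' : (treeOf s).par v = p := hpp
      rw [hpp'] at hpX
      rw [hpp] at hp
      have hpN := Finset.mem_range.1 hpX.1
      have hpn : n ≤ p := by simpa using hpX.2
      have hemit : ∀ t : Memory, ∀ q c, t.reg 18 = s'.reg 18 → q ∈ zeroNodes (treeOf s) n N →
          c ∈ (treeOf s).ch (Finset.range N) q → (treeOf s).A c v →
          t.arr 4 = Function.update (s'.arr 4) v (idx q) →
          t.arr 5 = Function.update (s'.arr 5) v (if c + c < (treeOf s).cs q then 0 else 2) →
          Emitted (treeOf s) n N z idx (v + 1) t := by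
        intro t q c ht hq hc hcv h4 h5
        rw [mem_zeroNodes] at hq
        refine ⟨?_, fun u hu hur => ?_, fun i hi hi' => ?_, fun u hu hur => ?_⟩
        · rw [hfilter, if_neg (show ¬ (treeOf s).par v = (treeOf s).root from hpp' ▸ hp), ht,
          hE.count]
        · have huv : u ≠ v := by
            rintro rfl
            exact hp (hpp' ▸ hur)
          rw [h4, h5, Function.update_of_ne huv, Function.update_of_ne huv]
          exact hE.root u (by omega) hur
        · obtain ⟨u, hu, hur, hu4⟩ := hE.surj i hi (ht ▸ hi')
          refine ⟨u, by omega, hur, ?_⟩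
          rw [h4, Function.update_of_ne (by omega), hu4]
        · rw [h4, h5]
          by_cases huv : u = v
          · rw [huv, Function.update_self, Function.update_self]
            exact ⟨q, Finset.mem_range.2 hq.1, by simpa using hq.2.1, hq.2.2, c, hc, hcv, rfl, rfl⟩
          · rw [Function.update_of_ne huv, Function.update_of_ne huv]
            exact hE.nonroot u (by omega) hur
      have hvp : v ∈ (treeOf s).ch (Finset.range N) p := PT.mem_ch.2 ⟨hvX, hvr, hpp'⟩
      by_cases h0 : s.arr 3 p = 0
      · have hpZ : p ∈ zeroNodes (treeOf s) n N := mem_zeroNodes.2 ⟨hpN, hpn, h0⟩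
        have hpz := hidx p hpZ
        have hem := fun t => hemit t p v
        simp [block, wp, Expr.eval, r2, a2, a3, a7, a13, hv, hpp, hp, h0]
        refine ⟨by omega, by omega, by omega, fun h3 => ⟨by omega, k - 1, by omega, ?_, by omega,
          hem _ ?_ hpZ hvp (.refl _) ?_ ?_⟩, fun h3 => ⟨by omega, by omega, k - 1, by omega, ?_,
          by omega, hem _ ?_ hpZ hvp (.refl _) ?_ ?_⟩⟩
        · apply_rules [Frame.setReg, Frame.setArr] <;> simp
        · simp
        · simp
        · simp [treeOf, h3]
        · apply_rules [Frame.setReg, Frame.setArr] <;> simp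
        · simp
        · simp
        · simp [treeOf, h3.not_gt]
      · have hq := h.tree.par_mem p hpX.1 hp
        obtain ⟨q, hqq⟩ : ∃ q, s.arr 2 p = q := ⟨_, rfl⟩
        have hqq' : (treeOf s).par p = q := hqq
        have halt := h.reduced.alt p hpX.1 hpX.2 (by simp) hp
        have hlp := h.reduced.lab_le p hpX.1 hpX.2
        rw [hqq'] at hq halt
        have hlq := h.reduced.lab_le q hq.1 hq.2
        have hqN := Finset.mem_range.1 hq.1
        have h0' : (treeOf s).lab p ≠ 0 := h0
        -- The parent `p` is a 1-node other than the root, so by alternation its parent is a 0-node.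
        have hqZ : q ∈ zeroNodes (treeOf s) n N :=
          mem_zeroNodes.2 ⟨hqN, by simpa using hq.2, by omega⟩
        have hqz := hidx q hqZ
        have hpq : p ∈ (treeOf s).ch (Finset.range N) q := PT.mem_ch.2 ⟨hpX.1, hp, hqq'⟩
        have hpv := PT.IsTree.anc_of_ch hvp
        have hem := fun t => hemit t q p
        simp [block, wp, Expr.eval, r2, a2, a3, a7, a13, hv, hpp, hp, h0, hqq]
        refine ⟨by omega, by omega, by omega, by omega, by omega, fun h3 => ⟨by omega, k - 1,
          by omega, ?_, by omega, hem _ ?_ hqZ hpq hpv ?_ ?_⟩, fun h3 => ⟨by omega, by omega, k - 1,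
          by omega, ?_, by omega, hem _ ?_ hqZ hpq hpv ?_ ?_⟩⟩
        · apply_rules [Frame.setReg, Frame.setArr] <;> simp
        · simp
        · simp
        · simp [treeOf, h3]
        · apply_rules [Frame.setReg, Frame.setArr] <;> simp
        · simp
        · simp
        · simp [treeOf, h3.not_gt]
  · rintro k s' ⟨hf, hk, hE⟩ hb
    have r10 := (hf.1 10 (by simp)).trans h10
    have hge : n ≤ s'.reg 15 := r10 ▸ Expr.lt_eq_zero.1 hb
    have e : s'.reg 15 = n := by omega
    rw [e] at hE
    exact ⟨hf, hE⟩
  · simp [block, Program.cost, Expr.cost]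
    omega

end

end CICograph

/-! ### Correctness of the checking phase. -/

namespace CICograph

open Memory Program

variable {W n N : ℕ} {s : Memory} {G : SimpleGraph (Fin n)}

theorem PT.IsCotree.eq_root {T : PT}
    (h : T.IsCotree (Finset.range N) (Finset.range n) (natAdj G))
    (hr : T.root ∈ Finset.range n) {v : ℕ} (hv : v < n) : v = T.root := by
  have hvX := h.tree.sub (Finset.mem_range.2 hv)
  exact (h.tree.anc_leaf hvX hr (h.tree.reach v hvX)).symm

theorem exists_poset_of_subsingleton (hn : n = 1) (h3 : s.reg 3 = 1) (h4 : s.arr 4 0 = 0)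
    (h5 : s.arr 5 0 = 0) :
    ∃ P : PartialOrder (Fin n), coverIncompGraph P = G ∧ StoresPoset s P (G ≠ ⊤) := by
  subst hn
  have e : ∀ v : Fin 1, (v : ℕ) = 0 := fun v => by omega
  exact storesPoset_rankedSum (r := 1) (κ := fun _ => 0) (ρ := fun _ => 0) (fun _ => Nat.zero_le 2)
    (fun i => ⟨0, Subsingleton.elim _ _⟩) (.inl fun _ => rfl)
    (fun u v huv => absurd (Subsingleton.elim u v) huv) h3 (fun v => by rw [e, h4]; rfl)
    fun v => by rw [e, h5]

theorem check_spec (h : (treeOf s).IsCotree (Finset.range N) (Finset.range n) (natAdj G))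
    (hn : 0 < n) (h1 : s.reg 1 = N) (h10 : s.reg 10 = n) (hN : N ≤ 3 * n) (hW : N + 2 ≤ W) :
    RunsWithin W check s (1200 * n) fun s' =>
      (¬ (treeOf s).InFamily (Finset.range N) (Finset.range n) ∧ s'.reg 0 = 1) ∨
      ((treeOf s).InFamily (Finset.range N) (Finset.range n) ∧ s'.reg 0 = 2 ∧
        ∃ P : PartialOrder (Fin n), coverIncompGraph P = G ∧ StoresPoset s' P (G ≠ ⊤)) := by
  have hnN := h.le
  refine (runsWithin_ite (B := 1100 * n) (fun hb => ?_) fun hb => ?_).mono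
    (by simp [Expr.cost]; omega) fun _ h => h
  · have hr : s.reg 2 < n := h10 ▸ Expr.lt_ne_zero.1 hb
    have hrV : (treeOf s).root ∈ Finset.range n := Finset.mem_range.2 hr
    -- A root that is a leaf is the only node above any vertex, so all vertices coincide with it.
    have hn1 : n = 1 := by
      have e1 := h.eq_root hrV hn
      have e2 := h.eq_root hrV (show n - 1 < n by omega)
      omega
    refine .of_wp ?_ (by simp [block, Program.cost, Expr.cost]; omega)
    simp [block, wp, Expr.eval]
    refine ⟨by omega, by omega, .inl hrV, exists_poset_of_subsingleton hn1 ?_ ?_ ?_⟩ <;> simp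
  have hr : (treeOf s).root ∉ Finset.range n := by
    rw [Finset.mem_range, not_lt]
    exact h10 ▸ Expr.lt_eq_zero.1 hb
  refine (runsWithin_ite (B := 1000 * n) (fun hb => ?_) fun hb => ?_).mono
    (by simp [Expr.cost]; omega) fun _ h => h
  swap
  · refine .of_wp ?_ (by simp [Program.cost, Expr.cost]; omega)
    refine ⟨by simp [Expr.eval]; omega, .inl ⟨fun hfam => ?_, by simp [Expr.eval]⟩⟩
    exact Expr.eq_eq_zero.1 hb (hfam.resolve_left hr).1
  have hlab : (treeOf s).lab (treeOf s).root = 1 := Expr.eq_ne_zero.1 hb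
  refine (runsWithin_seq ((scan_spec h1 h10 hnN hW).mono (B' := 400 * n) (by omega)
    fun s₁ hs₁ => ?_)).mono
    (B := _ + 510 * n) (by omega) fun _ h => h
  obtain ⟨hf₁, hcase⟩ := hs₁
  refine (runsWithin_ite (B := 500 * n) (fun hb => ?_) fun hb => ?_).mono
    (by simp [Expr.cost]; omega) fun _ h => h
  · have hbad := (hcase.resolve_left fun e => hb e.1).2
    refine .of_wp ?_ (by simp [Program.cost, Expr.cost]; omega)
    refine ⟨by simp [Expr.eval]; omega, .inl ⟨fun hfam => hbad fun x hx => ?_, by simp [Expr.eval]⟩⟩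
    obtain ⟨hx, hxV, hx0⟩ := Finset.mem_filter.1 hx |>.imp id id
    exact (hfam.resolve_left hr).2.2 x hx hxV hx0
  obtain ⟨-, hzero, himg, hcard⟩ := hcase.resolve_right fun e => e.1 hb
  obtain ⟨z, hz⟩ : ∃ z, s₁.reg 17 = z := ⟨_, rfl⟩
  obtain ⟨idx, hidx⟩ : ∃ idx, s₁.arr 13 = idx := ⟨_, rfl⟩
  rw [hz] at himg hcard
  rw [hidx] at himg
  have hT := treeOf_eq hf₁ (by simp) (by simp)
  have hzN : z ≤ N := by
    rw [← hcard]
    exact (Finset.card_filter_le _ _).trans (by simp)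
  have hemit := emit_spec (W := W) (s := s₁) (G := G) (z := z) (idx := idx) (hT.symm ▸ h)
    (hT.symm ▸ hr) (fun x hx => by
      rw [← Finset.mem_range, ← himg]
      exact Finset.mem_image_of_mem _ (hT ▸ hx)) hidx hz ((hf₁.1 10 (by simp)).trans h10) hzN hW
  rw [hT] at hemit
  refine (runsWithin_seq (hemit.mono le_rfl fun s₂ hs₂ => ?_)).mono
    (B := _ + 100) (by omega) fun _ h => h
  obtain ⟨hf₂, hE⟩ := hs₂
  have r17 := (hf₂.1 17 (by simp)).trans hz
  have hcount : s₂.reg 18 = ({x ∈ Finset.range n | (treeOf s).par x = (treeOf s).root}).card :=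
    hE.count
  refine (runsWithin_ite (B := 50) (fun hb => ?_) fun hb => ?_).mono
    (by simp [Expr.cost]) fun _ h => h
  · have hlt : s₂.reg 18 < z := r17 ▸ Expr.lt_ne_zero.1 hb
    refine .of_wp ?_ (by simp [Program.cost, Expr.cost])
    refine ⟨by simp [Expr.eval]; omega, .inl ⟨fun hfam => ?_, by simp [Expr.eval]⟩⟩
    have := (hfam.resolve_left hr).2.1
    rw [← hcount] at this
    exact absurd (hcard.symm.trans_le this) (by omega)
  · have hle : z ≤ s₂.reg 18 := r17 ▸ Expr.lt_eq_zero.1 hb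
    have hzero' : ∀ x ∈ Finset.range N, x ∉ Finset.range n → (treeOf s).lab x = 0 →
        (treeOf s).nc x = 2 ∧ (treeOf s).par x = (treeOf s).root := fun x hx hxV hx0 =>
      hzero x (Finset.mem_filter.2 ⟨hx, hxV, hx0⟩)
    have hfam : (treeOf s).InFamily (Finset.range N) (Finset.range n) :=
      .inr ⟨hlab, hcount ▸ hcard.trans_le hle, hzero'⟩
    have hranked : ∀ t : Memory, t.arr = s₂.arr → t.reg 3 = max z 1 →
        (treeOf s).Ranked n N z idx t := fun t ht h3 =>
      { root_notMem := hr
        lab_root := hlab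
        zero := hzero'
        img := himg
        card := hcard
        root := ht.symm ▸ hE.root
        surj := fun i hi => ht.symm ▸ hE.surj i hi (by omega)
        nonroot := ht.symm ▸ hE.nonroot
        reg := h3 }
    refine .of_wp ?_ (by simp [block, Program.cost, Expr.cost])
    simp [block, wp, Expr.eval, r17]
    refine ⟨by omega, fun hz0 => ⟨by omega, hfam, ?_⟩, fun hz0 => ⟨by omega, hfam, ?_⟩⟩
    · exact (hranked _ (by simp [setReg]) (by simp [hz0])).exists_poset h hn
    · exact (hranked _ (by simp [setReg]) (by simp; omega)).exists_poset h hn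

theorem storesCotree_toCotree (h : (treeOf s).IsCotree (Finset.range N) (Finset.range n) (natAdj G))
    (h1 : s.reg 1 = N) : StoresCotree s h.toCotree := by
  refine ⟨h1, rfl, fun v => rfl, fun x => rfl, fun x hx => ?_⟩
  rw [h.isLeaf_iff] at hx
  have := h.reduced.lab_le x (Finset.mem_range.2 x.2) hx
  change (treeOf s).lab x = if decide ((treeOf s).lab x = 1) = true then 1 else 0
  split_ifs with hl
  · exact of_decide_eq_true hl
  · have := of_decide_eq_false (eq_false_of_ne_true hl)
    omega

end CICograph

namespace CICograph

open Memory Program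

/-! ### The whole algorithm -/

theorem two_phases {n : ℕ} (hn : 0 < n) (G : SimpleGraph (Fin n)) (adj : Fin n → List (Fin n))
    (hadj : IsAdjacencyLists G adj) {W : ℕ} (hW : 9 * (n * n) + 12 * n ≤ W) :
    RunsWithin W build (inputMemory n adj) (7000 * (n + G.edgeSet.ncard)) (fun s₁ =>
      (¬ IsCograph G ∧ s₁.reg 0 = 0) ∨
      (IsCograph G ∧ s₁.reg 0 = 1 ∧
        ∃ (N : ℕ) (T : Cotree (Fin n) N), StoresCotree s₁ T ∧ T.graph = G ∧
          (IsCIGraph G ↔ T.InTC) ∧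
          RunsWithin W check s₁ (1200 * n) (fun s₂ =>
            (¬ T.InTC ∧ s₂.reg 0 = 1) ∨
            (T.InTC ∧ s₂.reg 0 = 2 ∧
              ∃ P : PartialOrder (Fin n),
                coverIncompGraph P = G ∧ StoresPoset s₂ P (G ≠ ⊤))))) := by
  refine (build_spec hadj hW hn).mono le_rfl fun s hs => ?_
  rw [isCograph_iff]
  rcases hs with ⟨h0, hP4⟩ | ⟨h0, h10, -, hN, h⟩
  · exact .inl ⟨hP4, h0⟩
  · have hcheck := check_spec h hn rfl h10 hN (W := W) (by nlinarith)
    refine .inr ⟨noP4_of_isCotree h, h0, _, h.toCotree, storesCotree_toCotree h rfl,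
      h.toCotree_graph, ?_, ?_⟩
    · rw [h.inTC_iff]
      -- Sufficiency needs no separate argument: the poset that the checking phase outputs is a
      -- witness.
      refine ⟨h.inFamily_of_isCIGraph, fun hfam => ?_⟩
      obtain ⟨_, s', _, _, hs'⟩ := hcheck
      obtain ⟨-, -, P, hP, -⟩ := hs'.resolve_left fun e => e.1 hfam
      exact ⟨P, hP⟩
    · rwa [h.inTC_iff]

/-- With `m = 3 * n` bounding the node numbers, child sums are at most `m * m`; the left side is `m
* m + 4 * m`, the bound used throughout the construction. -/
theorem word_bound (n c : ℕ) (hc : 5 ≤ c) : 9 * (n * n) + 12 * n ≤ (n + 2) ^ c :=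
  calc 9 * (n * n) + 12 * n ≤ (n + 2) ^ 2 * 2 ^ 3 + n * n := by nlinarith
    _ ≤ (n + 2) ^ 2 * (n + 2) ^ 3 := by
      nlinarith [Nat.zero_le (n ^ 2), Nat.zero_le (n ^ 3), Nat.zero_le (n ^ 4), Nat.zero_le (n ^ 5)]
    _ = (n + 2) ^ 5 := by ring
    _ ≤ (n + 2) ^ c := Nat.pow_le_pow_right (by omega) hc

end CICograph

open CICograph

theorem mainTheorem8 :
    ∃ (build check : Program) (c : ℕ),
      ∀ (n : ℕ), 0 < n → ∀ (G : SimpleGraph (Fin n)) (adj : Fin n → List (Fin n)),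
        IsAdjacencyLists G adj →
          -- the whole algorithm is linear and recognizes C-I cographs, with a witnessing poset
          RunsWithin ((n + 2) ^ c) (recognizer build check) (inputMemory n adj)
            (c * (n + G.edgeSet.ncard)) (fun s =>
              (¬ IsCograph G ∧ s.reg 0 = 0) ∨
              (IsCograph G ∧ ¬ IsCIGraph G ∧ s.reg 0 = 1) ∨
              (IsCograph G ∧ IsCIGraph G ∧ s.reg 0 = 2 ∧
                ∃ P : PartialOrder (Fin n),
                  coverIncompGraph P = G ∧ StoresPoset s P (G ≠ ⊤))) ∧
          -- its two phases: construction of the cotree, and the check against the family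
          RunsWithin ((n + 2) ^ c) build (inputMemory n adj) (c * (n + G.edgeSet.ncard)) (fun s₁ =>
            (¬ IsCograph G ∧ s₁.reg 0 = 0) ∨
            (IsCograph G ∧ s₁.reg 0 = 1 ∧
              ∃ (N : ℕ) (T : Cotree (Fin n) N), StoresCotree s₁ T ∧ T.graph = G ∧
                (IsCIGraph G ↔ T.InTC) ∧
                RunsWithin ((n + 2) ^ c) check s₁ (c * n) (fun s₂ =>
                  (¬ T.InTC ∧ s₂.reg 0 = 1) ∨
                  (T.InTC ∧ s₂.reg 0 = 2 ∧
                    ∃ P : PartialOrder (Fin n),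
                      coverIncompGraph P = G ∧ StoresPoset s₂ P (G ≠ ⊤))))) := by
  -- The constant only has to exceed the sum of the step bounds, 7000 for the construction and 2000
  -- for the test of register 0 together with the check, and to be at least 5 as an exponent.
  refine ⟨CICograph.build, CICograph.check, 10000, fun n hn G adj hadj => ?_⟩
  have hW := word_bound n 10000 (by norm_num)
  have h := two_phases hn G adj hadj hW
  generalize (n + 2) ^ 10000 = W at h
  refine ⟨(runsWithin_seq (B₂ := 2000 * n) (h.mono le_rfl fun s hs => ?_)).mono (by omega)
    fun _ h => h, h.mono (by omega) fun s hs => hs.imp id ?_⟩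
  · rcases hs with ⟨hG, h0⟩ | ⟨hG, h0, N, T, -, -, hT, hcheck⟩
    · refine (runsWithin_ite (b := .reg 0) (B := 1) (fun hb => absurd h0 hb) fun _ => ?_).mono
        (by simp [Expr.cost]; omega) fun _ h => h
      exact .of_wp (p := .skip) (.inl ⟨hG, h0⟩) (by simp [Program.cost])
    · refine (runsWithin_ite (b := .reg 0) (fun _ => hcheck) fun hb => absurd (h0.symm.trans hb)
        one_ne_zero).mono (by simp [Expr.cost]; omega) fun s' hs' => .inr ?_
      rw [hT]
      exact hs'.imp (fun h => ⟨hG, h⟩) fun h => ⟨hG, h⟩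
  · exact fun ⟨hG, h0, N, T, h1, h2, h3, h4⟩ =>
      ⟨hG, h0, N, T, h1, h2, h3, h4.mono (by omega) fun _ h => h⟩
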